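/- Let $\mathbf H^2$ be the hyperbolic plane with boundary circle $\partial\mathbf H^2$, and give $\mathbf H^2\times\mathbf R$ the product metric $\sqrt{d_{\mathbf H^2}^2+|s-t|^2}$. A map $f:X\to Y$ of metric spaces is a $(\lambda,\epsilon,\delta)$-quasi-isometry ($\lambda>0$) if $\frac1\lambda d(x_1,x_2)-\epsilon\le d(f(x_1),f(x_2))\le\lambda d(x_1,x_2)+\epsilon$ for all $x_1,x_2\in X$ and every $y\in Y$ is at distance at most $\delta$ from some point of $f(X)$. Let $\Gamma$ be a group with the word metric $d_S(g,h)=\min\{n : ga_1\cdots a_n=h,\ a_i\in S\}$ of a finite generating set $S=S^{-1}$. Suppose that $\Gamma$ is quasi-isometric to $\mathbf H^2\times\mathbf R$: there are $(\lambda,\epsilon,\delta)$-quasi-isometries $\psi:\Gamma\to\mathbf H^2\times\mathbf R$ and $\omega:\mathbf H^2\times\mathbf R\to\Gamma$ and a constant $\kappa$ with $d(g,\omega(\psi(g)))\le\kappa$ and $d(y,\psi(\omega(y)))\le\kappa$ for all $g\in\Gamma$ and $y\in\mathbf H^2\times\mathbf R$. For $u\in\Gamma$ put $\phi_u(y)=\psi(u\cdot\omega(y))$,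 let $\pi:\mathbf H^2\times\mathbf R\to\mathbf H^2\times\{0\}$ be the projection, and regard $\pi\circ\phi_u$, restricted to $\mathbf H^2\times\{0\}$, as a map $f_u:\mathbf H^2\to\mathbf H^2$. A map $b:\partial\mathbf H^2\to\partial\mathbf H^2$ is said to give the boundary values of $f:\mathbf H^2\to\mathbf H^2$ if for every geodesic ray $\gamma$ with endpoint $x\in\partial\mathbf H^2$ the image $f(\gamma)$ lies within bounded distance of a geodesic ray with endpoint $b(x)$. A homeomorphism of $\partial\mathbf H^2$ is quasisymmetric if it is the continuous extension to $\partial\mathbf H^2$ of a quasiconformal homeomorphism of $\mathbf H^2$, that is, of a (possibly orientation-reversing) homeomorphism whose linear dilatation $\limsup_{r\to0}\frac{\sup\{d(f(x),f(y)) : d(x,y)\le r\}}{\inf\{d(f(x),f(z)) : d(x,z)\ge r\}}$ is at most some constant $H$ at all points $x$. A group of homeomorphisms of $\partial\mathbf H^2$ is uniformly quasisymmetric if one constant $H$ serves for all its elements. Corollary 3.7. For every $u\in\Gamma$ there is exactly one map $\Xi(u):\partial\mathbf H^2\to\partial\mathbf H^2$ that gives the boundary values of $f_u$, and it is a homeomorphism.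 The set $F$ of the homeomorphisms of $\partial\mathbf H^2$ that give the boundary values of some $f_u$, $u\in\Gamma$, is a group under composition and is uniformly quasisymmetric, and $\Xi:\Gamma\to F$ is a surjective homomorphism. -/

import Mathlib

open Set Filter Topology
open scoped NNReal

/-- The product `ℍ² × ℝ` with the metric `√(d_ℍ² + |s - t|²)`; the hyperbolic plane is the upper
half plane with its metric of curvature `-1`. -/
abbrev H2R : Type := WithLp 2 (UpperHalfPlane × ℝ)

/-- Word metric: `d_S(g, h)` is the least `n` with `g a₁ a₂ ⋯ aₙ = h` for some `aᵢ ∈ S`. -/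
noncomputable def wordDist {Γ : Type*} [Group Γ] (S : Set Γ) (g h : Γ) : ℝ :=
  ((sInf {n : ℕ | ∃ l : List Γ, l.length = n ∧ (∀ a ∈ l, a ∈ S) ∧ g * l.prod = h} : ℕ) : ℝ)

/-- `f` is a `(lam, eps, del)`-quasi-isometry from `X` with distance function `dX` to `Y` with
distance function `dY`, almost surjectivity included. -/
structure IsQuasiIsometry {X Y : Type*} (dX : X → X → ℝ) (dY : Y → Y → ℝ)
    (lam eps del : ℝ) (f : X → Y) : Prop where
  lam_pos : 0 < lam
  lower : ∀ x₁ x₂, 1 / lam * dX x₁ x₂ - eps ≤ dY (f x₁) (f x₂)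
  upper : ∀ x₁ x₂, dY (f x₁) (f x₂) ≤ lam * dX x₁ x₂ + eps
  almost_surj : ∀ y, ∃ x, dY y (f x) ≤ del

/-- `ψ` and `ω` are `(lam, eps, del)`-quasi-isometries that are inverse to each other up to an
error `kap`. -/
structure AreQuasiInverse {X Y : Type*} (dX : X → X → ℝ) (dY : Y → Y → ℝ)
    (lam eps del kap : ℝ) (ψ : X → Y) (ω : Y → X) : Prop where
  quasiIsometry : IsQuasiIsometry dX dY lam eps del ψ
  quasiIsometry_inv : IsQuasiIsometry dY dX lam eps del ω
  left_inv : ∀ x, dX x (ω (ψ x)) ≤ kap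
  right_inv : ∀ y, dY y (ψ (ω y)) ≤ kap

/-- The quasi-action `φ_u = ψ ∘ u ∘ ω`, with `u` acting on `Γ` by left multiplication. -/
def quasiAction {Γ X : Type*} [Group Γ] (ψ : Γ → X) (ω : X → Γ) (u : Γ) (x : X) : X :=
  ψ (u * ω x)

/-- `π ∘ φ` restricted to `ℍ² × {0}`, where `π` is the projection to `ℍ² × {0}`, and
`ℍ² × {0}` is identified with `ℍ²`. -/
def horizontalPart (φ : H2R → H2R) (z : UpperHalfPlane) : UpperHalfPlane :=
  (WithLp.ofLp (φ (WithLp.toLp 2 (z, 0)))).1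

/-- The circle `∂ℍ² = ℝ ∪ {∞}`. -/
abbrev BoundaryH2 : Type := OnePoint ℝ

/-- The inclusion of `ℍ²` in the Riemann sphere `ℂ ∪ {∞}`. -/
def toSphere (z : UpperHalfPlane) : OnePoint ℂ := ((z : ℂ) : OnePoint ℂ)

/-- The inclusion of `∂ℍ² = ℝ ∪ {∞}` in the Riemann sphere `ℂ ∪ {∞}`. -/
def boundaryToSphere (x : BoundaryH2) : OnePoint ℂ := OnePoint.map (fun t : ℝ => (t : ℂ)) x

/-- `γ` is a (unit speed) geodesic ray of `ℍ²` with endpoint `x ∈ ∂ℍ²`. -/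
def IsRayTo (γ : ℝ≥0 → UpperHalfPlane) (x : BoundaryH2) : Prop :=
  Isometry γ ∧ Tendsto (fun t => toSphere (γ t)) atTop (𝓝 (boundaryToSphere x))

/-- `b` is the map of boundary values of `f` (not necessarily continuous): for each geodesic ray
`γ` ending at `x`, the image `f(γ)` is within bounded distance of a geodesic ray ending
at `b x`. -/
def HasBoundaryValues (f : UpperHalfPlane → UpperHalfPlane) (b : BoundaryH2 → BoundaryH2) : Prop :=
  ∀ (x : BoundaryH2) (γ : ℝ≥0 → UpperHalfPlane), IsRayTo γ x →
    ∃ γ' : ℝ≥0 → UpperHalfPlane, IsRayTo γ' (b x) ∧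
      ∃ C : ℝ, ∀ t, ∃ s, dist (f (γ t)) (γ' s) ≤ C

/-- `b` is the continuous extension of `f` to `∂ℍ²`: `f z → b x` as `z → x` from
inside `ℍ²`, for each `x ∈ ∂ℍ²`. -/
def ExtendsContinuouslyBy (f : UpperHalfPlane → UpperHalfPlane) (b : BoundaryH2 → BoundaryH2) :
    Prop :=
  ∀ x : BoundaryH2, Tendsto (fun z => toSphere (f z))
    (comap toSphere (𝓝 (boundaryToSphere x))) (𝓝 (boundaryToSphere (b x)))

/-- The metric definition of quasiconformality: the homeomorphism `f` has linear dilatation at most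
`H` at every point, that is `limsup_{r → 0} L(x, r) / l(x, r) ≤ H` for
`L(x, r) = sup {d(f x, f y) | d(x, y) ≤ r}` and `l(x, r) = inf {d(f x, f z) | d(x, z) ≥ r}`. -/
def IsQuasiconformal {X : Type*} [MetricSpace X] (H : ℝ) (f : X ≃ₜ X) : Prop :=
  ∀ x : X, ∀ H' > H, ∀ᶠ r in 𝓝[>] (0 : ℝ), ∀ y z : X, dist x y ≤ r → r ≤ dist x z →
    dist (f x) (f y) ≤ H' * dist (f x) (f z)

/-- A homeomorphism of the circle `∂ℍ²` is quasisymmetric (with constant `H`) when it extends to a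
quasiconformal homeomorphism of `ℍ²` (with linear dilatation at most `H`). Orientation may be
reversed. -/
def IsQuasisymmetric (H : ℝ) (g : BoundaryH2 ≃ₜ BoundaryH2) : Prop :=
  ∃ f : UpperHalfPlane ≃ₜ UpperHalfPlane, IsQuasiconformal H f ∧ ExtendsContinuouslyBy f g

/-- A group of homeomorphisms of `∂ℍ²` is uniformly quasisymmetric when its elements are
quasisymmetric with a common constant. -/
def IsUniformlyQuasisymmetric (F : Subgroup (BoundaryH2 ≃ₜ BoundaryH2)) : Prop :=
  ∃ H : ℝ, ∀ g ∈ F, IsQuasisymmetric H g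

/-! The maps `quasiAction ψ ω u` compose like the elements `u` up to a bounded error, with constants
independent of `u` because `wordDist` is left invariant. If their horizontal parts were coarsely
well-behaved maps of `ℍ²`, boundary extension would turn this approximate action into an exact one.
The difficulty is the factor `ℝ`: a quasi-isometry of `ℍ² × ℝ` does not respect the product, and it
has to be shown that fibres go to bounded neighbourhoods of fibres.

Suppose that a fibre segment of length `l` acquires a horizontal displacement `D`, and let `w` be
the midpoint of the horizontal images of its ends. The fibre over `w` pulls back to a quasi-line.
Since `ℍ²` has exponentially many directions, one of them leads away from the relevant stretch of
this quasi-line (`exists_generic_direction`), so the ends of the segment are joined by a detour that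
avoids it. The horizontal image of the detour avoids a ball about `w` whose radius is proportional
to `D` up to logarithmic errors. In `ℍ²` this requires exponential length, whereas the length of the
detour is linear in `l`. Hence `D = O(log l)` (`AreCoarseInverse.fibre_log_bound_of_le`).

Sublinear displacement is enough to bootstrap. It makes every horizontal slice a quasi-isometric
embedding (`exists_slice_lower_bound`) and gives a Morse lemma with sublinear error, which a dyadic
argument improves to bounded error (`exists_slice_morse`). Slices at two heights send a far away
triple in the same directions, so the images of its centre are close, and fibres are displaced by a
bounded amount (`exists_fibre_bound`).

A map satisfying the Morse lemma distorts Gromov products coarsely linearly from below, hence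
extends to the circle, and the extension gives its boundary values
(`IsMorseMap.hasBoundaryValues_iff`). Maps at bounded distance have the same extension, so `Ξ` is a
homomorphism. For quasisymmetry, isometries reduce the boundary map to an increasing homeomorphism
of `ℝ`. The point above `x` at height `t` is a coarse centre of `x`, `x ± t` and `∞`, so the images
of both intervals have length comparable to the height of its image. The Beurling–Ahlfors extension
then supplies the quasiconformal homeomorphism. -/

/-! ### The upper half plane as a hyperbolic metric space -/

/-- The Gromov product of `x` and `y` seen from `w`. -/
noncomputable def gromovProd {X : Type*} [PseudoMetricSpace X] (w x y : X) : ℝ :=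
  (dist x w + dist y w - dist x y) / 2

section GromovProd

variable {X : Type*} [PseudoMetricSpace X]

theorem gromovProd_comm (w x y : X) : gromovProd w x y = gromovProd w y x := by
  simp only [gromovProd, dist_comm x y]; ring

theorem gromovProd_self (w x : X) : gromovProd w x x = dist x w := by
  simp [gromovProd]

theorem gromovProd_le_left (w x y : X) : gromovProd w x y ≤ dist x w := by
  have := dist_triangle_left y w x
  simp only [gromovProd]
  linarith

theorem gromovProd_le_right (w x y : X) : gromovProd w x y ≤ dist y w := by
  rw [gromovProd_comm]; exact gromovProd_le_left w y x

theorem gromovProd_nonneg (w x y : X) : 0 ≤ gromovProd w x y := by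
  have := dist_triangle_right x y w
  simp only [gromovProd]
  linarith

theorem le_gromovProd_add_dist (w x y x' : X) :
    gromovProd w x y ≤ gromovProd w x' y + dist x x' := by
  have h1 := dist_triangle x x' w
  have h2 := dist_triangle_left x' y x
  simp only [gromovProd]
  linarith

theorem gromovProd_base (w w' x y : X) :
    gromovProd w x y ≤ gromovProd w' x y + dist w w' := by
  have h1 := dist_triangle x w' w
  have h2 := dist_triangle y w' w
  rw [dist_comm w' w] at h1 h2
  simp only [gromovProd]
  linarith

theorem gromovProd_add_gromovProd (w x y : X) :
    gromovProd w x y + gromovProd x w y = dist x w := by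
  rw [gromovProd, gromovProd, dist_comm w x, dist_comm y x, dist_comm w y]
  ring

end GromovProd

namespace UpperHalfPlane

theorem exp_half_dist_le (z w : UpperHalfPlane) :
    Real.exp (dist z w / 2) ≤ 2 * Real.sinh (dist z w / 2) + 1 := by
  have h : Real.exp (-(dist z w / 2)) ≤ 1 := by
    rw [Real.exp_le_one_iff]; have := dist_nonneg (x := z) (y := w); linarith
  rw [Real.sinh_eq]; linarith

/-- By `sinh_half_dist` all three products have the same denominator, four times the product of the
roots of the imaginary parts, so Ptolemy's inequality in `ℂ` transfers. -/
theorem ptolemy (a b c d : UpperHalfPlane) :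
    Real.sinh (dist a c / 2) * Real.sinh (dist b d / 2) ≤
      Real.sinh (dist a b / 2) * Real.sinh (dist c d / 2) +
        Real.sinh (dist b c / 2) * Real.sinh (dist a d / 2) := by
  have h := EuclideanGeometry.mul_dist_le_mul_dist_add_mul_dist (a : ℂ) b c d
  have ha := a.im_pos
  have hb := b.im_pos
  have hc := c.im_pos
  have hd := d.im_pos
  simp only [sinh_half_dist, Real.sqrt_mul ha.le, Real.sqrt_mul hb.le, Real.sqrt_mul hc.le]
  have ha' := Real.sqrt_pos.2 ha
  have hb' := Real.sqrt_pos.2 hb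
  have hc' := Real.sqrt_pos.2 hc
  have hd' := Real.sqrt_pos.2 hd
  have key : ∀ p q : ℝ, ∀ x y z w : ℝ, 0 < x → 0 < y → 0 < z → 0 < w →
      p / (2 * (x * y)) * (q / (2 * (z * w))) = p * q / (4 * (x * y * z * w)) := by
    intros; field_simp; ring
  rw [key _ _ _ _ _ _ ha' hc' hb' hd', key _ _ _ _ _ _ ha' hb' hc' hd',
    key _ _ _ _ _ _ hb' hc' ha' hd']
  set D := 4 * (√a.im * √b.im * √c.im * √d.im) with hD
  rw [show 4 * (√a.im * √c.im * √b.im * √d.im) = D by rw [hD]; ring,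
    show 4 * (√b.im * √c.im * √a.im * √d.im) = D by rw [hD]; ring, ← add_div]
  have hDpos : 0 < D := by positivity
  gcongr

/-- The four point condition: the hyperbolic plane is Gromov hyperbolic. -/
theorem four_point (a b c d : UpperHalfPlane) :
    dist a c + dist b d ≤ max (dist a b + dist c d) (dist b c + dist a d) + 4 := by
  set M := max (dist a b + dist c d) (dist b c + dist a d) with hM
  have hM1 : dist a b + dist c d ≤ M := le_max_left _ _
  have hM2 : dist b c + dist a d ≤ M := le_max_right _ _
  have s0 : ∀ z w : UpperHalfPlane, 0 ≤ Real.sinh (dist z w / 2) := fun z w =>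
    Real.sinh_nonneg_iff.2 (by positivity)
  have e1 : ∀ z w : UpperHalfPlane, 2 * Real.sinh (dist z w / 2) ≤ Real.exp (dist z w / 2) := by
    intro z w
    rw [Real.sinh_eq]
    have := Real.exp_pos (-(dist z w / 2))
    linarith
  have hexp : ∀ t, t ≤ M / 2 → Real.exp t ≤ Real.exp (M / 2) := fun t ht => Real.exp_le_exp.2 ht
  have t1 := dist_triangle a b c
  have t2 := dist_triangle_right a c d
  have t3 := dist_triangle b c d
  have t4 := dist_triangle_left b d a
  have b1 : Real.exp (dist a c / 2) ≤ Real.exp (M / 2) := hexp _ (by linarith)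
  have b2 : Real.exp (dist b d / 2) ≤ Real.exp (M / 2) := hexp _ (by linarith)
  have b3 : Real.exp (dist a b / 2) * Real.exp (dist c d / 2) ≤ Real.exp (M / 2) := by
    rw [← Real.exp_add]; exact hexp _ (by linarith)
  have b4 : Real.exp (dist b c / 2) * Real.exp (dist a d / 2) ≤ Real.exp (M / 2) := by
    rw [← Real.exp_add]; exact hexp _ (by linarith)
  have c3 : (2 * Real.sinh (dist a b / 2)) * (2 * Real.sinh (dist c d / 2)) ≤ Real.exp (M / 2) :=
    (mul_le_mul (e1 _ _) (e1 _ _) (by have := s0 c d; positivity) (Real.exp_pos _).le).trans b3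
  have c4 : (2 * Real.sinh (dist b c / 2)) * (2 * Real.sinh (dist a d / 2)) ≤ Real.exp (M / 2) :=
    (mul_le_mul (e1 _ _) (e1 _ _) (by have := s0 a d; positivity) (Real.exp_pos _).le).trans b4
  -- Ptolemy's inequality with `sinh` replaced by exponentials; `b1` and `b2` absorb the linear
  -- terms. The right side is at most `5 * exp (M / 2)`, and `5 ≤ exp 2` yields the additive
  -- constant `4`.
  have main : Real.exp (dist a c / 2) * Real.exp (dist b d / 2) ≤ 4 * Real.exp (M / 2) + 1 := by
    calc Real.exp (dist a c / 2) * Real.exp (dist b d / 2)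
        ≤ (2 * Real.sinh (dist a c / 2) + 1) * (2 * Real.sinh (dist b d / 2) + 1) :=
          mul_le_mul (exp_half_dist_le _ _) (exp_half_dist_le _ _) (Real.exp_pos _).le
            (by have := s0 a c; positivity)
      _ ≤ 4 * Real.exp (M / 2) + 1 := by
          have := ptolemy a b c d
          have := e1 a c
          have := e1 b d
          nlinarith
  have h1 : (1 : ℝ) ≤ Real.exp (M / 2) := Real.one_le_exp (by
    have := dist_nonneg (x := a) (y := b)
    have := dist_nonneg (x := c) (y := d)
    linarith)
  have h5 : (5 : ℝ) ≤ Real.exp 2 := by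
    have h := Real.exp_one_gt_d9
    have h' : Real.exp 2 = Real.exp 1 ^ 2 := by rw [← Real.exp_nat_mul]; norm_num
    rw [h']
    nlinarith
  by_contra hcon
  push Not at hcon
  have h6 : Real.exp (M / 2) * Real.exp 2 <
      Real.exp (dist a c / 2) * Real.exp (dist b d / 2) := by
    rw [← Real.exp_add, ← Real.exp_add]; exact Real.exp_lt_exp.2 (by linarith)
  nlinarith

theorem min_gromovProd_le (w x y z : UpperHalfPlane) :
    min (gromovProd w x y) (gromovProd w y z) ≤ gromovProd w x z + 2 := by
  have h := four_point x y z w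
  simp only [gromovProd]
  rcases le_total (dist x y + dist z w) (dist y z + dist x w) with h1 | h1
  · rw [max_eq_right h1] at h
    exact (min_le_right _ _).trans (by linarith)
  · rw [max_eq_left h1] at h
    exact (min_le_left _ _).trans (by linarith)

theorem le_gromovProd_of_le {w x y z : UpperHalfPlane} {r : ℝ} (h1 : r ≤ gromovProd w x y)
    (h2 : r ≤ gromovProd w y z) : r - 2 ≤ gromovProd w x z := by
  have := min_gromovProd_le w x y z
  have := le_min h1 h2
  linarith

/-- The point `x + i eᵗ`. -/
noncomputable def vert (x t : ℝ) : UpperHalfPlane := ⟨⟨x, Real.exp t⟩, Real.exp_pos t⟩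

@[simp] theorem vert_re (x t : ℝ) : (vert x t).re = x := rfl
@[simp] theorem vert_im (x t : ℝ) : (vert x t).im = Real.exp t := rfl

theorem vert_re_log_im (z : UpperHalfPlane) : vert z.re (Real.log z.im) = z := by
  apply UpperHalfPlane.ext
  apply Complex.ext
  · rfl
  · exact Real.exp_log z.im_pos

theorem exists_eq_vert (z : UpperHalfPlane) : ∃ x t, z = vert x t :=
  ⟨_, _, (vert_re_log_im z).symm⟩

theorem dist_vert_vert_same (x s t : ℝ) : dist (vert x s) (vert x t) = |s - t| := by
  rw [dist_of_re_eq (by simp)]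
  simp [Real.dist_eq]

theorem abs_sub_le_dist_vert (x x' s t : ℝ) : |s - t| ≤ dist (vert x s) (vert x' t) := by
  have := dist_log_im_le (vert x s) (vert x' t)
  simpa [Real.dist_eq] using this

theorem sqrt_im_vert (x x' s t : ℝ) :
    √((vert x s).im * (vert x' t).im) = Real.exp ((s + t) / 2) := by
  rw [vert_im, vert_im, ← Real.exp_add, Real.exp_half]

theorem dist_vert_horizontal (x x' t : ℝ) :
    dist (vert x t) (vert x' t) ≤ |x - x'| / Real.exp t := by
  have h := dist_le_dist_coe_div_sqrt (vert x t) (vert x' t)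
  rw [sqrt_im_vert] at h
  have h2 : dist ((vert x t : UpperHalfPlane) : ℂ) (vert x' t) = |x - x'| := by
    rw [Complex.dist_of_im_eq (by rfl), Real.dist_eq]; rfl
  rw [h2] at h
  simpa using h

theorem abs_sub_le_exp_dist (x x' s t : ℝ) :
    |x - x'| ≤ Real.exp ((dist (vert x s) (vert x' t) + s + t) / 2) := by
  have h := sinh_half_dist (vert x s) (vert x' t)
  rw [sqrt_im_vert] at h
  have h2 : |x - x'| ≤ dist ((vert x s : UpperHalfPlane) : ℂ) (vert x' t) := by
    rw [Complex.dist_eq]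
    exact Complex.abs_re_le_norm (((vert x s : UpperHalfPlane) : ℂ) - (vert x' t))
  have h3 : 2 * Real.sinh (dist (vert x s) (vert x' t) / 2) ≤
      Real.exp (dist (vert x s) (vert x' t) / 2) := by
    rw [Real.sinh_eq]
    have := Real.exp_pos (-(dist (vert x s) (vert x' t) / 2))
    linarith
  rw [h] at h3
  rw [show (dist (vert x s) (vert x' t) + s + t) / 2 =
    dist (vert x s) (vert x' t) / 2 + (s + t) / 2 by ring, Real.exp_add]
  refine h2.trans ?_
  have := Real.exp_pos ((s + t) / 2)
  rw [mul_div_assoc', mul_div_mul_left _ _ (by norm_num : (2 : ℝ) ≠ 0), div_le_iff₀ this] at h3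
  exact h3

theorem two_mul_log_le_dist (x x' s t : ℝ) (hx : x ≠ x') :
    2 * Real.log |x - x'| - s - t ≤ dist (vert x s) (vert x' t) := by
  have h := Real.log_le_log (abs_pos.2 (sub_ne_zero.2 hx)) (abs_sub_le_exp_dist x x' s t)
  rw [Real.log_exp] at h
  linarith

/-- Rough geodesics: the path that goes up from `a`, across, and down to `b`. -/
theorem exists_rough_geodesic (a b : UpperHalfPlane) :
    ∃ (c : ℝ → UpperHalfPlane) (T : ℝ), 0 ≤ T ∧ T ≤ dist a b ∧ dist a b ≤ T + 1 ∧
      (∀ r, 0 ≤ r → r ≤ T → dist a (c r) ≤ r + 1 ∧ dist (c r) b ≤ T - r + 1) ∧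
      (∀ r s, dist (c r) (c s) ≤ |r - s| + 1) ∧ c T = b ∧ dist (c 0) a ≤ 1 := by
  obtain ⟨x, s, rfl⟩ := exists_eq_vert a
  obtain ⟨y, t, rfl⟩ := exists_eq_vert b
  -- `h` is the height at which the crossing costs at most `1`, or the height of the higher end if
  -- that is larger.
  obtain ⟨h, hs, ht, hd, hT⟩ : ∃ h, s ≤ h ∧ t ≤ h ∧ |x - y| ≤ Real.exp h ∧
      (h - s) + (h - t) ≤ dist (vert x s) (vert y t) := by
    have h1 := abs_sub_le_dist_vert x y s t
    by_cases hxy : x = y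
    · refine ⟨max s t, le_max_left _ _, le_max_right _ _, by simp [hxy, Real.exp_nonneg], ?_⟩
      rcases le_total s t with h | h
      · rw [max_eq_right h]; have := neg_le_abs (s - t); linarith
      · rw [max_eq_left h]; have := le_abs_self (s - t); linarith
    · have h2 := two_mul_log_le_dist x y s t hxy
      have hpos := abs_pos.2 (sub_ne_zero.2 hxy)
      refine ⟨max (Real.log |x - y|) (max s t), ?_, ?_, ?_, ?_⟩
      · exact (le_max_left _ _).trans (le_max_right _ _)
      · exact (le_max_right _ _).trans (le_max_right _ _)
      · rw [← Real.log_le_iff_le_exp hpos]; exact le_max_left _ _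
      · rcases le_total (Real.log |x - y|) (max s t) with h | h
        · rw [max_eq_right h]
          rcases le_total s t with h | h
          · rw [max_eq_right h]; have := neg_le_abs (s - t); linarith
          · rw [max_eq_left h]; have := le_abs_self (s - t); linarith
        · rw [max_eq_left h]; linarith
  have hor : dist (vert x h) (vert y h) ≤ 1 :=
    (dist_vert_horizontal x y h).trans ((div_le_one (Real.exp_pos h)).2 hd)
  have hor' : dist (vert y h) (vert x h) ≤ 1 := by rwa [dist_comm]
  have cross : ∀ p q, p ≤ h → q ≤ h → dist (vert x p) (vert y q) ≤ (h - p) + (h - q) + 1 := by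
    intro p q hp hq
    have h1 := dist_triangle4 (vert x p) (vert x h) (vert y h) (vert y q)
    rw [dist_vert_vert_same, dist_vert_vert_same, abs_of_nonpos (by linarith : p - h ≤ 0),
      abs_of_nonneg (by linarith : 0 ≤ h - q)] at h1
    linarith
  have crossle : dist (vert x s) (vert y t) ≤ (h - s) + (h - t) + 1 := cross s t hs ht
  refine ⟨fun r => if r < h - s then vert x (s + r) else vert y (h - (r - (h - s))),
    (h - s) + (h - t), by linarith, hT, crossle, ?_, ?_, ?_, ?_⟩
  · intro r hr0 hr
    by_cases hrs : r < h - s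
    · simp only [hrs, if_true]
      constructor
      · rw [dist_vert_vert_same, abs_of_nonpos (by linarith)]; linarith
      · have := cross (s + r) t (by linarith) ht; linarith
    · simp only [hrs, if_false]
      constructor
      · have := cross s (h - (r - (h - s))) hs (by linarith); linarith
      · rw [dist_vert_vert_same, abs_of_nonneg (by linarith)]; linarith
  · intro p q
    by_cases hp : p < h - s <;> by_cases hq : q < h - s <;> simp only [hp, hq, if_true, if_false]
    · rw [dist_vert_vert_same, show s + p - (s + q) = p - q by ring]; linarith
    · have := cross (s + p) (h - (q - (h - s))) (by linarith) (by linarith)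
      have := neg_le_abs (p - q)
      linarith
    · rw [dist_comm]
      have := cross (s + q) (h - (p - (h - s))) (by linarith) (by linarith)
      have := le_abs_self (p - q)
      linarith
    · rw [dist_vert_vert_same, show h - (p - (h - s)) - (h - (q - (h - s))) = -(p - q) by ring,
        abs_neg]; linarith
  · simp only [show ¬ (h - s + (h - t) < h - s) by linarith, if_false]; congr 1; ring
  · by_cases hs' : 0 < h - s
    · simp [hs']
    · have : h = s := by linarith
      subst this
      simpa using hor'

theorem exists_rough_geodesic_point (a b : UpperHalfPlane) {t : ℝ} (h0 : 0 ≤ t)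
    (ht : t ≤ dist a b) :
    ∃ p, dist a p ≤ t + 1 ∧ dist p b ≤ dist a b - t + 1 := by
  obtain ⟨c, T, hT0, hT1, hT2, hc, -⟩ := exists_rough_geodesic a b
  by_cases h : t ≤ T
  · obtain ⟨h1, h2⟩ := hc t h0 h
    exact ⟨c t, h1, by linarith⟩
  · push Not at h
    exact ⟨b, by linarith, by simp; linarith⟩

end UpperHalfPlane

/-! ### Exponential divergence and generic directions -/

namespace UpperHalfPlane

/-- A coarsely Lipschitz path of length at most `2 ^ k` that stays outside a ball has ends with
large Gromov product, up to an error linear in `k`. -/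
theorem le_gromovProd_of_path_pow {w : UpperHalfPlane} {c : ℝ → UpperHalfPlane}
    {A B R u v : ℝ} (hA : 0 ≤ A)
    (hc : ∀ r ∈ Icc u v, ∀ r' ∈ Icc u v, dist (c r) (c r') ≤ A * |r - r'| + B)
    (hR : ∀ r ∈ Icc u v, R ≤ dist (c r) w) (k : ℕ) :
    ∀ s ∈ Icc u v, ∀ t ∈ Icc u v, |s - t| ≤ 2 ^ k →
      R - (A + B) / 2 - 2 * k ≤ gromovProd w (c s) (c t) := by
  induction k with
  | zero =>
    intro s hs t ht hst
    have h1 := hR s hs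
    have h2 := hR t ht
    have h3 := hc s hs t ht
    have h4 : A * |s - t| ≤ A * 1 := mul_le_mul_of_nonneg_left (by simpa using hst) hA
    simp only [gromovProd, Nat.cast_zero]
    linarith
  | succ k ih =>
    intro s hs t ht hst
    -- Bisection: each halving costs the hyperbolicity constant `2` once.
    have hm : (s + t) / 2 ∈ Icc u v :=
      ⟨by linarith [hs.1, ht.1], by linarith [hs.2, ht.2]⟩
    have e1 : |s - (s + t) / 2| ≤ 2 ^ k := by
      rw [show s - (s + t) / 2 = (s - t) / 2 by ring, abs_div, abs_two]
      rw [pow_succ] at hst; linarith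
    have e2 : |(s + t) / 2 - t| ≤ 2 ^ k := by
      rw [show (s + t) / 2 - t = (s - t) / 2 by ring, abs_div, abs_two]
      rw [pow_succ] at hst; linarith
    have := le_gromovProd_of_le (ih s hs _ hm e1) (ih _ hm t ht e2)
    push_cast
    linarith

/-- Exponential divergence: a coarsely Lipschitz path that stays outside a ball has ends with large
Gromov product, up to an error logarithmic in the length. -/
theorem le_gromovProd_of_path {w : UpperHalfPlane} {c : ℝ → UpperHalfPlane}
    {A B R u v : ℝ} (huv : u ≤ v) (hA : 0 ≤ A)
    (hc : ∀ r ∈ Icc u v, ∀ r' ∈ Icc u v, dist (c r) (c r') ≤ A * |r - r'| + B)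
    (hR : ∀ r ∈ Icc u v, R ≤ dist (c r) w) :
    R - (A + B) / 2 - 3 * Real.log (1 + (v - u)) - 2 ≤ gromovProd w (c u) (c v) := by
  have hl2 : (0 : ℝ) < Real.log 2 := Real.log_pos (by norm_num)
  have hpos : (0 : ℝ) < 1 + (v - u) := by linarith
  have hlog : 0 ≤ Real.log (1 + (v - u)) := Real.log_nonneg (by linarith)
  set k := ⌈Real.log (1 + (v - u)) / Real.log 2⌉₊ with hk
  have h1 : Real.log (1 + (v - u)) / Real.log 2 ≤ k := Nat.le_ceil _
  have h2 : (k : ℝ) < Real.log (1 + (v - u)) / Real.log 2 + 1 :=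
    Nat.ceil_lt_add_one (by positivity)
  have h3 : |u - v| ≤ 2 ^ k := by
    rw [abs_of_nonpos (by linarith)]
    rw [div_le_iff₀ hl2, ← Real.log_pow] at h1
    have := (Real.log_le_log_iff hpos (by positivity)).1 h1
    linarith
  have h4 := le_gromovProd_of_path_pow hA hc hR k u (left_mem_Icc.2 huv) v (right_mem_Icc.2 huv) h3
  have h5 : Real.log (1 + (v - u)) / Real.log 2 ≤ 3 / 2 * Real.log (1 + (v - u)) := by
    rw [div_le_iff₀ hl2]
    nlinarith [Real.log_two_gt_d9]
  linarith

/-- Given `n` points and a base point there is a ray that diverges from the directions of all of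
them, up to an error logarithmic in `n`. -/
theorem exists_generic_direction (x₀ t₀ : ℝ) {n : ℕ} (c : Fin n → UpperHalfPlane) {ρ : ℝ}
    (hρ : 0 ≤ ρ) :
    ∃ x, dist (vert x t₀) (vert x₀ t₀) ≤ 1 ∧ ∀ r, 0 ≤ r → r ≤ ρ → ∀ j,
      r + dist (vert x₀ t₀) (c j) - 2 * Real.log (n + 1) - 8 ≤ dist (vert x (t₀ - r)) (c j) := by
  have hE := Real.exp_pos t₀
  have hn : (0 : ℝ) < n + 1 := by positivity
  -- These are the feet of `n + 1` descending rays that start within distance `1` of the base point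
  -- and separate after depth about `log (n + 1)`.
  set X : Fin (n + 1) → ℝ := fun k => x₀ + Real.exp t₀ * (k / (n + 1)) with hX
  set z := vert x₀ t₀ with hz
  have hXz : ∀ k, dist (vert (X k) t₀) z ≤ 1 := by
    intro k
    refine (dist_vert_horizontal _ _ _).trans ?_
    rw [div_le_one hE, hX]
    simp only [add_sub_cancel_left]
    rw [abs_of_nonneg (by positivity)]
    refine mul_le_of_le_one_right hE.le ?_
    rw [div_le_one hn]
    exact_mod_cast k.2.le
  have hdz : ∀ k r, 0 ≤ r → r ≤ dist (vert (X k) (t₀ - r)) z ∧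
      dist (vert (X k) (t₀ - r)) z ≤ r + 1 := by
    intro k r hr
    constructor
    · have := abs_sub_le_dist_vert (X k) x₀ (t₀ - r) t₀
      rw [show t₀ - r - t₀ = -r by ring, abs_neg, abs_of_nonneg hr] at this
      exact this
    · have := dist_triangle (vert (X k) (t₀ - r)) (vert (X k) t₀) z
      rw [dist_vert_vert_same, show t₀ - r - t₀ = -r by ring, abs_neg, abs_of_nonneg hr] at this
      linarith [hXz k]
  have hpair : ∀ k l, k ≠ l →
      gromovProd z (vert (X k) (t₀ - ρ)) (vert (X l) (t₀ - ρ)) ≤ 1 + Real.log (n + 1) := by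
    intro k l hkl
    have h1 := (hdz k ρ hρ).2
    have h2 := (hdz l ρ hρ).2
    have hne : (1 : ℝ) ≤ |(k : ℝ) - l| := by
      have hkl' : ((k : ℕ) : ℤ) - ((l : ℕ) : ℤ) ≠ 0 := by
        intro h; apply hkl; ext; omega
      have := Int.one_le_abs hkl'
      exact_mod_cast this
    have hXX : Real.exp t₀ / (n + 1) ≤ |X k - X l| := by
      have : X k - X l = Real.exp t₀ / (n + 1) * ((k : ℝ) - l) := by
        simp only [hX]; field_simp; ring
      rw [this, abs_mul, abs_of_pos (by positivity)]
      exact le_mul_of_one_le_right (by positivity) hne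
    have hq : 0 < Real.exp t₀ / (n + 1) := by positivity
    have hXne : X k ≠ X l := fun h => by
      rw [h, sub_self, abs_zero] at hXX; linarith
    have h3 := two_mul_log_le_dist (X k) (X l) (t₀ - ρ) (t₀ - ρ) hXne
    have h4 := Real.log_le_log hq hXX
    rw [Real.log_div hE.ne' hn.ne', Real.log_exp] at h4
    simp only [gromovProd]
    linarith
  -- Pigeonhole: a point `c j` close in direction to two of the rays would, by hyperbolicity,
  -- contradict `hpair`, so `n` points block at most `n` rays.
  obtain ⟨k, hk⟩ : ∃ k, ∀ j, gromovProd z (vert (X k) (t₀ - ρ)) (c j) ≤ Real.log (n + 1) + 3 := by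
    by_contra hcon
    push Not at hcon
    choose g hg using hcon
    obtain ⟨k, l, hkl, hgkl⟩ := Fintype.exists_ne_map_eq_of_card_lt g (by simp)
    have h1 := hg k
    have h2 := hg l
    rw [← hgkl, gromovProd_comm] at h2
    have h3 := le_gromovProd_of_le h1.le h2.le
    have h4 := hpair k l hkl
    have h5 := min_gromovProd_le z (vert (X k) (t₀ - ρ)) (c (g k)) (vert (X l) (t₀ - ρ))
    have := lt_min h1 h2
    linarith
  refine ⟨X k, hXz k, fun r hr0 hr j => ?_⟩
  have h1 := hk j
  have h2 := (hdz k r hr0).1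
  have h3 := (hdz k ρ hρ).1
  have h4 := dist_triangle (vert (X k) (t₀ - ρ)) (vert (X k) (t₀ - r)) (c j)
  rw [dist_vert_vert_same, show t₀ - ρ - (t₀ - r) = r - ρ by ring,
    abs_of_nonpos (by linarith)] at h4
  simp only [gromovProd] at h1
  rw [dist_comm (c j) z] at h1
  linarith

end UpperHalfPlane

/-- Turns logarithmic errors into linear ones of arbitrarily small slope. -/
theorem log_one_add_le {η x : ℝ} (hη : 0 < η) (hx : 0 ≤ x) :
    Real.log (1 + x) ≤ η * x + (η - Real.log η) := by
  have h1 : 0 < 1 + x := by linarith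
  have h := Real.log_le_sub_one_of_pos (mul_pos hη h1)
  rw [Real.log_mul hη.ne' h1.ne'] at h
  linarith

/-! ### Quasi-isometries of `ℍ² × ℝ` -/

namespace H2R

/-- The point of `ℍ² × ℝ` with given components. -/
def mk (z : UpperHalfPlane) (s : ℝ) : H2R := WithLp.toLp 2 (z, s)

@[simp] theorem mk_fst (z : UpperHalfPlane) (s : ℝ) : (mk z s).fst = z := rfl
@[simp] theorem mk_fst_snd (x : H2R) : mk x.fst x.snd = x := rfl
@[simp] theorem mk_snd (z : UpperHalfPlane) (s : ℝ) : (mk z s).snd = s := rfl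

theorem dist_sq (x y : H2R) :
    dist x y ^ 2 = dist x.fst y.fst ^ 2 + |x.snd - y.snd| ^ 2 := by
  rw [WithLp.prod_dist_eq_add (by norm_num), Real.dist_eq]
  simp only [ENNReal.toReal_ofNat, Real.rpow_two]
  rw [← Real.sqrt_eq_rpow, Real.sq_sqrt (by positivity)]

theorem dist_fst_le (x y : H2R) : dist x.fst y.fst ≤ dist x y := by
  refine abs_le_of_sq_le_sq' ?_ dist_nonneg |>.2
  rw [dist_sq]; nlinarith [sq_nonneg |x.snd - y.snd|]

theorem abs_snd_sub_le (x y : H2R) : |x.snd - y.snd| ≤ dist x y := by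
  refine abs_le_of_sq_le_sq' ?_ dist_nonneg |>.2
  rw [dist_sq]; nlinarith [sq_nonneg (dist x.fst y.fst)]

theorem dist_le_add (x y : H2R) : dist x y ≤ dist x.fst y.fst + |x.snd - y.snd| := by
  refine abs_le_of_sq_le_sq' ?_ (by positivity) |>.2
  rw [dist_sq]
  nlinarith [mul_nonneg (dist_nonneg (x := x.fst) (y := y.fst)) (abs_nonneg (x.snd - y.snd))]

@[simp] theorem dist_mk_left (z w : UpperHalfPlane) (s : ℝ) :
    dist (mk z s) (mk w s) = dist z w :=
  le_antisymm (by simpa using dist_le_add (mk z s) (mk w s))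
    (by simpa using dist_fst_le (mk z s) (mk w s))

@[simp] theorem dist_mk_right (z : UpperHalfPlane) (s t : ℝ) :
    dist (mk z s) (mk z t) = |s - t| :=
  le_antisymm (by simpa using dist_le_add (mk z s) (mk z t))
    (by simpa using abs_snd_sub_le (mk z s) (mk z t))

end H2R

/-- `φ` and `φ'` are coarsely Lipschitz and inverse to each other up to a bounded error. -/
structure AreCoarseInverse {X : Type*} [PseudoMetricSpace X] (L K : ℝ) (φ φ' : X → X) : Prop where
  one_le : 1 ≤ L
  nonneg : 0 ≤ K
  lip : ∀ x y, dist (φ x) (φ y) ≤ L * dist x y + K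
  lip' : ∀ x y, dist (φ' x) (φ' y) ≤ L * dist x y + K
  inv : ∀ x, dist (φ (φ' x)) x ≤ K
  inv' : ∀ x, dist (φ' (φ x)) x ≤ K

namespace AreCoarseInverse

theorem symm {X : Type*} [PseudoMetricSpace X] {L K : ℝ} {φ φ' : X → X}
    (h : AreCoarseInverse L K φ φ') : AreCoarseInverse L K φ' φ :=
  ⟨h.one_le, h.nonneg, h.lip', h.lip, h.inv', h.inv⟩

variable {L K : ℝ} {φ φ' : H2R → H2R}

theorem dist_fst_le (h : AreCoarseInverse L K φ φ') (x y : H2R) :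
    dist (φ x).fst (φ y).fst ≤ L * dist x y + K :=
  (H2R.dist_fst_le _ _).trans (h.lip x y)

-- The detour goes from `(z, s)` horizontally along a ray `B`, then up the fibre over `B ρ'`, then
-- back to `(z, t)`. Its horizontal image avoids a large ball about the midpoint `w`, so exponential
-- divergence bounds the displacement by a logarithm.
set_option maxHeartbeats 1000000 in
open UpperHalfPlane in
theorem fibre_log_bound_of_le (h : AreCoarseInverse L K φ φ') (z : UpperHalfPlane) {s t : ℝ}
    (hst : s ≤ t) :
    dist (φ (H2R.mk z s)).fst (φ (H2R.mk z t)).fst ≤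
      2 + 4 * K + 2 * L * (2 * (L * (8 + 5 / 2 * (L + K) +
        3 * (Real.log ((2 * L + 2 * K + 3) * (1 + K + L)) + Real.log (1 + (t - s)))) + 2 * K) +
        4 * (Real.log ((2 * L + 2 * K + 3) * (1 + K + L)) + Real.log (1 + (t - s))) + 16) := by
  have hL := h.one_le
  have hK := h.nonneg
  obtain ⟨x₀, t₀, hz⟩ := exists_eq_vert z
  set P := H2R.mk z s with hP
  set Q := H2R.mk z t with hQ
  set p := (φ P).fst with hp
  set q := (φ Q).fst with hq
  set D := dist p q with hD
  set l := t - s with hl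
  have hl0 : 0 ≤ l := by linarith
  have hlogl : 0 ≤ Real.log (1 + l) := Real.log_nonneg (by linarith)
  have hbig : 1 ≤ (2 * L + 2 * K + 3) * (1 + K + L) := by nlinarith
  set C₀ := Real.log ((2 * L + 2 * K + 3) * (1 + K + L)) with hC₀
  have hC₀0 : 0 ≤ C₀ := Real.log_nonneg hbig
  have hDl : D ≤ L * l + K := by
    have := h.dist_fst_le P Q
    rw [hP, hQ, H2R.dist_mk_right, abs_sub_comm, abs_of_nonneg hl0] at this
    exact this
  obtain ⟨w, hw1, hw2⟩ := exists_rough_geodesic_point p q (t := D / 2)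
    (by have : 0 ≤ D := dist_nonneg; linarith) (by have : 0 ≤ D := dist_nonneg; linarith)
  rw [← hD] at hw2
  have hw2' : dist q w ≤ D / 2 + 1 := by rw [dist_comm]; linarith
  have hpq := dist_triangle p w q
  rw [dist_comm w q] at hpq
  have hgpw : gromovProd w p q ≤ 1 := by simp only [gromovProd]; linarith
  -- `ρ` is the distance from the pulled-back fibre over `w` that `hfar` guarantees for `P` and `Q`,
  -- whose images are at horizontal distance at least `D / 2 - 1` from `w`.
  set ρ := (D / 2 - 1 - 2 * K) / L with hρ
  have hLρ : L * ρ = D / 2 - 1 - 2 * K := by rw [hρ]; field_simp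
  have hfar : ∀ y σ, D / 2 - 1 ≤ dist (φ y).fst w → ρ ≤ dist y (φ' (H2R.mk w σ)) := by
    intro y σ hy
    have h1 := H2R.dist_fst_le (φ y) (H2R.mk w σ)
    have h2 := dist_triangle (φ y) (φ (φ' (H2R.mk w σ))) (H2R.mk w σ)
    have h3 := h.inv (H2R.mk w σ)
    have h4 := h.lip y (φ' (H2R.mk w σ))
    rw [H2R.mk_fst] at h1
    have : L * ρ ≤ L * dist y (φ' (H2R.mk w σ)) := by linarith
    exact le_of_mul_le_mul_left this (by linarith)
  have hPfar : ∀ σ, ρ ≤ dist P (φ' (H2R.mk w σ)) := fun σ => hfar P σ (by linarith)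
  have hQfar : ∀ σ, ρ ≤ dist Q (φ' (H2R.mk w σ)) := fun σ => hfar Q σ (by linarith)
  rcases le_or_gt ρ 0 with hρ0 | hρ0
  · have : D ≤ 2 + 4 * K := by nlinarith
    have hpos : 0 ≤ 2 * L * (2 * (L * (8 + 5 / 2 * (L + K) + 3 * (C₀ + Real.log (1 + l))) + 2 * K)
      + 4 * (C₀ + Real.log (1 + l)) + 16) := by positivity
    linarith
  have hρD : ρ ≤ D / 2 := by nlinarith
  -- `ρ'` is the depth of the detour, `E` bounds the distance of its points from `P`, and `W` bounds
  -- how far their images are in height from `τ`.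
  set ρ' := ρ / 2 with hρ'
  set E := 1 + ρ' + l with hE
  have hE1 : E ≤ (1 + K + L) * (1 + l) := by nlinarith
  have hE0 : 1 ≤ E := by linarith
  have hlogE : Real.log E ≤ C₀ + Real.log (1 + l) := by
    rw [hC₀, ← Real.log_mul (by positivity) (by positivity)]
    refine Real.log_le_log (by linarith) (hE1.trans ?_)
    gcongr
    nlinarith
  set W := L * E + K with hW
  have hW0 : 0 ≤ W := by positivity
  set τ := (φ P).snd with hτ
  -- Only heights in `[τ - W, τ + W]` matter, so finitely many unit-spaced points of the fibre over
  -- `w` represent it. Their number is linear in `E`, and the generic direction costs only a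
  -- logarithm.
  set n := ⌈2 * W⌉₊ + 1 with hn
  have hnW : (n : ℝ) + 1 ≤ 2 * W + 3 := by
    have := Nat.ceil_lt_add_one (a := 2 * W) (by positivity)
    rw [hn]; push_cast; linarith
  have hlogn : Real.log ((n : ℝ) + 1) ≤ C₀ + Real.log (1 + l) := by
    rw [hC₀, ← Real.log_mul (by positivity) (by positivity)]
    refine Real.log_le_log (by positivity) (hnW.trans ?_)
    rw [hW]
    calc 2 * (L * E + K) + 3 ≤ (2 * L + 2 * K + 3) * E := by nlinarith
      _ ≤ _ := by rw [mul_assoc]; gcongr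
  set lam : Fin n → H2R := fun j => φ' (H2R.mk w (τ - W + j)) with hlam
  obtain ⟨x, hx, hdir⟩ := exists_generic_direction x₀ t₀ (fun j => (lam j).fst)
    (ρ := ρ') (by positivity)
  rw [← hz] at hx hdir
  set B : ℝ → UpperHalfPlane := fun r => vert x (t₀ - r) with hB
  have hBB : ∀ r r', dist (B r) (B r') = |r - r'| := by
    intro r r'
    rw [hB, dist_vert_vert_same, show t₀ - r - (t₀ - r') = -(r - r') by ring, abs_neg]
  have hB0 : dist (B 0) z ≤ 1 := by simpa [hB] using hx
  have hBz : ∀ r, 0 ≤ r → dist (B r) z ≤ r + 1 := by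
    intro r hr
    have := dist_triangle (B r) (B 0) z
    rw [hBB, sub_zero, abs_of_nonneg hr] at this
    linarith
  set Δ := ρ / 2 - 2 * Real.log ((n : ℝ) + 1) - 8 with hΔ
  -- points far from the quasi-line have images far from the fibre over `w`
  have himage : ∀ y, dist y P ≤ E → (∀ j, Δ ≤ dist y (lam j)) →
      (Δ - 2 * K) / L - 1 ≤ dist (φ y).fst w := by
    intro y hyP hy
    have h1 := h.lip y P
    have h2 := H2R.abs_snd_sub_le (φ y) (φ P)
    have h3 : |(φ y).snd - τ| ≤ W := by
      refine h2.trans (h1.trans ?_)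
      rw [hW]; gcongr
    have h4 := abs_le.1 h3
    have h5 : 0 ≤ (φ y).snd - (τ - W) := by linarith
    have h6 := Nat.floor_le h5
    have h7 := Nat.lt_floor_add_one ((φ y).snd - (τ - W))
    set j := ⌊(φ y).snd - (τ - W)⌋₊ with hj
    have hjn : j < n := by
      have : j ≤ ⌈2 * W⌉₊ := by
        refine (Nat.floor_le_ceil _).trans (Nat.ceil_mono (by linarith))
      omega
    have h8 := hy ⟨j, hjn⟩
    have h9 : dist (φ y) (H2R.mk w (τ - W + j)) ≤ dist (φ y).fst w + 1 := by
      refine (H2R.dist_le_add _ _).trans ?_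
      simp only [H2R.mk_fst, H2R.mk_snd]
      gcongr
      rw [abs_le]; constructor <;> linarith
    have h10 := h.lip' (φ y) (H2R.mk w (τ - W + j))
    have h11 := dist_triangle_left y (φ' (H2R.mk w (τ - W + j))) (φ' (φ y))
    have h12 := h.inv' y
    have h13 : L * dist (φ y) (H2R.mk w (τ - W + j)) ≤ L * (dist (φ y).fst w + 1) := by gcongr
    have h14 : Δ - 2 * K ≤ L * (dist (φ y).fst w + 1) := by
      have : Δ ≤ dist y (φ' (H2R.mk w (τ - W + j))) := h8
      linarith
    rw [sub_le_iff_le_add, div_le_iff₀ (by linarith)]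
    linarith
  set R := (Δ - 2 * K) / L - 1 with hR
  -- Moving along the generic ray does not decrease the horizontal distance beyond the logarithmic
  -- error. Horizontal and vertical distance together stay near `ρ`, and the product distance is at
  -- least half their sum; this is the `ρ / 2` in `Δ`.
  have hside : ∀ (σ : ℝ), (∀ σ', ρ ≤ dist (H2R.mk z σ) (φ' (H2R.mk w σ'))) → |σ - s| ≤ l →
      ∀ r ∈ Icc 0 ρ', R ≤ dist (φ (H2R.mk (B r) σ)).fst w := by
    intro σ hσ hσs r hr
    refine himage _ ?_ fun j => ?_
    · have h1 := H2R.dist_le_add (H2R.mk (B r) σ) P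
      have h2 := hBz r hr.1
      simp only [hP, H2R.mk_fst, H2R.mk_snd] at h1
      linarith [hr.2]
    · have h1 := hdir r hr.1 hr.2 j
      have h2 := H2R.dist_fst_le (H2R.mk (B r) σ) (lam j)
      have h3 := H2R.abs_snd_sub_le (H2R.mk (B r) σ) (lam j)
      have h4 := H2R.dist_le_add (H2R.mk z σ) (lam j)
      have h5 : ρ ≤ dist (H2R.mk z σ) (lam j) := hσ _
      have h6 : 0 ≤ Real.log ((n : ℝ) + 1) := Real.log_nonneg (by
        have : (0 : ℝ) ≤ n := by positivity
        linarith)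
      simp only [H2R.mk_fst, H2R.mk_snd] at h2 h3 h4
      have h7 : r + dist z (lam j).fst - 2 * Real.log ((n : ℝ) + 1) - 8 ≤
        dist (B r) (lam j).fst := h1
      rw [hΔ]
      have := hr.1
      linarith
  -- At depth `ρ' = ρ / 2` the horizontal separation alone suffices, whatever the height.
  have hvert : ∀ σ ∈ Icc s t, R ≤ dist (φ (H2R.mk (B ρ') σ)).fst w := by
    intro σ hσ
    refine himage _ ?_ fun j => ?_
    · have h1 := H2R.dist_le_add (H2R.mk (B ρ') σ) P
      have h2 := hBz ρ' (by positivity)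
      simp only [hP, H2R.mk_fst, H2R.mk_snd] at h1
      rw [abs_of_nonneg (by linarith [hσ.1])] at h1
      linarith [hσ.2]
    · have h1 := hdir ρ' (by positivity) le_rfl j
      have h2 := H2R.dist_fst_le (H2R.mk (B ρ') σ) (lam j)
      have h7 : ρ' + dist z (lam j).fst - 2 * Real.log ((n : ℝ) + 1) - 8 ≤
        dist (B ρ') (lam j).fst := h1
      have h8 : 0 ≤ dist z (lam j).fst := dist_nonneg
      simp only [H2R.mk_fst] at h2
      rw [hΔ]
      linarith
  have hpath : ∀ σ, (∀ r ∈ Icc 0 ρ', R ≤ dist (φ (H2R.mk (B r) σ)).fst w) →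
      R - (L + K) / 2 - 3 * Real.log E - 2 ≤
        gromovProd w (φ (H2R.mk (B 0) σ)).fst (φ (H2R.mk (B ρ') σ)).fst := by
    intro σ hσ
    have := le_gromovProd_of_path (c := fun r => (φ (H2R.mk (B r) σ)).fst) (A := L) (B := K)
      (u := 0) (v := ρ') (by positivity) (by linarith)
      (fun r _ r' _ => by simpa [hBB] using h.dist_fst_le (H2R.mk (B r) σ) (H2R.mk (B r') σ)) hσ
    have h2 : Real.log (1 + (ρ' - 0)) ≤ Real.log E :=
      Real.log_le_log (by rw [sub_zero]; positivity) (by linarith)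
    linarith
  have g1 := hpath s (hside s hPfar (by simpa using hl0))
  have g3 := hpath t (hside t hQfar (by rw [abs_of_nonneg (by linarith)]))
  have g2 : R - (L + K) / 2 - 3 * Real.log E - 2 ≤
      gromovProd w (φ (H2R.mk (B ρ') s)).fst (φ (H2R.mk (B ρ') t)).fst := by
    have := le_gromovProd_of_path (c := fun σ => (φ (H2R.mk (B ρ') σ)).fst) (A := L) (B := K)
      (u := s) (v := t) hst (by linarith)
      (fun r _ r' _ => by simpa using h.dist_fst_le (H2R.mk (B ρ') r) (H2R.mk (B ρ') r')) hvert
    have h2 : Real.log (1 + (t - s)) ≤ Real.log E :=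
      Real.log_le_log (by linarith) (by linarith)
    linarith
  rw [gromovProd_comm] at g3
  -- The three pieces of the detour are chained. The resulting lower bound, about `R`, meets the
  -- upper bound `hgpw`.
  have g4 := le_gromovProd_of_le g1 g2
  have g5 := le_gromovProd_of_le g4 ((sub_le_self _ zero_le_two).trans g3)
  have hend : ∀ σ, dist (φ (H2R.mk (B 0) σ)).fst (φ (H2R.mk z σ)).fst ≤ L + K := by
    intro σ
    refine (h.dist_fst_le _ _).trans ?_
    rw [H2R.dist_mk_left]
    nlinarith
  have g6 := le_gromovProd_add_dist w (φ (H2R.mk (B 0) s)).fst (φ (H2R.mk (B 0) t)).fst p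
  have g7 := le_gromovProd_add_dist w (φ (H2R.mk (B 0) t)).fst p q
  rw [gromovProd_comm, gromovProd_comm w q p] at g7
  have g8 := hend s
  have g9 := hend t
  have hRle : R ≤ 7 + 5 / 2 * (L + K) + 3 * (C₀ + Real.log (1 + l)) := by
    linarith
  have hΔle : Δ ≤ L * (8 + 5 / 2 * (L + K) + 3 * (C₀ + Real.log (1 + l))) + 2 * K := by
    rw [hR, sub_le_iff_le_add, div_le_iff₀ (by linarith)] at hRle
    linarith
  have hρle : ρ ≤ 2 * (L * (8 + 5 / 2 * (L + K) + 3 * (C₀ + Real.log (1 + l))) + 2 * K) +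
      4 * (C₀ + Real.log (1 + l)) + 16 := by linarith
  have := mul_le_mul_of_nonneg_left hρle (show 0 ≤ L by linarith)
  linarith

end AreCoarseInverse

/-- Fibres `{z} × ℝ` are mapped close to fibres: horizontal displacement is sublinear. -/
theorem exists_fibre_sublinear (L K : ℝ) {η : ℝ} (hη : 0 < η) :
    ∃ C, 0 ≤ C ∧ ∀ φ φ' : H2R → H2R, AreCoarseInverse L K φ φ' → ∀ z s t,
      dist (φ (H2R.mk z s)).fst (φ (H2R.mk z t)).fst ≤ η * |s - t| + C := by
  -- The constant is chosen before `φ`; for other values of `L` and `K` there is no pair of coarse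
  -- inverses, and any constant serves.
  by_cases hLK : 1 ≤ L ∧ 0 ≤ K
  swap
  · exact ⟨0, le_rfl, fun φ φ' h => (hLK ⟨h.one_le, h.nonneg⟩).elim⟩
  obtain ⟨hL, hK⟩ := hLK
  set a := 2 * L * (2 * (L * 3) + 4) with ha
  have ha0 : 0 < a := by positivity
  set C₀ := Real.log ((2 * L + 2 * K + 3) * (1 + K + L)) with hC₀
  have hη' : 0 < η / a := by positivity
  set b := 2 + 4 * K + 2 * L * (2 * (L * (8 + 5 / 2 * (L + K) + 3 * C₀) + 2 * K) +
    4 * C₀ + 16) with hb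
  refine ⟨|b + a * (η / a - Real.log (η / a))|, abs_nonneg _, fun φ φ' h z => ?_⟩
  have key : ∀ s t, s ≤ t → dist (φ (H2R.mk z s)).fst (φ (H2R.mk z t)).fst ≤
      η * (t - s) + |b + a * (η / a - Real.log (η / a))| := by
    intro s t hst
    have h1 := h.fibre_log_bound_of_le z hst
    have h2 := log_one_add_le hη' (sub_nonneg.2 hst)
    have h3 := mul_le_mul_of_nonneg_left h2 ha0.le
    have h4 : a * (η / a * (t - s)) = η * (t - s) := by field_simp
    have h5 := le_abs_self (b + a * (η / a - Real.log (η / a)))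
    rw [mul_add, h4] at h3
    rw [← hC₀] at h1
    have h6 : dist (φ (H2R.mk z s)).fst (φ (H2R.mk z t)).fst ≤ b + a * Real.log (1 + (t - s)) := by
      rw [hb, ha]; linarith
    linarith
  intro s t
  rcases le_total s t with hst | hst
  · rw [abs_sub_comm, abs_of_nonneg (sub_nonneg.2 hst)]; exact key s t hst
  · rw [dist_comm, abs_of_nonneg (sub_nonneg.2 hst)]; exact key t s hst

/-- The horizontal component of `φ` at height `s`. -/
def H2R.slice (φ : H2R → H2R) (s : ℝ) (z : UpperHalfPlane) : UpperHalfPlane :=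
  (φ (H2R.mk z s)).fst

/-! ### The Morse lemma for horizontal slices -/

open H2R UpperHalfPlane

namespace AreCoarseInverse

variable {L K : ℝ} {φ φ' : H2R → H2R}

theorem dist_slice_le (h : AreCoarseInverse L K φ φ') (s : ℝ) (a b : UpperHalfPlane) :
    dist (slice φ s a) (slice φ s b) ≤ L * dist a b + K := by
  simpa [slice] using h.dist_fst_le (H2R.mk a s) (H2R.mk b s)

end AreCoarseInverse

/-- The horizontal components of a quasi-isometry are quasi-isometric embeddings. -/
theorem exists_slice_lower_bound (L K : ℝ) :
    ∃ C, 0 ≤ C ∧ ∀ φ φ' : H2R → H2R, AreCoarseInverse L K φ φ' → ∀ s a b,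
      dist a b ≤ 2 * L * dist (slice φ s a) (slice φ s b) + C := by
  by_cases hLK : 1 ≤ L ∧ 0 ≤ K
  swap
  · exact ⟨0, le_rfl, fun φ φ' h => (hLK ⟨h.one_le, h.nonneg⟩).elim⟩
  obtain ⟨hL, hK⟩ := hLK
  obtain ⟨C, hC, H⟩ := exists_fibre_sublinear L K (η := 1 / (2 * L)) (by positivity)
  refine ⟨2 * (4 * K + C), by positivity, fun φ φ' h s a b => ?_⟩
  set p := φ (mk a s) with hp
  set q := φ (mk b s) with hq
  -- The point over `q.fst` at the height of `p` is pulled back near `a` if `p` and `q` are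
  -- horizontally close, and `q` is pulled back near `b`. Both lie on one fibre, and the slope `1 /
  -- (2 * L)` makes the displacement between them at most `dist a b / 2` plus a constant, which is
  -- absorbed.
  have h1 := H φ' φ h.symm q.fst p.snd q.snd
  have h2 := (abs_snd_sub_le p q).trans (h.lip (mk a s) (mk b s))
  rw [dist_mk_left] at h2
  have h3 : dist (φ' (mk q.fst p.snd)).fst a ≤ L * dist p.fst q.fst + 2 * K := by
    have e1 := H2R.dist_fst_le (φ' (mk q.fst p.snd)) (mk a s)
    have e2 := dist_triangle (φ' (mk q.fst p.snd)) (φ' p) (mk a s)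
    have e3 := h.inv' (mk a s)
    have e4 := h.lip' (mk q.fst p.snd) p
    have e5 := dist_le_add (mk q.fst p.snd) p
    simp only [mk_fst, mk_snd, sub_self, abs_zero, add_zero] at e1 e5
    rw [dist_comm q.fst] at e5
    have e6 : L * dist (mk q.fst p.snd) p ≤ L * dist p.fst q.fst := by gcongr
    linarith
  have h4 : dist (φ' (mk q.fst q.snd)).fst b ≤ K := by
    rw [mk_fst_snd]
    exact (H2R.dist_fst_le _ (mk b s)).trans (h.inv' (mk b s))
  have h5 := dist_triangle4 a (φ' (mk q.fst p.snd)).fst (φ' (mk q.fst q.snd)).fst b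
  rw [dist_comm a (φ' (mk q.fst p.snd)).fst] at h5
  have h6 : 1 / (2 * L) * |p.snd - q.snd| ≤ dist a b / 2 + K := by
    calc 1 / (2 * L) * |p.snd - q.snd| ≤ 1 / (2 * L) * (L * dist a b + K) := by gcongr
      _ = dist a b / 2 + K / (2 * L) := by field_simp
      _ ≤ dist a b / 2 + K := by
        gcongr
        exact div_le_self hK (by linarith)
  change dist a b ≤ 2 * L * dist p.fst q.fst + _
  linarith

/-- A sublinear version of the Morse lemma. -/
theorem exists_slice_morse_sublinear (L K C₀ : ℝ) {η : ℝ} (hη : 0 < η) :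
    ∃ C, 0 ≤ C ∧ ∀ φ φ' : H2R → H2R, AreCoarseInverse L K φ φ' → ∀ s m a b,
      gromovProd m a b ≤ C₀ → gromovProd (slice φ s m) (slice φ s a) (slice φ s b) ≤
        η * (dist a m + dist b m) + C := by
  by_cases hLK : 1 ≤ L ∧ 0 ≤ K
  swap
  · exact ⟨0, le_rfl, fun φ φ' h => (hLK ⟨h.one_le, h.nonneg⟩).elim⟩
  obtain ⟨hL, hK⟩ := hLK
  -- The slope enters five times with weight `L ^ 2`: four times through `hrm` (once from `hgb`,
  -- three times from the logarithm) and once on returning to height `s`.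
  set ε := η / (5 * L ^ 2) with hε
  have hε0 : 0 < ε := by positivity
  have hεL : ε * L ^ 2 = η / 5 := by rw [hε]; field_simp
  obtain ⟨C₁, hC₁, H⟩ := exists_fibre_sublinear L K hε0
  set c₂ := ε - Real.log ε with hc₂
  set R₀ := C₀ + (L + 2 * K) + (ε * K + C₁ + K) + (2 * L + K) / 2 + 3 * (ε * K + c₂) + 3 with hR₀
  refine ⟨|1 + K + L * R₀ + K + ε * (L * (K + 1) + 2 * K) + C₁|, abs_nonneg _,
    fun φ φ' h s m a b hab => ?_⟩
  obtain ⟨c, T, hT0, hT1, hT2, hc, hcl, hcT, hc0⟩ :=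
    exists_rough_geodesic (slice φ s a) (slice φ s b)
  set l := dist a m + dist b m with hl
  have habl : dist a b ≤ l := by rw [hl, dist_comm b m]; exact dist_triangle _ _ _
  have hl0 : 0 ≤ l := by positivity
  have hTl : T ≤ L * l + K := by
    have h1 := h.dist_slice_le s a b
    have : L * dist a b ≤ L * l := by gcongr
    linarith
  set τ := (φ (mk a s)).snd with hτ
  -- The rough geodesic between the images is lifted to the constant height `τ` and pulled back to a
  -- path from near `a` to near `b`.
  set g : ℝ → UpperHalfPlane := fun r => (φ' (mk (c r) τ)).fst with hg
  have hgl : ∀ r ∈ Icc 0 T, ∀ r' ∈ Icc 0 T, dist (g r) (g r') ≤ L * |r - r'| + (L + K) := by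
    intro r _ r' _
    have h1 := h.symm.dist_fst_le (mk (c r) τ) (mk (c r') τ)
    rw [dist_mk_left] at h1
    have h2 : L * dist (c r) (c r') ≤ L * (|r - r'| + 1) := by gcongr; exact hcl r r'
    linarith
  -- distance from the lift of a point of the rough geodesic to `(a, s)`
  have hlift : ∀ r, dist (φ' (mk (c r) τ)) (mk a s) ≤ L * dist (c r) (slice φ s a) + 2 * K := by
    intro r
    have e2 := dist_triangle (φ' (mk (c r) τ)) (φ' (φ (mk a s))) (mk a s)
    have e3 := h.inv' (mk a s)
    have e4 := h.lip' (mk (c r) τ) (φ (mk a s))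
    have e5 := dist_le_add (mk (c r) τ) (φ (mk a s))
    simp only [mk_fst, mk_snd, hτ, sub_self, abs_zero, add_zero] at e5
    have e6 : L * dist (mk (c r) τ) (φ (mk a s)) ≤ L * dist (c r) (slice φ s a) := by
      gcongr; exact e5
    linarith
  have hga : dist a (g 0) ≤ L + 2 * K := by
    have e1 := H2R.dist_fst_le (φ' (mk (c 0) τ)) (mk a s)
    have e2 := hlift 0
    have e3 : L * dist (c 0) (slice φ s a) ≤ L * 1 := by gcongr
    rw [dist_comm]
    simp only [mk_fst] at e1
    linarith
  have hgb : dist b (g T) ≤ ε * (L * l + K) + C₁ + K := by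
    have e1 := H φ' φ h.symm (slice φ s b) τ (φ (mk b s)).snd
    have e2 := (abs_snd_sub_le (φ (mk a s)) (φ (mk b s))).trans (h.lip _ _)
    rw [dist_mk_left] at e2
    have e3 : L * dist a b ≤ L * l := by gcongr
    have e4 : ε * |τ - (φ (mk b s)).snd| ≤ ε * (L * l + K) := by gcongr; linarith
    have e5 : dist (φ' (mk (slice φ s b) (φ (mk b s)).snd)).fst b ≤ K :=
      (H2R.dist_fst_le _ (mk b s)).trans (h.inv' (mk b s))
    have e6 := dist_triangle (φ' (mk (slice φ s b) τ)).fst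
      (φ' (mk (slice φ s b) (φ (mk b s)).snd)).fst b
    simp only [hg, hcT]
    rw [dist_comm]
    linarith
  have hgm : gromovProd m (g 0) (g T) ≤ C₀ + (L + 2 * K) + (ε * (L * l + K) + C₁ + K) := by
    have e1 := le_gromovProd_add_dist m (g 0) (g T) a
    have e2 := le_gromovProd_add_dist m (g T) a b
    rw [gromovProd_comm, gromovProd_comm m b a] at e2
    rw [dist_comm] at e1 e2
    linarith
  have hlogT : Real.log (1 + (T - 0)) ≤ ε * (L * l + K) + c₂ := by
    rw [sub_zero]
    have h1 := log_one_add_le hε0 hT0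
    have : ε * T ≤ ε * (L * l + K) := by gcongr
    linarith
  -- A path avoiding this ball would, by exponential divergence, violate the bound `hgm` on the
  -- Gromov product of its ends.
  obtain ⟨r, hr, hrm⟩ : ∃ r ∈ Icc 0 T, dist (g r) m < R₀ + 4 * ε * (L * l) := by
    by_contra hcon
    push Not at hcon
    have := le_gromovProd_of_path hT0 (by linarith) hgl hcon
    linarith
  have hcm : dist (slice φ s m) (c r) ≤
      K + (L * (R₀ + 4 * ε * (L * l)) + K) + (ε * (L * (L * l + K + 1) + 2 * K) + C₁) := by
    set y := φ' (mk (c r) τ) with hy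
    have e1 : dist (φ y).fst (c r) ≤ K :=
      (H2R.dist_fst_le _ (mk (c r) τ)).trans (h.inv (mk (c r) τ))
    have e2 : dist (φ y).fst (φ (mk m y.snd)).fst ≤ L * (R₀ + 4 * ε * (L * l)) + K := by
      have e3 := h.dist_fst_le (mk y.fst y.snd) (mk m y.snd)
      rw [dist_mk_left, mk_fst_snd] at e3
      have : L * dist y.fst m ≤ L * (R₀ + 4 * ε * (L * l)) := by gcongr
      linarith
    have e3 := H φ φ' h m y.snd s
    have e4 : |y.snd - s| ≤ L * (L * l + K + 1) + 2 * K := by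
      refine (abs_snd_sub_le y (mk a s)).trans ((hlift r).trans ?_)
      have e5 := (hc r hr.1 hr.2).1
      rw [dist_comm] at e5
      have e6 := hr.2
      gcongr
      linarith
    have e5 : ε * |y.snd - s| ≤ ε * (L * (L * l + K + 1) + 2 * K) := by gcongr
    have e6 := dist_triangle4 (slice φ s m) (φ (mk m y.snd)).fst (φ y).fst (c r)
    rw [dist_comm (slice φ s m) (φ (mk m y.snd)).fst,
      dist_comm (φ (mk m y.snd)).fst (φ y).fst] at e6
    change dist (φ (mk m y.snd)).fst (slice φ s m) ≤ _ at e3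
    linarith
  have hcr : gromovProd (c r) (slice φ s a) (slice φ s b) ≤ 1 := by
    obtain ⟨e1, e2⟩ := hc r hr.1 hr.2
    rw [dist_comm (c r)] at e2
    simp only [gromovProd]
    linarith
  have h1 := gromovProd_base (slice φ s m) (c r) (slice φ s a) (slice φ s b)
  have h2 := le_abs_self (1 + K + L * R₀ + K + ε * (L * (K + 1) + 2 * K) + C₁)
  have h3 : L * (4 * ε * (L * l)) + ε * (L * (L * l)) = η * l := by
    calc L * (4 * ε * (L * l)) + ε * (L * (L * l)) = 5 * (ε * L ^ 2) * l := by ring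
      _ = η * l := by rw [hεL]; ring
  linarith

/-- Replaces a distant point `a` by a point `a'` at scale `r` in the same direction, without an
error depending on the distance of `a`. The sublinear Morse lemma is applied at scales `r`, `2r`,
`4r`, …, where its error, of slope `1 / (16 * L)`, is beaten by the progress `r / (2 * L)` of the
image. The errors do not add up because the Gromov products grow with the scale. -/
theorem exists_slice_arm_bound (L K : ℝ) :
    ∃ r₀ C, 0 ≤ C ∧ 0 ≤ r₀ ∧ ∀ φ φ' : H2R → H2R, AreCoarseInverse L K φ φ' → ∀ s m a a' r,
      r₀ ≤ r → dist m a' ≤ r + 1 → dist a' a ≤ dist m a - r + 1 →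
      r / (8 * L) - C ≤ gromovProd (slice φ s m) (slice φ s a) (slice φ s a') := by
  by_cases hLK : 1 ≤ L ∧ 0 ≤ K
  swap
  · exact ⟨0, 0, le_rfl, le_rfl, fun φ φ' h => (hLK ⟨h.one_le, h.nonneg⟩).elim⟩
  obtain ⟨hL, hK⟩ := hLK
  obtain ⟨C₁, hC₁, H₁⟩ := exists_slice_morse_sublinear L K 4 (η := 1 / (16 * L)) (by positivity)
  obtain ⟨C₂, hC₂, H₂⟩ := exists_slice_lower_bound L K
  refine ⟨16 * L, 2 + C₂ + C₁ + 2, by positivity, by positivity, fun φ φ' h s m a => ?_⟩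
  have hstep : ∀ r a' a'', 0 ≤ r → r - 1 ≤ dist m a' → dist m a' ≤ r + 1 →
      dist a' a'' ≤ r + 6 → gromovProd a' m a'' ≤ 4 →
      r / (8 * L) - (2 + C₂ + C₁) ≤
        gromovProd (slice φ s m) (slice φ s a'') (slice φ s a') := by
    intro r a' a'' hr h0 h1 h2 h3
    have e1 := H₁ φ φ' h s a' m a'' h3
    have e2 := H₂ φ φ' h s m a'
    have e3 := gromovProd_add_gromovProd (slice φ s m) (slice φ s a') (slice φ s a'')
    rw [gromovProd_comm _ (slice φ s a') (slice φ s a''),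
      dist_comm (slice φ s a') (slice φ s m)] at e3
    rw [dist_comm a'' a'] at e1
    have e4 : 1 / (16 * L) * (dist m a' + dist a' a'') ≤ 1 / (16 * L) * (2 * r + 7) :=
      mul_le_mul_of_nonneg_left (by linarith) (by positivity)
    have e5 : 1 / (2 * L) * (r - 1 - C₂) ≤ dist (slice φ s m) (slice φ s a') := by
      rw [one_div_mul_eq_div, div_le_iff₀ (by positivity)]
      linarith
    have e6 : r / (8 * L) - (2 + C₂ + C₁) ≤
        1 / (2 * L) * (r - 1 - C₂) - (1 / (16 * L) * (2 * r + 7) + C₁) := by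
      have hi : 1 / L ≤ 1 := by rw [div_le_one (by linarith)]; exact hL
      have hi0 : 0 < 1 / L := by positivity
      rw [show r / (8 * L) = 1 / L * (r / 8) by field_simp,
        show 1 / (2 * L) * (r - 1 - C₂) = 1 / L * ((r - 1 - C₂) / 2) by field_simp,
        show 1 / (16 * L) * (2 * r + 7) = 1 / L * ((2 * r + 7) / 16) by field_simp]
      nlinarith [mul_le_mul_of_nonneg_right hi hC₂, mul_nonneg hi0.le hr]
    linarith
  -- Induction on the number of doublings that reach `a`. The bound at scale `2 * r` exceeds the one
  -- at `r` by `r / (8 * L) ≥ 2`, which pays for the use of hyperbolicity; hence the condition `16 *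
  -- L ≤ r`.
  have key : ∀ k : ℕ, ∀ r a', 16 * L ≤ r → dist m a ≤ 2 ^ (k + 1) * r → dist m a' ≤ r + 1 →
      dist a' a ≤ dist m a - r + 1 →
      r / (8 * L) - (2 + C₂ + C₁ + 2) ≤
        gromovProd (slice φ s m) (slice φ s a) (slice φ s a') := by
    intro k
    induction k with
    | zero =>
      intro r a' hr hk h1 h2
      have h3 := dist_triangle m a' a
      rw [zero_add, pow_one] at hk
      have := hstep r a' a (by linarith) (by linarith) h1 (by linarith)
        (by simp only [gromovProd]; rw [dist_comm a a']; linarith)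
      linarith
    | succ k ih =>
      intro r a' hr hk h1 h2
      have h3 := dist_triangle m a' a
      rcases le_or_gt (dist m a) (2 * r) with hD | hD
      · have := hstep r a' a (by linarith) (by linarith) h1 (by linarith)
          (by simp only [gromovProd]; rw [dist_comm a a']; linarith)
        linarith
      obtain ⟨a'', h4, h5⟩ := exists_rough_geodesic_point m a (t := 2 * r) (by linarith) hD.le
      have h6 := dist_triangle m a'' a
      have h7 := ih (2 * r) a'' (by linarith) (by rw [pow_succ] at hk; linarith) h4 h5
      have h8 : dist a' a'' ≤ r + 6 := by
        have e1 := four_point a' m a'' a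
        have e2 : max (dist a' m + dist a'' a) (dist m a'' + dist a' a) ≤ dist m a + r + 2 := by
          rw [dist_comm a' m]
          exact max_le (by linarith) (by linarith)
        linarith
      have h9 := hstep r a' a'' (by linarith) (by linarith) h1 h8
        (by simp only [gromovProd]; rw [dist_comm a'' a']; linarith)
      have h10 : 2 ≤ r / (8 * L) := by
        rw [le_div_iff₀ (by positivity)]; linarith
      have h11 : 2 * r / (8 * L) = r / (8 * L) + r / (8 * L) := by ring
      have h12 := le_gromovProd_of_le (r := r / (8 * L) - (2 + C₂ + C₁))
        (le_trans (by rw [h11]; linarith only [h10]) h7) h9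
      linarith
  intro a' r hr h1 h2
  have hL16 : (0 : ℝ) < r := by linarith
  obtain ⟨k, hk⟩ := pow_unbounded_of_one_lt (dist m a / r) (one_lt_two)
  rw [div_lt_iff₀ hL16] at hk
  refine key k r a' hr ?_ h1 h2
  rw [pow_succ]
  nlinarith [mul_pos (pow_pos (zero_lt_two (α := ℝ)) k) hL16]

/-- The Morse lemma for the horizontal components of a quasi-isometry. -/
theorem exists_slice_morse (L K C₀ : ℝ) :
    ∃ C, 0 ≤ C ∧ ∀ φ φ' : H2R → H2R, AreCoarseInverse L K φ φ' → ∀ s m a b,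
      gromovProd m a b ≤ C₀ → gromovProd (slice φ s m) (slice φ s a) (slice φ s b) ≤ C := by
  by_cases hLK : 1 ≤ L ∧ 0 ≤ K
  swap
  · exact ⟨0, le_rfl, fun φ φ' h => (hLK ⟨h.one_le, h.nonneg⟩).elim⟩
  obtain ⟨hL, hK⟩ := hLK
  obtain ⟨r₀, C₁, hC₁, hr₀, H₁⟩ := exists_slice_arm_bound L K
  obtain ⟨C₂, hC₂, H₂⟩ :=
    exists_slice_morse_sublinear L K (C₀ + 2) (η := 1 / (32 * L)) (by positivity)
  -- At this scale the arms agree up to `r / (8 * L)`, more than the sublinear Morse error `r / (16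
  -- * L)` and all constants together.
  set r := max r₀ (16 * L * (C₁ + C₂ + 6)) with hr
  have hr1 : r₀ ≤ r := le_max_left _ _
  have hr2 : 16 * L * (C₁ + C₂ + 6) ≤ r := le_max_right _ _
  have hr0 : 0 ≤ r := hr₀.trans hr1
  set T := r / (16 * L) + 1 + C₂ with hT
  have hTr : T + 4 < r / (8 * L) - C₁ := by
    have e1 : C₁ + C₂ + 6 ≤ r / (16 * L) := by rw [le_div_iff₀ (by positivity)]; linarith
    have e2 : r / (8 * L) = r / (16 * L) + r / (16 * L) := by field_simp; ring
    linarith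
  have hT0 : 0 ≤ T + 4 := by positivity
  refine ⟨(T + 4) + (L * r + K), by positivity, fun φ φ' h s m a b hab => ?_⟩
  have hLr : 0 ≤ L * r + K := by positivity
  rcases lt_or_ge (dist a m) r with ha | ha
  · have e1 := gromovProd_le_left (slice φ s m) (slice φ s a) (slice φ s b)
    have e2 := h.dist_slice_le s a m
    have : L * dist a m ≤ L * r := by gcongr
    linarith
  rcases lt_or_ge (dist b m) r with hb | hb
  · have e1 := gromovProd_le_right (slice φ s m) (slice φ s a) (slice φ s b)
    have e2 := h.dist_slice_le s b m
    have : L * dist b m ≤ L * r := by gcongr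
    linarith
  rw [dist_comm] at ha hb
  obtain ⟨a', ha1, ha2⟩ := exists_rough_geodesic_point m a hr0 ha
  obtain ⟨b', hb1, hb2⟩ := exists_rough_geodesic_point m b hr0 hb
  have e1 := H₁ φ φ' h s m a a' r hr1 ha1 ha2
  have e2 := H₁ φ φ' h s m b b' r hr1 hb1 hb2
  have hab' : gromovProd m a' b' ≤ C₀ + 2 := by
    have e3 := dist_triangle4 a a' b' b
    rw [dist_comm a a'] at e3
    simp only [gromovProd] at hab ⊢
    rw [dist_comm a m, dist_comm b m] at hab
    rw [dist_comm a' m, dist_comm b' m]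
    linarith
  have e3 := H₂ φ φ' h s m a' b' hab'
  have e4 : 1 / (32 * L) * (dist a' m + dist b' m) ≤ r / (16 * L) + 1 := by
    rw [dist_comm a' m, dist_comm b' m]
    calc 1 / (32 * L) * (dist m a' + dist m b') ≤ 1 / (32 * L) * (2 * r + 2) :=
          mul_le_mul_of_nonneg_left (by linarith) (by positivity)
      _ = r / (16 * L) + 1 / (16 * L) := by field_simp; ring
      _ ≤ r / (16 * L) + 1 := by
          gcongr
          rw [div_le_one (by positivity)]; linarith
  -- A larger product would pass along the two arms to `a'` and `b'`, against `e3`.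
  have e5 : gromovProd (slice φ s m) (slice φ s a) (slice φ s b) ≤ T + 4 := by
    by_contra hcon
    push Not at hcon
    rw [gromovProd_comm] at e1
    set r' := min (gromovProd (slice φ s m) (slice φ s a) (slice φ s b)) (r / (8 * L) - C₁) with hr'
    have f0 : T + 4 < r' := lt_min hcon hTr
    have f1 := le_gromovProd_of_le ((min_le_right _ _).trans e1) (min_le_left _ _ : r' ≤ _)
    have f2 := le_gromovProd_of_le f1
      (((sub_le_self _ zero_le_two).trans (min_le_right _ _)).trans e2)
    linarith
  linarith

/-! ### Coarse centres of triples and bounded displacement of fibres -/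

namespace UpperHalfPlane

/-- Two coarse centres of the same triangle are close to each other. -/
theorem dist_le_of_gromovProd_le {p q a b d : UpperHalfPlane} {c : ℝ}
    (h1 : gromovProd p a b ≤ c) (h2 : gromovProd p a d ≤ c) (h3 : gromovProd p b d ≤ c)
    (h4 : gromovProd q a b ≤ c) (h5 : gromovProd q a d ≤ c) (h6 : gromovProd q b d ≤ c) :
    dist p q ≤ 2 * c + 4 := by
  -- If `p` and `q` were further apart, every pair among `a`, `b`, `d` would contain a point
  -- strictly closer to `p`, so at least two of the three would be; the same holds for `q`, which is
  -- impossible.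
  have key : ∀ p q x y : UpperHalfPlane, gromovProd p x y ≤ c → dist p q - (2 * c + 4) ≤
      max (dist x q - dist x p) (dist y q - dist y p) := by
    intro p q x y h
    have e1 := four_point p x q y
    rw [dist_comm p x, dist_comm q y, dist_comm p y] at e1
    simp only [gromovProd] at h
    rcases max_choice (dist x p + dist y q) (dist x q + dist y p) with e | e <;> rw [e] at e1
    · exact le_max_of_le_right (by linarith)
    · exact le_max_of_le_left (by linarith)
  by_contra hcon
  push Not at hcon
  have k1 := key p q a b h1
  have k2 := key p q a d h2
  have k3 := key p q b d h3
  have k4 := key q p a b h4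
  have k5 := key q p a d h5
  have k6 := key q p b d h6
  rw [dist_comm q p] at k4 k5 k6
  have hpos : 0 < dist p q - (2 * c + 4) := by linarith
  have l1 := lt_of_lt_of_le hpos k1
  have l2 := lt_of_lt_of_le hpos k2
  have l3 := lt_of_lt_of_le hpos k3
  have l4 := lt_of_lt_of_le hpos k4
  have l5 := lt_of_lt_of_le hpos k5
  have l6 := lt_of_lt_of_le hpos k6
  simp only [lt_max_iff, sub_pos] at l1 l2 l3 l4 l5 l6
  rcases l1 with l1 | l1 <;> rcases l2 with l2 | l2 <;> rcases l3 with l3 | l3 <;>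
    rcases l4 with l4 | l4 <;> rcases l5 with l5 | l5 <;> rcases l6 with l6 | l6 <;> linarith

theorem gromovProd_vert_up_down {x u n : ℝ} (hn : 0 ≤ n) {y : ℝ}
    (hy : |y - x| ≤ Real.exp u) :
    gromovProd (vert x u) (vert x (u + n)) (vert y (u - n)) ≤ 1 := by
  have h1 := abs_sub_le_dist_vert x y (u + n) (u - n)
  have h2 := dist_triangle (vert y (u - n)) (vert y u) (vert x u)
  have h3 := dist_vert_horizontal y x u
  have h4 : |y - x| / Real.exp u ≤ 1 := by rwa [div_le_one (Real.exp_pos u)]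
  rw [dist_vert_vert_same, show u - n - u = -n by ring, abs_neg, abs_of_nonneg hn] at h2
  rw [show u + n - (u - n) = 2 * n by ring, abs_of_nonneg (by linarith)] at h1
  simp only [gromovProd]
  rw [dist_vert_vert_same, show u + n - u = n by ring, abs_of_nonneg hn]
  linarith

theorem gromovProd_vert_down_down {x u n : ℝ} (hn : 0 ≤ n) {y : ℝ}
    (hy : |x - y| = Real.exp u) :
    gromovProd (vert x u) (vert x (u - n)) (vert y (u - n)) ≤ 1 := by
  have hne : x ≠ y := fun h => by
    have := Real.exp_pos u
    rw [h, sub_self, abs_zero] at hy; linarith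
  have h1 := two_mul_log_le_dist x y (u - n) (u - n) hne
  rw [hy, Real.log_exp] at h1
  have h2 := dist_triangle (vert y (u - n)) (vert y u) (vert x u)
  have h3 := dist_vert_horizontal y x u
  have h4 : |y - x| / Real.exp u ≤ 1 := by
    rw [abs_sub_comm, hy, div_self (Real.exp_pos u).ne']
  rw [dist_vert_vert_same, show u - n - u = -n by ring, abs_neg, abs_of_nonneg hn] at h2
  simp only [gromovProd]
  rw [dist_vert_vert_same, show u - n - u = -n by ring, abs_neg, abs_of_nonneg hn]
  linarith

end UpperHalfPlane

/-- Fibres `{z} × ℝ` are mapped to within bounded distance of fibres. -/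
theorem exists_fibre_bound (L K : ℝ) :
    ∃ C, 0 ≤ C ∧ ∀ φ φ' : H2R → H2R, AreCoarseInverse L K φ φ' → ∀ z s t,
      dist (slice φ s z) (slice φ t z) ≤ C := by
  obtain ⟨C₁, hC₁, H₁⟩ := exists_slice_morse L K 1
  obtain ⟨C₂, hC₂, H₂⟩ := exists_slice_lower_bound L K
  obtain ⟨C₃, hC₃, H₃⟩ := exists_fibre_sublinear L K one_pos
  refine ⟨2 * (C₁ + 4) + 4, by positivity, fun φ φ' h m s t => ?_⟩
  have hL := h.one_le
  obtain ⟨x, u, hm⟩ := exists_eq_vert m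
  set N := |s - t| + C₃ with hN
  have hN0 : 0 ≤ N := by positivity
  -- At distance `n` from `m` the displacement between the slices, at most `N`, is negligible
  -- against the distance from `slice φ s m`. Seen from there, both slices send the triple `a`, `b`,
  -- `d` in the same directions.
  set n := 2 * L * (N + C₁ + 5) + C₂ with hn
  have hn0 : 0 ≤ n := by positivity
  have hE := Real.exp_pos u
  set a := vert x (u + n)
  set b := vert x (u - n)
  set d := vert (x + Real.exp u) (u - n)
  have hdd : |x - (x + Real.exp u)| = Real.exp u := by
    rw [show x - (x + Real.exp u) = -Real.exp u by ring, abs_neg, abs_of_pos hE]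
  have hab : gromovProd m a b ≤ 1 := by
    rw [hm]; exact gromovProd_vert_up_down hn0 (by simp [hE.le])
  have had : gromovProd m a d ≤ 1 := by
    rw [hm]; exact gromovProd_vert_up_down hn0 (by rw [abs_sub_comm, hdd])
  have hbd : gromovProd m b d ≤ 1 := by
    rw [hm]; exact gromovProd_vert_down_down hn0 hdd
  have far : ∀ y, n ≤ dist y m →
      C₁ + 5 ≤ gromovProd (slice φ s m) (slice φ s y) (slice φ t y) := by
    intro y hy
    have e1 := H₂ φ φ' h s y m
    have e2 := H₃ φ φ' h y s t
    rw [one_mul] at e2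
    have e3 : N + C₁ + 5 ≤ dist (slice φ s y) (slice φ s m) := by
      have : 2 * L * (N + C₁ + 5) ≤ 2 * L * dist (slice φ s y) (slice φ s m) := by linarith
      exact le_of_mul_le_mul_left this (by linarith)
    have e4 := le_gromovProd_add_dist (slice φ s m) (slice φ s y) (slice φ s y) (slice φ t y)
    rw [gromovProd_self, gromovProd_comm] at e4
    change dist (slice φ s y) (slice φ t y) ≤ _ at e2
    linarith
  have transfer : ∀ y y', n ≤ dist y m → n ≤ dist y' m → gromovProd m y y' ≤ 1 →
      gromovProd (slice φ s m) (slice φ t y) (slice φ t y') ≤ C₁ + 4 := by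
    intro y y' hy hy' hyy
    have e1 := H₁ φ φ' h s m y y' hyy
    by_contra hcon
    push Not at hcon
    set r := min (gromovProd (slice φ s m) (slice φ t y) (slice φ t y')) (C₁ + 5) with hr
    have f0 : C₁ + 4 < r := lt_min hcon (by linarith)
    have f1 := le_gromovProd_of_le ((min_le_right _ _).trans (far y hy)) (min_le_left _ _ : r ≤ _)
    have f2 := far y' hy'
    rw [gromovProd_comm] at f2
    have f3 := le_gromovProd_of_le f1
      (((sub_le_self _ zero_le_two).trans (min_le_right _ _)).trans f2)
    linarith
  have da : n ≤ dist a m := by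
    rw [hm, dist_vert_vert_same, show u + n - u = n by ring, abs_of_nonneg hn0]
  have db : n ≤ dist b m := by
    rw [hm, dist_vert_vert_same, show u - n - u = -n by ring, abs_neg, abs_of_nonneg hn0]
  have dd : n ≤ dist d m := by
    rw [hm]
    have := abs_sub_le_dist_vert (x + Real.exp u) x (u - n) u
    rwa [show u - n - u = -n by ring, abs_neg, abs_of_nonneg hn0] at this
  have fin : ∀ y y', gromovProd m y y' ≤ 1 →
      gromovProd (slice φ t m) (slice φ t y) (slice φ t y') ≤ C₁ + 4 := fun y y' hyy =>
    (H₁ φ φ' h t m y y' hyy).trans (by linarith)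
  -- Both images of `m` are coarse centres of the triple at height `t`, with constants in which `n`
  -- does not occur.
  exact dist_le_of_gromovProd_le (transfer a b da db hab) (transfer a d da dd had)
    (transfer b d db dd hbd) (fin a b hab) (fin a d had) (fin b d hbd)

/-- A quasi-isometric embedding of `ℍ²` that satisfies the conclusion of the Morse lemma. -/
structure IsMorseMap (L K : ℝ) (M : ℝ → ℝ) (f : UpperHalfPlane → UpperHalfPlane) : Prop where
  pos : 0 < L
  upper : ∀ a b, dist (f a) (f b) ≤ L * dist a b + K
  lower : ∀ a b, dist a b ≤ L * dist (f a) (f b) + K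
  morse : ∀ C m a b, gromovProd m a b ≤ C → gromovProd (f m) (f a) (f b) ≤ M C

/-- The order of quantifiers is what later makes the quasisymmetry constant the same for all group
elements. -/
theorem exists_isMorseMap_slice (L K : ℝ) :
    ∃ L' K' M, ∀ φ φ' : H2R → H2R, AreCoarseInverse L K φ φ' → ∀ s,
      IsMorseMap L' K' M (slice φ s) := by
  obtain ⟨C₂, hC₂, H₂⟩ := exists_slice_lower_bound L K
  choose M hM H₁ using fun C₀ => exists_slice_morse L K C₀
  refine ⟨2 * L, K + C₂, M, fun φ φ' h s => ⟨by linarith [h.one_le], fun a b => ?_, fun a b => ?_,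
    fun C m a b => H₁ C φ φ' h s m a b⟩⟩
  · have h1 := h.dist_slice_le s a b
    have h2 : 0 ≤ L * dist a b := mul_nonneg (by linarith [h.one_le]) dist_nonneg
    linarith
  · have h1 := H₂ φ φ' h s a b
    have h2 := h.nonneg
    linarith

open UpperHalfPlane

/-! ### The boundary circle -/

/-- The filter of neighbourhoods of a boundary point, traced on `ℍ²`. -/
noncomputable def boundaryNhds (ξ : BoundaryH2) : Filter UpperHalfPlane :=
  comap toSphere (𝓝 (boundaryToSphere ξ))

theorem tendsto_boundaryNhds_iff {α : Type*} {l : Filter α} {p : α → UpperHalfPlane}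
    {ξ : BoundaryH2} :
    Tendsto p l (boundaryNhds ξ) ↔ Tendsto (fun a => toSphere (p a)) l (𝓝 (boundaryToSphere ξ)) :=
  tendsto_comap_iff

theorem extendsContinuouslyBy_iff {f : UpperHalfPlane → UpperHalfPlane}
    {b : BoundaryH2 → BoundaryH2} :
    ExtendsContinuouslyBy f b ↔ ∀ x, Tendsto f (boundaryNhds x) (boundaryNhds (b x)) :=
  forall_congr' fun _ => tendsto_boundaryNhds_iff.symm

theorem boundaryToSphere_injective : Function.Injective boundaryToSphere :=
  Option.map_injective Complex.ofReal_injective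

theorem continuous_boundaryToSphere : Continuous boundaryToSphere :=
  OnePoint.continuous_map Complex.continuous_ofReal
    (by simpa only [coclosedCompact_eq_cocompact] using
      Complex.isometry_ofReal.isClosedEmbedding.tendsto_cocompact)

/-- The chart `z ↦ (z + i)⁻¹` of the sphere, on the half plane. -/
noncomputable def chart (z : UpperHalfPlane) : ℂ := ((z : ℂ) + Complex.I)⁻¹

/-- The chart `z ↦ (z + i)⁻¹` of the sphere, on the boundary circle. -/
noncomputable def boundaryChart (ξ : BoundaryH2) : ℂ :=
  ξ.elim 0 fun x => ((x : ℂ) + Complex.I)⁻¹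

theorem coe_add_I_ne_zero (z : UpperHalfPlane) : (z : ℂ) + Complex.I ≠ 0 := fun h => by
  have h1 := congrArg Complex.im h
  have := z.im_pos
  simp at h1
  linarith

theorem ofReal_add_I_ne_zero (x : ℝ) : (x : ℂ) + Complex.I ≠ 0 := fun h => by
  have h1 := congrArg Complex.im h
  simp at h1

theorem tendsto_boundaryNhds_infty_iff {α : Type*} {l : Filter α} {p : α → UpperHalfPlane} :
    Tendsto p l (boundaryNhds OnePoint.infty) ↔ Tendsto (fun a => ‖(p a : ℂ)‖) l atTop := by
  have e1 : boundaryToSphere OnePoint.infty = OnePoint.infty := rfl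
  rw [tendsto_boundaryNhds_iff, e1, tendsto_norm_atTop_iff_cobounded, Metric.cobounded_eq_cocompact,
    ← coclosedCompact_eq_cocompact, ← OnePoint.comap_coe_nhds_infty, tendsto_comap_iff]
  rfl

theorem tendsto_boundaryNhds_coe_iff {α : Type*} {l : Filter α} {p : α → UpperHalfPlane} {x : ℝ} :
    Tendsto p l (boundaryNhds (x : OnePoint ℝ)) ↔ Tendsto (fun a => (p a : ℂ)) l (𝓝 (x : ℂ)) := by
  have e1 : boundaryToSphere (x : OnePoint ℝ) = ((x : ℂ) : OnePoint ℂ) := rfl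
  rw [tendsto_boundaryNhds_iff, e1]
  exact OnePoint.isOpenEmbedding_coe.tendsto_nhds_iff.symm

theorem tendsto_boundaryNhds_iff_chart {α : Type*} {l : Filter α} {p : α → UpperHalfPlane}
    {ξ : BoundaryH2} :
    Tendsto p l (boundaryNhds ξ) ↔ Tendsto (fun a => chart (p a)) l (𝓝 (boundaryChart ξ)) := by
  induction ξ using OnePoint.rec with
  | infty =>
    have e2 : boundaryChart OnePoint.infty = 0 := rfl
    have e4 : Tendsto (fun a => ‖(p a : ℂ)‖) l atTop ↔
        Tendsto (fun a => ‖(p a : ℂ) + Complex.I‖) l atTop := by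
      constructor
      · intro h
        refine tendsto_atTop_mono (fun a => ?_) (tendsto_atTop_add_const_right _ (-1) h)
        have := norm_sub_le ((p a : ℂ) + Complex.I) Complex.I
        simp only [add_sub_cancel_right, Complex.norm_I] at this
        linarith
      · intro h
        refine tendsto_atTop_mono (fun a => ?_) (tendsto_atTop_add_const_right _ (-1) h)
        have := norm_add_le (p a : ℂ) Complex.I
        simp only [Complex.norm_I] at this
        linarith
    rw [tendsto_boundaryNhds_infty_iff, e4, e2, tendsto_norm_atTop_iff_cobounded]
    constructor
    · exact fun h => tendsto_inv₀_cobounded.comp h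
    · intro h
      have h1 : Tendsto (fun a => chart (p a)) l (𝓝[≠] 0) :=
        tendsto_nhdsWithin_iff.2 ⟨h, Eventually.of_forall fun a =>
          inv_ne_zero (coe_add_I_ne_zero (p a))⟩
      have h2 := tendsto_inv₀_nhdsNE_zero.comp h1
      simpa [Function.comp_def, chart] using h2
  | coe x =>
    have e2 : boundaryChart (x : OnePoint ℝ) = ((x : ℂ) + Complex.I)⁻¹ := rfl
    rw [tendsto_boundaryNhds_coe_iff, e2]
    constructor
    · intro h
      exact (h.add_const Complex.I).inv₀ (ofReal_add_I_ne_zero x)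
    · intro h
      have h1 := (h.inv₀ (inv_ne_zero (ofReal_add_I_ne_zero x))).sub_const Complex.I
      simpa [chart] using h1

/-- The chart maps `ℍ²` onto the disc `‖k‖ ^ 2 < -k.im`, and the left side measures the failure to
lie on its boundary circle. It is comparable to `exp (-dist z I)`, so leaving all balls means
approaching the circle. -/
theorem chart_defect (z : UpperHalfPlane) :
    -(chart z).im - ‖chart z‖ ^ 2 = z.im * ‖chart z‖ ^ 2 := by
  have h0 : Complex.normSq ((z : ℂ) + Complex.I) ≠ 0 := by
    rw [Ne, Complex.normSq_eq_zero]; exact coe_add_I_ne_zero z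
  rw [chart, Complex.inv_im, norm_inv, inv_pow, ← Complex.normSq_eq_norm_sq]
  simp only [Complex.add_im, Complex.I_im, UpperHalfPlane.coe_im]
  field_simp
  ring

theorem cosh_half_dist_I (z : UpperHalfPlane) :
    Real.cosh (dist z I / 2) = ‖(z : ℂ) + Complex.I‖ / (2 * √z.im) := by
  rw [cosh_half_dist, Complex.dist_eq]
  simp

theorem norm_chart_mul (z : UpperHalfPlane) :
    ‖chart z‖ * (2 * √z.im * Real.cosh (dist z I / 2)) = 1 := by
  have h0 := norm_ne_zero_iff.2 (coe_add_I_ne_zero z)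
  have h1 := (Real.sqrt_pos.2 z.im_pos).ne'
  rw [cosh_half_dist_I, chart, norm_inv]
  field_simp

theorem im_mul_norm_chart_sq (z : UpperHalfPlane) :
    z.im * ‖chart z‖ ^ 2 * (4 * Real.cosh (dist z I / 2) ^ 2) = 1 := by
  have h1 := norm_chart_mul z
  have h2 := Real.sq_sqrt z.im_pos.le
  calc z.im * ‖chart z‖ ^ 2 * (4 * Real.cosh (dist z I / 2) ^ 2)
      = √z.im ^ 2 * ‖chart z‖ ^ 2 * (4 * Real.cosh (dist z I / 2) ^ 2) := by rw [h2]
    _ = (‖chart z‖ * (2 * √z.im * Real.cosh (dist z I / 2))) ^ 2 := by ring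
    _ = 1 := by rw [h1, one_pow]

theorem cosh_le_exp {x : ℝ} (hx : 0 ≤ x) : Real.cosh x ≤ Real.exp x := by
  have : Real.exp (-x) ≤ Real.exp x := Real.exp_le_exp.2 (by linarith)
  rw [Real.cosh_eq]; linarith

theorem exp_div_two_le_cosh (x : ℝ) : Real.exp x / 2 ≤ Real.cosh x := by
  have := Real.exp_pos (-x)
  rw [Real.cosh_eq]; linarith

theorem exp_neg_dist_le_chart_defect (z : UpperHalfPlane) :
    Real.exp (-dist z I) ≤ 4 * (-(chart z).im - ‖chart z‖ ^ 2) := by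
  rw [chart_defect]
  have h1 := im_mul_norm_chart_sq z
  have h2 := cosh_le_exp (x := dist z I / 2) (by positivity)
  have h3 : Real.cosh (dist z I / 2) ^ 2 ≤ Real.exp (dist z I) := by
    calc Real.cosh (dist z I / 2) ^ 2 ≤ Real.exp (dist z I / 2) ^ 2 := by
          gcongr
      _ = Real.exp (dist z I) := by rw [← Real.exp_nat_mul]; congr 1; push_cast; ring
  rw [Real.exp_neg, inv_le_iff_one_le_mul₀ (Real.exp_pos _), ← h1]
  have : 0 ≤ z.im * ‖chart z‖ ^ 2 := mul_nonneg z.im_pos.le (by positivity)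
  nlinarith

theorem chart_defect_le (z : UpperHalfPlane) :
    -(chart z).im - ‖chart z‖ ^ 2 ≤ Real.exp (-dist z I) := by
  rw [chart_defect]
  have h1 := im_mul_norm_chart_sq z
  have h2 := exp_div_two_le_cosh (dist z I / 2)
  have h3 : Real.exp (dist z I) ≤ 4 * Real.cosh (dist z I / 2) ^ 2 := by
    have h4 : Real.exp (dist z I) = 4 * (Real.exp (dist z I / 2) / 2) ^ 2 := by
      rw [div_pow, ← Real.exp_nat_mul]
      have : ((2 : ℕ) : ℝ) * (dist z I / 2) = dist z I := by push_cast; ring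
      rw [this]; ring
    rw [h4]
    gcongr
  rw [Real.exp_neg, le_inv_comm₀ (by
    have := Real.cosh_pos (dist z I / 2); by_contra hcon; nlinarith [sq_nonneg ‖chart z‖])
    (Real.exp_pos _), ← one_div, le_div_iff₀ (by
    have := Real.cosh_pos (dist z I / 2); by_contra hcon; nlinarith [sq_nonneg ‖chart z‖])]
  have : 0 ≤ z.im * ‖chart z‖ ^ 2 := mul_nonneg z.im_pos.le (by positivity)
  nlinarith

/-- In the chart, Euclidean distance is comparable to `exp (-gromovProd I z w)`, up to a term that
vanishes at the boundary. Convergence to a boundary point can therefore be read off Gromov products.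
-/
theorem norm_chart_sub (z w : UpperHalfPlane) :
    2 * ‖chart z - chart w‖ * (Real.cosh (dist z I / 2) * Real.cosh (dist w I / 2)) =
      Real.sinh (dist z w / 2) := by
  have h1 := norm_ne_zero_iff.2 (coe_add_I_ne_zero z)
  have h2 := norm_ne_zero_iff.2 (coe_add_I_ne_zero w)
  have h3 := (Real.sqrt_pos.2 z.im_pos).ne'
  have h4 := (Real.sqrt_pos.2 w.im_pos).ne'
  have h5 : ‖chart z - chart w‖ =
      dist (z : ℂ) w / (‖(z : ℂ) + Complex.I‖ * ‖(w : ℂ) + Complex.I‖) := by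
    rw [chart, chart, inv_sub_inv (coe_add_I_ne_zero z) (coe_add_I_ne_zero w), norm_div, norm_mul,
      dist_comm, Complex.dist_eq]
    congr 2; ring
  rw [h5, cosh_half_dist_I, cosh_half_dist_I, sinh_half_dist, Real.sqrt_mul z.im_pos.le]
  field_simp

theorem exp_neg_gromovProd (w x y : UpperHalfPlane) :
    Real.exp (-gromovProd w x y) * (Real.exp (dist x w / 2) * Real.exp (dist y w / 2)) =
      Real.exp (dist x y / 2) := by
  rw [← Real.exp_add, ← Real.exp_add, gromovProd]
  congr 1; ring

theorem norm_chart_sub_le (z w : UpperHalfPlane) :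
    ‖chart z - chart w‖ ≤ Real.exp (-gromovProd I z w) := by
  have h1 := norm_chart_sub z w
  have h2 := exp_neg_gromovProd I z w
  have h3 := exp_div_two_le_cosh (dist z I / 2)
  have h4 := exp_div_two_le_cosh (dist w I / 2)
  have h5 : Real.sinh (dist z w / 2) ≤ Real.exp (dist z w / 2) / 2 := by
    rw [Real.sinh_eq]
    have := Real.exp_pos (-(dist z w / 2))
    linarith
  have h6 : Real.exp (dist z I / 2) / 2 * (Real.exp (dist w I / 2) / 2) ≤
      Real.cosh (dist z I / 2) * Real.cosh (dist w I / 2) := by gcongr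
  have h7 : 2 * ‖chart z - chart w‖ * (Real.exp (dist z I / 2) / 2 * (Real.exp (dist w I / 2) / 2))
      ≤ Real.exp (dist z w / 2) / 2 := by
    refine le_trans ?_ (h1.le.trans h5)
    gcongr
  rw [← h2] at h7
  have h8 : 0 < Real.exp (dist z I / 2) * Real.exp (dist w I / 2) := by positivity
  refine le_of_mul_le_mul_right ?_ h8
  linarith

theorem exp_neg_gromovProd_le (z w : UpperHalfPlane) :
    Real.exp (-gromovProd I z w) ≤
      4 * ‖chart z - chart w‖ + Real.exp (-(dist z I / 2)) * Real.exp (-(dist w I / 2)) := by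
  have h1 := norm_chart_sub z w
  have h2 := exp_neg_gromovProd I z w
  have h3 := cosh_le_exp (x := dist z I / 2) (by positivity)
  have h4 := cosh_le_exp (x := dist w I / 2) (by positivity)
  have h5 := exp_half_dist_le z w
  have h6 : Real.cosh (dist z I / 2) * Real.cosh (dist w I / 2) ≤
      Real.exp (dist z I / 2) * Real.exp (dist w I / 2) := by
    gcongr
  have h8 : 0 < Real.exp (dist z I / 2) * Real.exp (dist w I / 2) := by positivity
  refine le_of_mul_le_mul_right ?_ h8
  rw [h2, add_mul]
  have h9 : Real.exp (-(dist z I / 2)) * Real.exp (-(dist w I / 2)) *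
      (Real.exp (dist z I / 2) * Real.exp (dist w I / 2)) = 1 := by
    rw [← Real.exp_add, ← Real.exp_add, ← Real.exp_add, ← Real.exp_zero]; congr 1; ring
  rw [h9]
  have h10 : 4 * ‖chart z - chart w‖ * (Real.cosh (dist z I / 2) * Real.cosh (dist w I / 2)) ≤
      4 * ‖chart z - chart w‖ * (Real.exp (dist z I / 2) * Real.exp (dist w I / 2)) := by gcongr
  linarith

/-! ### Convergence to the boundary in terms of Gromov products -/

section Tendsto

variable {α : Type*} {l : Filter α} {p q : α → UpperHalfPlane} {ξ η : BoundaryH2}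

theorem boundaryChart_defect (ξ : BoundaryH2) :
    -(boundaryChart ξ).im - ‖boundaryChart ξ‖ ^ 2 = 0 := by
  induction ξ using OnePoint.rec with
  | infty =>
    have : boundaryChart OnePoint.infty = 0 := rfl
    simp [this]
  | coe x =>
    have e2 : boundaryChart (x : OnePoint ℝ) = ((x : ℂ) + Complex.I)⁻¹ := rfl
    have h0 : Complex.normSq ((x : ℂ) + Complex.I) ≠ 0 := by
      rw [Ne, Complex.normSq_eq_zero]; exact ofReal_add_I_ne_zero x
    rw [e2, Complex.inv_im, norm_inv, inv_pow, ← Complex.normSq_eq_norm_sq]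
    simp only [Complex.add_im, Complex.I_im, Complex.ofReal_im]
    field_simp
    ring

theorem exists_boundaryChart_eq {k : ℂ} (hk : -k.im - ‖k‖ ^ 2 = 0) : ∃ ξ, boundaryChart ξ = k := by
  by_cases h0 : k = 0
  · exact ⟨OnePoint.infty, h0.symm⟩
  · refine ⟨((k⁻¹).re : ℝ), ?_⟩
    have e2 : boundaryChart (((k⁻¹).re : ℝ) : OnePoint ℝ) = (((k⁻¹).re : ℂ) + Complex.I)⁻¹ := rfl
    rw [e2, inv_eq_iff_eq_inv]
    apply Complex.ext
    · simp
    · have hn : Complex.normSq k ≠ 0 := by rwa [Ne, Complex.normSq_eq_zero]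
      rw [← Complex.normSq_eq_norm_sq] at hk
      simp only [Complex.add_im, Complex.ofReal_im, Complex.I_im, zero_add, Complex.inv_im]
      field_simp
      linarith

theorem tendsto_dist_atTop_of_boundaryNhds (h : Tendsto p l (boundaryNhds ξ)) :
    Tendsto (fun a => dist (p a) I) l atTop := by
  rw [tendsto_boundaryNhds_iff_chart] at h
  have h1 : Tendsto (fun a => 4 * (-(chart (p a)).im - ‖chart (p a)‖ ^ 2)) l (𝓝 0) := by
    have h2 := (((Complex.continuous_im.tendsto _).comp h).neg.sub ((h.norm).pow 2)).const_mul 4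
    rw [boundaryChart_defect, mul_zero] at h2
    exact h2
  have h3 : Tendsto (fun a => Real.exp (-dist (p a) I)) l (𝓝 0) :=
    squeeze_zero (fun _ => (Real.exp_pos _).le) (fun a => exp_neg_dist_le_chart_defect (p a)) h1
  rw [Real.tendsto_exp_comp_nhds_zero, tendsto_neg_atBot_iff] at h3
  exact h3

theorem tendsto_gromovProd_atTop (hp : Tendsto p l (boundaryNhds ξ))
    (hq : Tendsto q l (boundaryNhds ξ)) :
    Tendsto (fun a => gromovProd I (p a) (q a)) l atTop := by
  have dp := tendsto_dist_atTop_of_boundaryNhds hp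
  have dq := tendsto_dist_atTop_of_boundaryNhds hq
  have half : ∀ {r : α → UpperHalfPlane}, Tendsto (fun a => dist (r a) I) l atTop →
      Tendsto (fun a => Real.exp (-(dist (r a) I / 2))) l (𝓝 0) := by
    intro r hr
    rw [Real.tendsto_exp_comp_nhds_zero, tendsto_neg_atBot_iff]
    exact hr.atTop_div_const (by norm_num)
  rw [tendsto_boundaryNhds_iff_chart] at hp hq
  have h1 := (((hp.sub hq).norm).const_mul 4).add ((half dp).mul (half dq))
  rw [sub_self, norm_zero, mul_zero, mul_zero, add_zero] at h1
  have h3 : Tendsto (fun a => Real.exp (-gromovProd I (p a) (q a))) l (𝓝 0) :=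
    squeeze_zero (fun _ => (Real.exp_pos _).le) (fun a => exp_neg_gromovProd_le (p a) (q a)) h1
  rw [Real.tendsto_exp_comp_nhds_zero, tendsto_neg_atBot_iff] at h3
  exact h3

theorem tendsto_boundaryNhds_of_gromovProd (hp : Tendsto p l (boundaryNhds ξ))
    (h : Tendsto (fun a => gromovProd I (p a) (q a)) l atTop) :
    Tendsto q l (boundaryNhds ξ) := by
  rw [tendsto_boundaryNhds_iff_chart] at hp ⊢
  have h1 : Tendsto (fun a => Real.exp (-gromovProd I (p a) (q a))) l (𝓝 0) := by
    rw [Real.tendsto_exp_comp_nhds_zero, tendsto_neg_atBot_iff]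
    exact h
  have h2 : Tendsto (fun a => chart (p a) - chart (q a)) l (𝓝 0) :=
    squeeze_zero_norm (fun a => norm_chart_sub_le (p a) (q a)) h1
  have h3 := hp.sub h2
  simpa using h3

theorem tendsto_boundaryNhds_of_dist_le (hp : Tendsto p l (boundaryNhds ξ)) {C : ℝ}
    (h : ∀ a, dist (p a) (q a) ≤ C) : Tendsto q l (boundaryNhds ξ) := by
  refine tendsto_boundaryNhds_of_gromovProd hp
    (tendsto_atTop_mono (fun a => ?_) (tendsto_atTop_add_const_right _ (-C)
      (tendsto_dist_atTop_of_boundaryNhds hp)))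
  have h1 := le_gromovProd_add_dist I (p a) (p a) (q a)
  rw [gromovProd_self, gromovProd_comm] at h1
  have := h a
  linarith

/-- The chart takes values in a compact ball, so a limit exists; the defect tends to `0`, so the
limit lies on the circle. -/
theorem exists_tendsto_boundaryNhds (u : Ultrafilter α)
    (h : Tendsto (fun a => dist (p a) I) u atTop) :
    ∃ ξ, Tendsto p u (boundaryNhds ξ) := by
  have hb : ∀ z : UpperHalfPlane, ‖chart z‖ ≤ 1 := by
    intro z
    rw [chart, norm_inv]
    refine inv_le_one_of_one_le₀ ?_
    have h1 := Complex.abs_im_le_norm ((z : ℂ) + Complex.I)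
    simp only [Complex.add_im, Complex.I_im, UpperHalfPlane.coe_im] at h1
    have h2 := le_abs_self (z.im + 1)
    have := z.im_pos
    linarith
  obtain ⟨k, -, hk⟩ := (isCompact_closedBall (0 : ℂ) 1).ultrafilter_le_nhds
    (u.map fun a => chart (p a)) (by
      rw [le_principal_iff]
      exact Filter.mem_map.2 (univ_mem' fun a => by simpa using hb (p a)))
  have hk' : Tendsto (fun a => chart (p a)) u (𝓝 k) := hk
  have h1 := ((Complex.continuous_im.tendsto _).comp hk').neg.sub ((hk'.norm).pow 2)
  have h2 : Tendsto (fun a => Real.exp (-dist (p a) I)) u (𝓝 0) := by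
    rw [Real.tendsto_exp_comp_nhds_zero, tendsto_neg_atBot_iff]
    exact h
  have h3 : Tendsto (fun a => -(chart (p a)).im - ‖chart (p a)‖ ^ 2) u (𝓝 0) := by
    refine squeeze_zero (fun a => ?_) (fun a => chart_defect_le (p a)) h2
    rw [chart_defect]
    exact mul_nonneg (p a).im_pos.le (by positivity)
  obtain ⟨ξ, rfl⟩ := exists_boundaryChart_eq (tendsto_nhds_unique h1 h3)
  exact ⟨ξ, tendsto_boundaryNhds_iff_chart.2 hk'⟩

theorem eq_of_tendsto_boundaryNhds [l.NeBot] (h : Tendsto p l (boundaryNhds ξ))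
    (h' : Tendsto p l (boundaryNhds η)) : ξ = η :=
  boundaryToSphere_injective (tendsto_nhds_unique (tendsto_boundaryNhds_iff.1 h)
    (tendsto_boundaryNhds_iff.1 h'))

end Tendsto

/-- A vertical geodesic ray with given endpoint. -/
noncomputable def rayTo (ξ : BoundaryH2) (t : ℝ≥0) : UpperHalfPlane :=
  ξ.elim (vert 0 t) fun x => vert x (-t)

theorem isometry_rayTo (ξ : BoundaryH2) : Isometry (rayTo ξ) := by
  refine Isometry.of_dist_eq fun s t => ?_
  induction ξ using OnePoint.rec with
  | infty =>
    change dist (vert 0 s) (vert 0 t) = _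
    rw [dist_vert_vert_same, NNReal.dist_eq]
  | coe x =>
    change dist (vert x (-s)) (vert x (-t)) = _
    rw [dist_vert_vert_same, NNReal.dist_eq, ← abs_neg]
    congr 1; ring

theorem tendsto_vert_atBot (x : ℝ) : Tendsto (vert x) atBot (boundaryNhds (x : OnePoint ℝ)) := by
  rw [tendsto_boundaryNhds_coe_iff]
  have h : Tendsto (fun t : ℝ => (x : ℂ) + (Real.exp t : ℝ) * Complex.I) atBot
      (𝓝 ((x : ℂ) + ((0 : ℝ) : ℂ) * Complex.I)) :=
    ((((Complex.continuous_ofReal.tendsto 0).comp Real.tendsto_exp_atBot)).mul_const _).const_add _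
  simp only [Complex.ofReal_zero, zero_mul, add_zero] at h
  refine h.congr fun t => ?_
  apply Complex.ext
  · simp
  · simp [Complex.exp_ofReal_re]

theorem tendsto_vert_atTop (x : ℝ) : Tendsto (vert x) atTop (boundaryNhds OnePoint.infty) := by
  rw [tendsto_boundaryNhds_iff_chart]
  change Tendsto _ _ (𝓝 0)
  refine squeeze_zero_norm (fun t => ?_) Real.tendsto_exp_neg_atTop_nhds_zero
  rw [chart, norm_inv, Real.exp_neg]
  refine inv_anti₀ (Real.exp_pos t) ?_
  have h1 := Complex.abs_im_le_norm ((vert x t : ℂ) + Complex.I)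
  simp only [Complex.add_im, Complex.I_im, UpperHalfPlane.coe_im, vert_im] at h1
  have h2 := le_abs_self (Real.exp t + 1)
  linarith

theorem tendsto_rayTo (ξ : BoundaryH2) : Tendsto (rayTo ξ) atTop (boundaryNhds ξ) := by
  have hc : Tendsto (fun t : ℝ≥0 => (t : ℝ)) atTop atTop := NNReal.tendsto_coe_atTop.2 tendsto_id
  induction ξ using OnePoint.rec with
  | infty => exact (tendsto_vert_atTop 0).comp hc
  | coe x => exact (tendsto_vert_atBot x).comp (tendsto_neg_atTop_atBot.comp hc)

theorem isRayTo_rayTo (ξ : BoundaryH2) : IsRayTo (rayTo ξ) ξ :=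
  ⟨isometry_rayTo ξ, tendsto_boundaryNhds_iff.1 (tendsto_rayTo ξ)⟩

instance neBot_boundaryNhds (ξ : BoundaryH2) : (boundaryNhds ξ).NeBot := (tendsto_rayTo ξ).neBot

namespace ExtendsContinuouslyBy

variable {f g : UpperHalfPlane → UpperHalfPlane} {b c : BoundaryH2 → BoundaryH2}

theorem tendsto (h : ExtendsContinuouslyBy f b) (x : BoundaryH2) :
    Tendsto f (boundaryNhds x) (boundaryNhds (b x)) :=
  extendsContinuouslyBy_iff.1 h x

theorem comp (hg : ExtendsContinuouslyBy g c) (hf : ExtendsContinuouslyBy f b) :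
    ExtendsContinuouslyBy (g ∘ f) (c ∘ b) :=
  extendsContinuouslyBy_iff.2 fun x => (hg.tendsto (b x)).comp (hf.tendsto x)

protected theorem id : ExtendsContinuouslyBy id id :=
  extendsContinuouslyBy_iff.2 fun _ => tendsto_id

theorem unique (h : ExtendsContinuouslyBy f b) (h' : ExtendsContinuouslyBy f c) : b = c :=
  funext fun x => eq_of_tendsto_boundaryNhds (h.tendsto x) (h'.tendsto x)

theorem of_dist_le (h : ExtendsContinuouslyBy f b) {C : ℝ} (hC : ∀ z, dist (f z) (g z) ≤ C) :
    ExtendsContinuouslyBy g b :=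
  extendsContinuouslyBy_iff.2 fun x => tendsto_boundaryNhds_of_dist_le (h.tendsto x) hC

/-- Continuity of `f` plays no role: if `f` maps a trace of an open neighbourhood of `x` into a
closed set, its limits at nearby boundary points stay in that set. -/
theorem continuous (h : ExtendsContinuouslyBy f b) : Continuous b := by
  have hemb : IsEmbedding boundaryToSphere :=
    (continuous_boundaryToSphere.isClosedEmbedding boundaryToSphere_injective).isEmbedding
  rw [hemb.continuous_iff, continuous_iff_continuousAt]
  intro x
  rw [ContinuousAt, (closed_nhds_basis _).tendsto_right_iff]
  rintro U ⟨hU, hUc⟩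
  have h1 : ∀ᶠ z in boundaryNhds x, toSphere (f z) ∈ U :=
    (tendsto_boundaryNhds_iff.1 (h.tendsto x)).eventually hU
  obtain ⟨V, hV, hVU⟩ := Filter.mem_comap.1 h1
  obtain ⟨W, hWV, hWo, hxW⟩ := mem_nhds_iff.1 hV
  filter_upwards [continuous_boundaryToSphere.continuousAt.preimage_mem_nhds (hWo.mem_nhds hxW)]
    with y hy
  refine hUc.mem_of_tendsto (tendsto_boundaryNhds_iff.1 (h.tendsto y)) ?_
  exact Filter.mem_comap.2 ⟨W, hWo.mem_nhds hy, fun z hz => hVU (hWV hz)⟩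

end ExtendsContinuouslyBy

/-! ### Boundary extension of Morse maps -/

namespace IsMorseMap

variable {L K : ℝ} {M : ℝ → ℝ} {f : UpperHalfPlane → UpperHalfPlane}

/-- The point `m` at distance `gromovProd o x y` from `o` towards `x` is coarsely between `o` and
each of `x` and `y`. The Morse property preserves this, and the lower bound on distances carries `f
m` away from `f o`. -/
theorem le_gromovProd (h : IsMorseMap L K M f) : ∃ C, ∀ o x y,
    gromovProd o x y / L - C ≤ gromovProd (f o) (f x) (f y) := by
  have hL := h.pos
  refine ⟨(1 + K) / L + max (M 1) (M 4) + 2, fun o x y => ?_⟩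
  set t := gromovProd o x y with ht
  obtain ⟨m, h1, h2⟩ := exists_rough_geodesic_point o x (gromovProd_nonneg o x y)
    (by rw [dist_comm]; exact gromovProd_le_left o x y)
  have h3 : gromovProd m o x ≤ 1 := by
    simp only [gromovProd]
    rw [dist_comm x m]
    linarith
  have h0 := dist_triangle o m x
  have h4 : t - 3 ≤ gromovProd o m y := by
    have e1 : t - 1 ≤ gromovProd o m x := by
      simp only [gromovProd]
      rw [dist_comm m o, dist_comm x o]
      linarith
    have := le_gromovProd_of_le e1 (show t - 1 ≤ gromovProd o x y by linarith)
    linarith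
  have h5 : gromovProd m o y ≤ 4 := by
    have e := gromovProd_add_gromovProd o m y
    rw [dist_comm m o] at e
    linarith
  have k1 := h.morse _ _ _ _ h3
  have k2 := h.morse _ _ _ _ h5
  have k3 := h.lower o m
  have e1 := gromovProd_add_gromovProd (f o) (f m) (f x)
  have e2 := gromovProd_add_gromovProd (f o) (f m) (f y)
  have hm : (t - 1 - K) / L ≤ dist (f m) (f o) := by
    rw [div_le_iff₀ hL, dist_comm]
    linarith
  have e3 : t / L - ((1 + K) / L + max (M 1) (M 4)) ≤ gromovProd (f o) (f x) (f m) := by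
    rw [gromovProd_comm]
    have := le_max_left (M 1) (M 4)
    have e : (t - 1 - K) / L = t / L - (1 + K) / L := by ring
    linarith
  have e4 : t / L - ((1 + K) / L + max (M 1) (M 4)) ≤ gromovProd (f o) (f m) (f y) := by
    have := le_max_right (M 1) (M 4)
    have e : (t - 1 - K) / L = t / L - (1 + K) / L := by ring
    linarith
  have := le_gromovProd_of_le e3 e4
  linarith

theorem tendsto_gromovProd (h : IsMorseMap L K M f) {α : Type*} {l : Filter α}
    {p q : α → UpperHalfPlane} (hpq : Tendsto (fun a => gromovProd I (p a) (q a)) l atTop) :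
    Tendsto (fun a => gromovProd I (f (p a)) (f (q a))) l atTop := by
  obtain ⟨C, hC⟩ := h.le_gromovProd
  refine tendsto_atTop_mono (fun a => ?_)
    (tendsto_atTop_add_const_right _ (-C - dist (f I) I) (hpq.atTop_div_const h.pos))
  have h1 := hC I (p a) (q a)
  have h2 := gromovProd_base (f I) I (f (p a)) (f (q a))
  linarith

theorem tendsto_dist (h : IsMorseMap L K M f) {α : Type*} {l : Filter α}
    {p : α → UpperHalfPlane} (hp : Tendsto (fun a => dist (p a) I) l atTop) :
    Tendsto (fun a => dist (f (p a)) I) l atTop := by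
  have := h.tendsto_gromovProd (p := p) (q := p) (by simpa only [gromovProd_self] using hp)
  simpa only [gromovProd_self] using this

/-- A Morse map of `ℍ²` extends continuously to the boundary circle. -/
theorem exists_extendsContinuouslyBy (h : IsMorseMap L K M f) :
    ∃ b, ExtendsContinuouslyBy f b := by
  have key : ∀ x, ∃ y, Tendsto f (boundaryNhds x) (boundaryNhds y) := by
    intro x
    set u := Ultrafilter.of (boundaryNhds x) with hu
    have hux : (u : Filter UpperHalfPlane) ≤ boundaryNhds x := Ultrafilter.of_le _
    have hid : Tendsto id (u : Filter UpperHalfPlane) (boundaryNhds x) := hux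
    obtain ⟨y, hy⟩ := exists_tendsto_boundaryNhds (p := f) u
      (h.tendsto_dist (p := id) (tendsto_dist_atTop_of_boundaryNhds hid))
    refine ⟨y, ?_⟩
    -- Comparing the ultrafilter with the whole trace filter upgrades the limit along the former to
    -- a limit along the latter.
    have h1 : Tendsto (fun a : UpperHalfPlane × UpperHalfPlane => gromovProd I (f a.1) (f a.2))
        ((u : Filter UpperHalfPlane) ×ˢ boundaryNhds x) atTop :=
      h.tendsto_gromovProd (tendsto_gromovProd_atTop (ξ := x)
        (hid.comp tendsto_fst) tendsto_snd)
    have h2 := tendsto_boundaryNhds_of_gromovProd (hy.comp tendsto_fst) h1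
    have h3 : Tendsto f (map Prod.snd ((u : Filter UpperHalfPlane) ×ˢ boundaryNhds x))
        (boundaryNhds y) := h2
    rwa [map_snd_prod] at h3
  choose b hb using key
  exact ⟨b, extendsContinuouslyBy_iff.2 hb⟩

/-- The continuous extension gives the boundary values, and nothing else does. -/
theorem hasBoundaryValues_iff (h : IsMorseMap L K M f) {b b' : BoundaryH2 → BoundaryH2}
    (hb : ExtendsContinuouslyBy f b) : HasBoundaryValues f b' ↔ b' = b := by
  constructor
  · intro hb'
    funext x
    obtain ⟨γ', ⟨hγ', hlim⟩, C, hC⟩ := hb' x (rayTo x) (isRayTo_rayTo x)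
    choose s hs using hC
    have h1 : Tendsto (fun t => f (rayTo x t)) atTop (boundaryNhds (b x)) :=
      (hb.tendsto x).comp (tendsto_rayTo x)
    have h2 : Tendsto (fun t => γ' (s t)) atTop (boundaryNhds (b x)) :=
      tendsto_boundaryNhds_of_dist_le h1 hs
    have h3 : Tendsto s atTop atTop := by
      rw [← NNReal.tendsto_coe_atTop]
      refine tendsto_atTop_mono (fun t => ?_) (tendsto_atTop_add_const_right _ (-dist (γ' 0) I)
        (tendsto_dist_atTop_of_boundaryNhds h2))
      have h4 := dist_triangle (γ' (s t)) (γ' 0) I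
      rw [hγ'.dist_eq, NNReal.dist_eq, NNReal.coe_zero, sub_zero,
        abs_of_nonneg (s t).coe_nonneg] at h4
      linarith
    exact eq_of_tendsto_boundaryNhds ((tendsto_boundaryNhds_iff.2 hlim).comp h3) h2
  · rintro rfl x γ ⟨hγ, hlim⟩
    set v := rayTo (b' x) with hv
    have hviso := isometry_rayTo (b' x)
    refine ⟨v, isRayTo_rayTo _, 2 * (M 0 + 2 + dist (f (γ 0)) (v 0)) + 4, fun t => ?_⟩
    set p := f (γ t) with hp
    have h1 : Tendsto (fun s => f (γ s)) atTop (boundaryNhds (b' x)) :=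
      (hb.tendsto x).comp (tendsto_boundaryNhds_iff.2 hlim)
    have h2 := tendsto_gromovProd_atTop h1 (tendsto_rayTo (b' x))
    -- `p` is compared with the point of `v` equally far from `v 0`. For large `s` the points `f (γ
    -- s)` and `v s` have nearly the same direction from `p`, so `p` lies coarsely between `v 0` and
    -- `v s`, and the four point condition bounds its distance to `v s'`.
    set s' : ℝ≥0 := ⟨dist p (v 0), dist_nonneg⟩ with hs'
    obtain ⟨s, ⟨h3, h4⟩, h5⟩ := ((((eventually_ge_atTop t).and (eventually_ge_atTop s'))).and
      (h2.eventually_ge_atTop (M 0 + 3 + dist I p))).exists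
    have h6 : gromovProd (γ t) (γ 0) (γ s) ≤ 0 := by
      simp only [gromovProd]
      rw [hγ.dist_eq, hγ.dist_eq, hγ.dist_eq, NNReal.dist_eq, NNReal.dist_eq, NNReal.dist_eq]
      have h3' : (t : ℝ) ≤ s := h3
      have ht0 : (0 : ℝ) ≤ t := t.2
      rw [NNReal.coe_zero, zero_sub, zero_sub, abs_neg, abs_neg, abs_of_nonneg ht0,
        abs_of_nonneg (ht0.trans h3'), abs_of_nonneg (sub_nonneg.2 h3')]
      linarith
    have h7 := h.morse _ _ _ _ h6
    have h8 := gromovProd_base I p (f (γ s)) (v s)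
    have h9 : gromovProd p (f (γ 0)) (v s) ≤ M 0 + 2 := by
      by_contra hcon
      push Not at hcon
      set r := min (gromovProd p (f (γ 0)) (v s)) (M 0 + 3) with hr
      have f0 : M 0 + 2 < r := lt_min hcon (by linarith)
      have f1 : M 0 + 3 ≤ gromovProd p (v s) (f (γ s)) := by
        rw [gromovProd_comm]; linarith
      have := le_gromovProd_of_le (min_le_left _ _ : r ≤ _) ((min_le_right _ _).trans f1)
      linarith
    have h10 := le_gromovProd_add_dist p (v 0) (v s) (f (γ 0))
    rw [dist_comm (v 0)] at h10
    have h4' : (s' : ℝ) ≤ s := h4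
    have hs'0 : (0 : ℝ) ≤ s' := s'.2
    have d1 : dist (v 0) (v s) = s := by
      rw [hviso.dist_eq, NNReal.dist_eq, NNReal.coe_zero, zero_sub, abs_neg,
        abs_of_nonneg s.coe_nonneg]
    have d2 : dist (v 0) (v s') = s' := by
      rw [hviso.dist_eq, NNReal.dist_eq, NNReal.coe_zero, zero_sub, abs_neg,
        abs_of_nonneg s'.coe_nonneg]
    have d3 : dist (v s') (v s) = s - s' := by
      rw [hviso.dist_eq, NNReal.dist_eq, abs_sub_comm, abs_of_nonneg (sub_nonneg.2 h4')]
    have d4 : dist p (v 0) = s' := rfl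
    have h11 := four_point p (v 0) (v s') (v s)
    refine ⟨s', ?_⟩
    simp only [gromovProd] at h9 h10
    rw [dist_comm (v 0) p, dist_comm (v s) p, d4, d1] at h10
    have hM0 : 0 ≤ M 0 := (gromovProd_nonneg _ _ _).trans h7
    have hd0 : 0 ≤ dist (f (γ 0)) (v 0) := dist_nonneg
    have h12 : max (dist p (v 0) + dist (v s') (v s)) (dist (v 0) (v s') + dist p (v s)) ≤
        s + 2 * (M 0 + 2 + dist (f (γ 0)) (v 0)) := by
      rw [d4, d3, d2]
      rw [dist_comm (v s) p] at h9
      exact max_le (by linarith) (by linarith)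
    rw [d1] at h11
    linarith

end IsMorseMap

open UpperHalfPlane

/-! ### The Beurling–Ahlfors extension -/

/-- A quasisymmetric homeomorphism of the real line (increasing, with constant `M`). -/
structure IsLineQuasisymmetric (M : ℝ) (h : ℝ → ℝ) : Prop where
  nonneg : 0 ≤ M
  continuous : Continuous h
  strictMono : StrictMono h
  surjective : Function.Surjective h
  right_le : ∀ x t, 0 < t → h (x + t) - h x ≤ M * (h x - h (x - t))
  left_le : ∀ x t, 0 < t → h x - h (x - t) ≤ M * (h (x + t) - h x)

namespace BeurlingAhlfors

/-- A primitive of `h`. -/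
noncomputable def prim (h : ℝ → ℝ) (x : ℝ) : ℝ := ∫ t in (0 : ℝ)..x, h t

/-- The mean value of `h` on `[a, b]`. -/
noncomputable def mean (h : ℝ → ℝ) (a b : ℝ) : ℝ := (prim h b - prim h a) / (b - a)

variable {h : ℝ → ℝ}

theorem hasStrictDerivAt_prim (hc : Continuous h) (x : ℝ) :
    HasStrictDerivAt (prim h) (h x) x :=
  intervalIntegral.integral_hasStrictDerivAt_right (hc.intervalIntegrable _ _)
    (hc.stronglyMeasurableAtFilter _ _) hc.continuousAt

theorem continuous_prim (hc : Continuous h) : Continuous (prim h) :=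
  continuous_iff_continuousAt.2 fun x => (hasStrictDerivAt_prim hc x).hasDerivAt.continuousAt

theorem exists_mean_eq (hc : Continuous h) {a b : ℝ} (hab : a < b) :
    ∃ c ∈ Ioo a b, mean h a b = h c := by
  obtain ⟨c, hc1, hc2⟩ := exists_hasDerivAt_eq_slope (prim h) h hab
    (continuous_prim hc).continuousOn fun x _ => (hasStrictDerivAt_prim hc x).hasDerivAt
  exact ⟨c, hc1, hc2.symm⟩

theorem lt_mean (hc : Continuous h) (hm : StrictMono h) {a b : ℝ} (hab : a < b) :
    h a < mean h a b := by
  obtain ⟨c, hc1, hc2⟩ := exists_mean_eq hc hab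
  rw [hc2]; exact hm hc1.1

theorem mean_lt (hc : Continuous h) (hm : StrictMono h) {a b : ℝ} (hab : a < b) :
    mean h a b < h b := by
  obtain ⟨c, hc1, hc2⟩ := exists_mean_eq hc hab
  rw [hc2]; exact hm hc1.2

theorem mean_mul {a b : ℝ} (hab : a < b) : mean h a b * (b - a) = prim h b - prim h a := by
  rw [mean, div_mul_cancel₀]; linarith

theorem mean_lt_mean_right (hc : Continuous h) (hm : StrictMono h)
    {a b b' : ℝ} (hab : a < b) (hb : b < b') :
    mean h a b < mean h a b' := by
  have h1 := mean_mul (h := h) hab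
  have h2 := mean_mul (h := h) hb
  have h3 := mean_mul (h := h) (hab.trans hb)
  have h4 := mean_lt hc hm hab
  have h5 := lt_mean hc hm hb
  have h6 : (mean h a b' - mean h a b) * (b' - a) = (mean h b b' - mean h a b) * (b' - b) := by
    linarith
  have h7 : 0 < (mean h a b' - mean h a b) * (b' - a) := by
    rw [h6]; exact mul_pos (by linarith) (by linarith)
  have := pos_of_mul_pos_left h7 (by linarith)
  linarith

theorem mean_lt_mean_left (hc : Continuous h) (hm : StrictMono h)
    {a a' b : ℝ} (ha : a < a') (hab : a' < b) :
    mean h a b < mean h a' b := by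
  have h1 := mean_mul (h := h) ha
  have h2 := mean_mul (h := h) hab
  have h3 := mean_mul (h := h) (ha.trans hab)
  have h4 := mean_lt hc hm ha
  have h5 := lt_mean hc hm hab
  have h6 : (mean h a' b - mean h a b) * (b - a) = (mean h a' b - mean h a a') * (a' - a) := by
    linarith
  have h7 : 0 < (mean h a' b - mean h a b) * (b - a) := by
    rw [h6]; exact mul_pos (by linarith) (by linarith)
  have := pos_of_mul_pos_left h7 (by linarith)
  linarith

theorem mean_midpoint {a b : ℝ} (hab : a < b) :
    mean h a b = (mean h a ((a + b) / 2) + mean h ((a + b) / 2) b) / 2 := by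
  have h1 : b - a ≠ 0 := by linarith
  rw [mean, mean, mean, show (a + b) / 2 - a = (b - a) / 2 by ring,
    show b - (a + b) / 2 = (b - a) / 2 by ring]
  field_simp
  ring

theorem mean_le_midpoint (hc : Continuous h) (hm : StrictMono h) {a b : ℝ} (hab : a < b) :
    mean h a b ≤ (h ((a + b) / 2) + h b) / 2 := by
  have h1 := mean_lt hc hm (show a < (a + b) / 2 by linarith)
  have h2 := mean_lt hc hm (show (a + b) / 2 < b by linarith)
  rw [mean_midpoint hab]
  linarith

theorem midpoint_le_mean (hc : Continuous h) (hm : StrictMono h) {a b : ℝ} (hab : a < b) :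
    (h a + h ((a + b) / 2)) / 2 ≤ mean h a b := by
  have h1 := lt_mean hc hm (show a < (a + b) / 2 by linarith)
  have h2 := lt_mean hc hm (show (a + b) / 2 < b by linarith)
  rw [mean_midpoint hab]
  linarith

/-- If `x < x'`, equal right means force `x' + y' < x + y` and equal left means force `x' - y' < x -
y`; the sum contradicts `x < x'`. -/
theorem eq_of_mean_eq (hc : Continuous h) (hm : StrictMono h) {x x' y y' : ℝ}
    (hy : 0 < y) (hy' : 0 < y')
    (h1 : mean h x (x + y) = mean h x' (x' + y')) (h2 : mean h (x - y) x = mean h (x' - y') x') :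
    x = x' ∧ y = y' := by
  have key : ∀ x x' y y' : ℝ, 0 < y → 0 < y' → mean h x (x + y) = mean h x' (x' + y') →
      mean h (x - y) x = mean h (x' - y') x' → ¬ x < x' := by
    intro x x' y y' hy hy' h1 h2 hx
    have hb : x' + y' < x + y := by
      by_contra hcon
      push Not at hcon
      have e1 : mean h x (x + y) ≤ mean h x (x' + y') := by
        rcases hcon.eq_or_lt with e | e
        · rw [e]
        · exact (mean_lt_mean_right hc hm (by linarith) e).le
      have e2 := mean_lt_mean_left hc hm hx (show x' < x' + y' by linarith)
      linarith
    have ha : x' - y' < x - y := by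
      by_contra hcon
      push Not at hcon
      have e1 : mean h (x - y) x' ≤ mean h (x' - y') x' := by
        rcases hcon.eq_or_lt with e | e
        · rw [e]
        · exact (mean_lt_mean_left hc hm e (by linarith)).le
      have e2 := mean_lt_mean_right hc hm (show x - y < x by linarith) hx
      linarith
    linarith
  have hx : x = x' := le_antisymm (not_lt.1 (key x' x y' y hy' hy h1.symm h2.symm))
    (not_lt.1 (key x x' y y' hy hy' h1 h2))
  subst hx
  refine ⟨rfl, le_antisymm (not_lt.1 fun hlt => ?_) (not_lt.1 fun hlt => ?_)⟩
  · exact (mean_lt_mean_right hc hm (show x < x + y' by linarith)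
      (show x + y' < x + y by linarith)).ne h1.symm
  · exact (mean_lt_mean_right hc hm (show x < x + y by linarith)
      (show x + y < x + y' by linarith)).ne h1

/-- The Beurling–Ahlfors extension, as a map of the plane. -/
noncomputable def planeMap (h : ℝ → ℝ) (z : ℂ) : ℂ :=
  ⟨(mean h z.re (z.re + z.im) + mean h (z.re - z.im) z.re) / 2,
    (mean h z.re (z.re + z.im) - mean h (z.re - z.im) z.re) / 2⟩

/-- The Beurling–Ahlfors extension of an increasing homeomorphism of the line. -/
noncomputable def extension (hc : Continuous h) (hm : StrictMono h) (z : UpperHalfPlane) :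
    UpperHalfPlane :=
  ⟨planeMap h z, by
    have h0 := z.im_pos
    have h1 := lt_mean hc hm (show z.re < z.re + z.im by linarith)
    have h2 := mean_lt hc hm (show z.re - z.im < z.re by linarith)
    change 0 < (mean h z.re (z.re + z.im) - mean h (z.re - z.im) z.re) / 2
    linarith⟩

theorem coe_extension (hc : Continuous h) (hm : StrictMono h) (z : UpperHalfPlane) :
    (extension hc hm z : ℂ) = planeMap h z := rfl

theorem planeMap_re_add_im (z : ℂ) :
    (planeMap h z).re + (planeMap h z).im = mean h z.re (z.re + z.im) := by
  simp only [planeMap]; ring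

theorem planeMap_re_sub_im (z : ℂ) :
    (planeMap h z).re - (planeMap h z).im = mean h (z.re - z.im) z.re := by
  simp only [planeMap]; ring

theorem extension_injective (hc : Continuous h) (hm : StrictMono h) :
    Function.Injective (extension hc hm) := by
  intro z w hzw
  have e : planeMap h (z : ℂ) = planeMap h (w : ℂ) := congrArg UpperHalfPlane.coe hzw
  have e1 := planeMap_re_add_im (h := h) (z : ℂ)
  have e2 := planeMap_re_sub_im (h := h) (z : ℂ)
  rw [e, planeMap_re_add_im] at e1
  rw [e, planeMap_re_sub_im] at e2
  obtain ⟨h1, h2⟩ := eq_of_mean_eq hc hm z.im_pos w.im_pos e1.symm e2.symm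
  exact UpperHalfPlane.ext (Complex.ext h1 h2)

/-- The differential of `planeMap h`. -/
noncomputable def planeDeriv (h : ℝ → ℝ) (z : ℂ) : ℂ →L[ℝ] ℂ :=
  let α : ℂ →L[ℝ] ℝ := ((h (z.re + z.im) - h z.re) / z.im) • Complex.reCLM +
    ((h (z.re + z.im) - mean h z.re (z.re + z.im)) / z.im) • Complex.imCLM
  let β : ℂ →L[ℝ] ℝ := ((h z.re - h (z.re - z.im)) / z.im) • Complex.reCLM +
    ((h (z.re - z.im) - mean h (z.re - z.im) z.re) / z.im) • Complex.imCLM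
  α.smulRight (⟨1 / 2, 1 / 2⟩ : ℂ) + β.smulRight (⟨1 / 2, -1 / 2⟩ : ℂ)

theorem planeDeriv_re_add_im (z v : ℂ) : (planeDeriv h z v).re + (planeDeriv h z v).im =
    (h (z.re + z.im) - h z.re) / z.im * v.re +
      (h (z.re + z.im) - mean h z.re (z.re + z.im)) / z.im * v.im := by
  simp [planeDeriv]; ring

theorem planeDeriv_re_sub_im (z v : ℂ) : (planeDeriv h z v).re - (planeDeriv h z v).im =
    (h z.re - h (z.re - z.im)) / z.im * v.re +
      (h (z.re - z.im) - mean h (z.re - z.im) z.re) / z.im * v.im := by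
  simp [planeDeriv]; ring

theorem hasStrictFDerivAt_planeMap (hc : Continuous h) {z : ℂ} (hz : z.im ≠ 0) :
    HasStrictFDerivAt (planeMap h) (planeDeriv h z) z := by
  have hre : HasStrictFDerivAt (fun w : ℂ => w.re) Complex.reCLM z :=
    Complex.reCLM.hasStrictFDerivAt
  have him : HasStrictFDerivAt (fun w : ℂ => w.im) Complex.imCLM z :=
    Complex.imCLM.hasStrictFDerivAt
  have hinv : HasStrictFDerivAt (fun w : ℂ => (w.im)⁻¹) (-(z.im ^ 2)⁻¹ • Complex.imCLM) z :=
    (hasStrictDerivAt_inv hz).comp_hasStrictFDerivAt z him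
  have hP0 := (hasStrictDerivAt_prim hc z.re).comp_hasStrictFDerivAt z hre
  have hP1 := (hasStrictDerivAt_prim hc (z.re + z.im)).comp_hasStrictFDerivAt z (hre.add him)
  have hP2 := (hasStrictDerivAt_prim hc (z.re - z.im)).comp_hasStrictFDerivAt z (hre.sub him)
  have hα := (hP1.sub hP0).mul hinv
  have hβ := (hP0.sub hP2).mul hinv
  have hF := (hα.smul_const (⟨1 / 2, 1 / 2⟩ : ℂ)).add (hβ.smul_const (⟨1 / 2, -1 / 2⟩ : ℂ))
  refine (hF.congr_fderiv ?_).congr_of_eventuallyEq (Eventually.of_forall fun w => ?_)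
  · ext v
    apply Complex.ext
    · simp [planeDeriv, mean, -Complex.ofReal_pow]
      field_simp
      ring
    · simp [planeDeriv, mean, -Complex.ofReal_pow]
      field_simp
      ring
  · by_cases hw : w.im = 0
    · apply Complex.ext <;> simp [planeMap, mean, hw]
    · apply Complex.ext
      · simp [planeMap, mean]
        field_simp
      · simp [planeMap, mean]
        field_simp
        ring

theorem continuous_extension (hc : Continuous h) (hm : StrictMono h) :
    Continuous (extension hc hm) := by
  rw [isOpenEmbedding_coe.isEmbedding.continuous_iff, continuous_iff_continuousAt]
  intro z
  exact (hasStrictFDerivAt_planeMap hc z.im_pos.ne').hasFDerivAt.continuousAt.comp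
    isOpenEmbedding_coe.continuous.continuousAt

section Bounds

variable {M : ℝ}

theorem _root_.IsLineQuasisymmetric.left_half_le (hh : IsLineQuasisymmetric M h) {x y : ℝ}
    (hy : 0 < y) : h (x + y) - h (x - y) ≤ (1 + M) * (h (x + y) - h x) := by
  have := hh.left_le x y hy
  linarith

theorem _root_.IsLineQuasisymmetric.right_half_le (hh : IsLineQuasisymmetric M h) {x y : ℝ}
    (hy : 0 < y) : h (x + y) - h (x - y) ≤ (1 + M) * (h x - h (x - y)) := by
  have := hh.right_le x y hy
  linarith

/-- The mean falls short of `h (x + y)` by at least half the increment of `h` over the last quarter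
of `[x - y, x + y]`. Quasisymmetry is used twice to compare this with the total increment, hence the
square. -/
theorem le_sub_mean (hh : IsLineQuasisymmetric M h) {x y : ℝ} (hy : 0 < y) :
    h (x + y) - h (x - y) ≤ 2 * (1 + M) ^ 2 * (h (x + y) - mean h x (x + y)) := by
  have h1 := mean_le_midpoint hh.continuous hh.strictMono (show x < x + y by linarith)
  have h2 := hh.left_half_le (x := x + y / 2) (y := y / 2) (by linarith)
  have h3 := hh.left_half_le (x := x) hy
  have h4 := hh.nonneg
  rw [show x + y / 2 + y / 2 = x + y by ring, show x + y / 2 - y / 2 = x by ring] at h2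
  rw [show (x + (x + y)) / 2 = x + y / 2 by ring] at h1
  calc h (x + y) - h (x - y) ≤ (1 + M) * (h (x + y) - h x) := h3
    _ ≤ (1 + M) * ((1 + M) * (2 * (h (x + y) - mean h x (x + y)))) := by
      refine mul_le_mul_of_nonneg_left (h2.trans ?_) (by linarith)
      exact mul_le_mul_of_nonneg_left (by linarith) (by linarith)
    _ = _ := by ring

theorem le_mean_sub (hh : IsLineQuasisymmetric M h) {x y : ℝ} (hy : 0 < y) :
    h (x + y) - h (x - y) ≤ 2 * (1 + M) ^ 2 * (mean h (x - y) x - h (x - y)) := by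
  have h1 := midpoint_le_mean hh.continuous hh.strictMono (show x - y < x by linarith)
  have h2 := hh.right_half_le (x := x - y / 2) (y := y / 2) (by linarith)
  have h3 := hh.right_half_le (x := x) hy
  have h4 := hh.nonneg
  rw [show x - y / 2 + y / 2 = x by ring, show x - y / 2 - y / 2 = x - y by ring] at h2
  rw [show (x - y + x) / 2 = x - y / 2 by ring] at h1
  calc h (x + y) - h (x - y) ≤ (1 + M) * (h x - h (x - y)) := h3
    _ ≤ (1 + M) * ((1 + M) * (2 * (mean h (x - y) x - h (x - y)))) := by
      refine mul_le_mul_of_nonneg_left (h2.trans ?_) (by linarith)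
      exact mul_le_mul_of_nonneg_left (by linarith) (by linarith)
    _ = _ := by ring

theorem norm_planeDeriv_le (hh : IsLineQuasisymmetric M h) {z : ℂ} (hz : 0 < z.im) (v : ℂ) :
    ‖planeDeriv h z v‖ ≤ 4 * ((h (z.re + z.im) - h (z.re - z.im)) / z.im) * ‖v‖ := by
  set x := z.re
  set y := z.im
  set s := (h (x + y) - h (x - y)) / y with hs
  have hc := hh.continuous
  have hm := hh.strictMono
  have m1 := hm (show x < x + y by linarith)
  have m2 := hm (show x - y < x by linarith)
  have m3 := mean_lt hc hm (show x < x + y by linarith)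
  have m4 := lt_mean hc hm (show x < x + y by linarith)
  have m5 := mean_lt hc hm (show x - y < x by linarith)
  have m6 := lt_mean hc hm (show x - y < x by linarith)
  have bd : ∀ t, |t| ≤ h (x + y) - h (x - y) → |t / y| ≤ s := by
    intro t ht
    rw [abs_div, abs_of_pos hz, hs]
    gcongr
  have hs0 : 0 ≤ s := (abs_nonneg _).trans (bd 0 (by rw [abs_zero]; linarith))
  have lin : ∀ p q, |p| ≤ s → |q| ≤ s → |p * v.re + q * v.im| ≤ 2 * s * ‖v‖ := by
    intro p q hp hq
    have e1 : |p * v.re| ≤ s * ‖v‖ := by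
      rw [abs_mul]; exact mul_le_mul hp (Complex.abs_re_le_norm v) (abs_nonneg _) hs0
    have e2 : |q * v.im| ≤ s * ‖v‖ := by
      rw [abs_mul]; exact mul_le_mul hq (Complex.abs_im_le_norm v) (abs_nonneg _) hs0
    have := abs_add_le (p * v.re) (q * v.im)
    linarith
  have a1 := planeDeriv_re_add_im (h := h) z v
  have a2 := planeDeriv_re_sub_im (h := h) z v
  have b1 := lin _ _ (bd (h (x + y) - h x) (by rw [abs_le]; constructor <;> linarith))
    (bd (h (x + y) - mean h x (x + y)) (by rw [abs_le]; constructor <;> linarith))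
  have b2 := lin _ _ (bd (h x - h (x - y)) (by rw [abs_le]; constructor <;> linarith))
    (bd (h (x - y) - mean h (x - y) x) (by rw [abs_le]; constructor <;> linarith))
  rw [← a1] at b1
  rw [← a2] at b2
  have c1 := abs_le.1 b1
  have c2 := abs_le.1 b2
  have d1 : |(planeDeriv h z v).re| ≤ 2 * s * ‖v‖ := by
    rw [abs_le]; constructor <;> linarith [c1.1, c1.2, c2.1, c2.2]
  have d2 : |(planeDeriv h z v).im| ≤ 2 * s * ‖v‖ := by
    rw [abs_le]; constructor <;> linarith [c1.1, c1.2, c2.1, c2.2]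
  have := Complex.norm_le_abs_re_add_abs_im (planeDeriv h z v)
  linarith

/-- The two coordinates `re ± im` of the derivative have the form `P * v.re + Q * v.im` and `P' *
v.re - Q' * v.im` with all four coefficients at least `c > 0`. Whatever the signs of `v.re` and
`v.im`, one of the two forms has no cancellation. -/
theorem le_norm_planeDeriv (hh : IsLineQuasisymmetric M h) {z : ℂ} (hz : 0 < z.im) (v : ℂ) :
    (h (z.re + z.im) - h (z.re - z.im)) / z.im * ‖v‖ ≤ 4 * (1 + M) ^ 2 * ‖planeDeriv h z v‖ := by
  set x := z.re
  set y := z.im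
  set s := (h (x + y) - h (x - y)) / y with hs
  have hM := hh.nonneg
  have hM2 : 0 < 2 * (1 + M) ^ 2 := by positivity
  have hM1 : 1 + M ≤ 2 * (1 + M) ^ 2 := by nlinarith
  set c := s / (2 * (1 + M) ^ 2) with hcdef
  have hS : 0 < h (x + y) - h (x - y) := sub_pos.2 (hh.strictMono (by linarith))
  have hs0 : 0 < s := div_pos hS hz
  have hc0 : 0 < c := div_pos hs0 hM2
  have m1 := hh.strictMono (show x < x + y by linarith)
  have m2 := hh.strictMono (show x - y < x by linarith)
  have bd : ∀ t, h (x + y) - h (x - y) ≤ 2 * (1 + M) ^ 2 * t → c ≤ t / y := by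
    intro t ht
    rw [hcdef, hs, div_div, div_le_div_iff₀ (by positivity) hz]
    nlinarith
  have p1 := bd (h (x + y) - h x) ((hh.left_half_le hz).trans
    (mul_le_mul_of_nonneg_right hM1 (by linarith)))
  have p2 := bd _ (le_sub_mean hh (x := x) hz)
  have q1 := bd (h x - h (x - y)) ((hh.right_half_le hz).trans
    (mul_le_mul_of_nonneg_right hM1 (by linarith)))
  have q2 := bd _ (le_mean_sub hh (x := x) hz)
  have a1 := planeDeriv_re_add_im (h := h) z v
  have a2 := planeDeriv_re_sub_im (h := h) z v
  set P := (h (x + y) - h x) / y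
  set Q := (h (x + y) - mean h x (x + y)) / y
  set P' := (h x - h (x - y)) / y
  have eQ : (h (x - y) - mean h (x - y) x) / y = -((mean h (x - y) x - h (x - y)) / y) := by ring
  rw [show (h (z.re - z.im) - mean h (z.re - z.im) z.re) / z.im =
    -((mean h (x - y) x - h (x - y)) / y) from eQ] at a2
  set Q' := (mean h (x - y) x - h (x - y)) / y
  have n1 := Complex.abs_re_le_norm (planeDeriv h z v)
  have n2 := Complex.abs_im_le_norm (planeDeriv h z v)
  have n3 := abs_le.1 n1
  have n4 := abs_le.1 n2
  have nv := Complex.norm_le_abs_re_add_abs_im v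
  have key : c * (|v.re| + |v.im|) ≤ 2 * ‖planeDeriv h z v‖ := by
    have a1' : (planeDeriv h z v).re + (planeDeriv h z v).im = P * v.re + Q * v.im := a1
    have a2' : (planeDeriv h z v).re - (planeDeriv h z v).im = P' * v.re + -Q' * v.im := a2
    rcases le_total 0 v.re with r | r <;> rcases le_total 0 v.im with i | i <;>
      simp only [abs_of_nonneg, abs_of_nonpos, r, i]
    · have := mul_le_mul_of_nonneg_right p1 r
      have := mul_le_mul_of_nonneg_right p2 i
      linarith [n3.2, n4.2]
    · have := mul_le_mul_of_nonneg_right q1 r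
      have := mul_le_mul_of_nonneg_right q2 (neg_nonneg.2 i)
      linarith [n3.2, n4.1]
    · have := mul_le_mul_of_nonneg_right q1 (neg_nonneg.2 r)
      have := mul_le_mul_of_nonneg_right q2 i
      linarith [n3.1, n4.2]
    · have := mul_le_mul_of_nonneg_right p1 (neg_nonneg.2 r)
      have := mul_le_mul_of_nonneg_right p2 (neg_nonneg.2 i)
      linarith [n3.1, n4.1]
  have hsc : s = 2 * (1 + M) ^ 2 * c := by rw [hcdef]; field_simp
  rw [hsc]
  calc 2 * (1 + M) ^ 2 * c * ‖v‖ ≤ 2 * (1 + M) ^ 2 * (c * (|v.re| + |v.im|)) := by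
        rw [mul_assoc]; gcongr
    _ ≤ 2 * (1 + M) ^ 2 * (2 * ‖planeDeriv h z v‖) := by gcongr
    _ = _ := by ring

/-- The lower bound on the differential makes it invertible, and the inverse function theorem
applies. -/
theorem isOpenMap_extension (hh : IsLineQuasisymmetric M h) :
    IsOpenMap (extension hh.continuous hh.strictMono) := by
  refine IsOpenMap.of_nhds_le fun z => ?_
  have hder := hasStrictFDerivAt_planeMap hh.continuous z.im_pos.ne'
  have hinj : Function.Injective (planeDeriv h (z : ℂ)) := by
    refine (injective_iff_map_eq_zero _).2 fun v hv => ?_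
    have h1 := le_norm_planeDeriv hh z.im_pos v
    rw [hv, norm_zero, mul_zero] at h1
    have h2 : 0 < (h ((z : ℂ).re + (z : ℂ).im) - h ((z : ℂ).re - (z : ℂ).im)) / (z : ℂ).im :=
      div_pos (sub_pos.2 (hh.strictMono (by have := z.im_pos; rw [← coe_im] at this; linarith)))
        z.im_pos
    exact norm_le_zero_iff.1 (nonpos_of_mul_nonpos_right h1 h2)
  have hsurj : (planeDeriv h (z : ℂ)).range = ⊤ :=
    LinearMap.range_eq_top.2 ((LinearMap.injective_iff_surjective
      (f := (planeDeriv h (z : ℂ) : ℂ →ₗ[ℝ] ℂ))).1 hinj)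
  have h1 := hder.map_nhds_eq_of_surj hsurj
  rw [← isOpenEmbedding_coe.map_nhds_eq, Filter.map_map] at h1
  have h2 : map (UpperHalfPlane.coe ∘ extension hh.continuous hh.strictMono) (𝓝 z) =
      map UpperHalfPlane.coe (𝓝 (extension hh.continuous hh.strictMono z)) := by
    rw [isOpenEmbedding_coe.map_nhds_eq]
    exact h1
  rw [← Filter.map_map] at h2
  exact (Filter.map_injective isOpenEmbedding_coe.injective h2).ge

theorem extendsContinuouslyBy_extension (hh : IsLineQuasisymmetric M h) :
    ExtendsContinuouslyBy (extension hh.continuous hh.strictMono) (OnePoint.map h) := by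
  have hc := hh.continuous
  have hm := hh.strictMono
  refine extendsContinuouslyBy_iff.2 fun ξ => ?_
  induction ξ using OnePoint.rec with
  | infty =>
    change Tendsto _ _ (boundaryNhds OnePoint.infty)
    have hid : Tendsto (fun z : UpperHalfPlane => ‖(z : ℂ)‖) (boundaryNhds OnePoint.infty) atTop :=
      tendsto_boundaryNhds_infty_iff.1 tendsto_id
    rw [tendsto_boundaryNhds_infty_iff]
    -- A lower bound for the norm of the image when `z.re ≥ 0`, from the right mean; `top2` serves
    -- `z.re ≤ 0` through the left mean.
    have top1 : Tendsto (fun r : ℝ => (h 0 + h (r / 2)) / 4) atTop atTop :=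
      (tendsto_atTop_add_const_left _ _ ((hm.monotone.tendsto_atTop_atTop fun b =>
        (hh.surjective b).imp fun _ e => e.ge).comp
          (tendsto_id.atTop_div_const two_pos))).atTop_div_const (by norm_num)
    have top2 : Tendsto (fun r : ℝ => (-h 0 + -h (-(r / 2))) / 4) atTop atTop :=
      (tendsto_atTop_add_const_left _ _ (tendsto_neg_atBot_atTop.comp
        ((hm.monotone.tendsto_atBot_atBot fun b => (hh.surjective b).imp fun _ e => e.le).comp
          (tendsto_neg_atTop_atBot.comp (tendsto_id.atTop_div_const two_pos))))).atTop_div_const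
            (by norm_num)
    rw [tendsto_atTop] at top1 top2 ⊢
    intro B
    filter_upwards [hid.eventually (top1 B), hid.eventually (top2 B)] with z h1 h2
    have hz := z.im_pos
    have n1 := Complex.abs_re_le_norm (planeMap h z)
    have n2 := Complex.abs_im_le_norm (planeMap h z)
    have n3 := Complex.norm_le_abs_re_add_abs_im (z : ℂ)
    have e1 := planeMap_re_add_im (h := h) (z : ℂ)
    have e2 := planeMap_re_sub_im (h := h) (z : ℂ)
    rw [coe_extension]
    rw [coe_re, coe_im] at e1 e2 n3
    rw [abs_of_pos hz] at n3
    rcases le_total 0 z.re with hx | hx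
    · rw [abs_of_nonneg hx] at n3
      have f1 := midpoint_le_mean hc hm (show z.re < z.re + z.im by linarith)
      have f2 := hm.monotone hx
      have f3 : h (‖(z : ℂ)‖ / 2) ≤ h ((z.re + (z.re + z.im)) / 2) := hm.monotone (by linarith)
      have n1' := (abs_le.1 n1).2
      have n2' := (abs_le.1 n2).2
      linarith
    · rw [abs_of_nonpos hx] at n3
      have f1 := mean_le_midpoint hc hm (show z.re - z.im < z.re by linarith)
      have f2 := hm.monotone hx
      have f3 : h ((z.re - z.im + z.re) / 2) ≤ h (-(‖(z : ℂ)‖ / 2)) := hm.monotone (by linarith)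
      have n1' := (abs_le.1 n1).1
      have n2' := (abs_le.1 n2).2
      linarith
  | coe x =>
    change Tendsto _ _ (boundaryNhds ((h x : ℝ) : OnePoint ℝ))
    have hid : Tendsto (fun z : UpperHalfPlane => (z : ℂ)) (boundaryNhds (x : OnePoint ℝ))
      (𝓝 (x : ℂ)) := tendsto_boundaryNhds_coe_iff.1 tendsto_id
    have hre : Tendsto (fun z : UpperHalfPlane => z.re) (boundaryNhds (x : OnePoint ℝ)) (𝓝 x) :=
      (Complex.continuous_re.tendsto _).comp hid
    have him : Tendsto (fun z : UpperHalfPlane => z.im) (boundaryNhds (x : OnePoint ℝ)) (𝓝 0) :=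
      (Complex.continuous_im.tendsto _).comp hid
    have hx : Tendsto (fun z : UpperHalfPlane => h z.re) (boundaryNhds (x : OnePoint ℝ))
      (𝓝 (h x)) := (hc.tendsto x).comp hre
    have hp : Tendsto (fun z : UpperHalfPlane => h (z.re + z.im)) (boundaryNhds (x : OnePoint ℝ))
        (𝓝 (h x)) := by
      have := hre.add him
      rw [add_zero] at this
      exact (hc.tendsto x).comp this
    have hn : Tendsto (fun z : UpperHalfPlane => h (z.re - z.im)) (boundaryNhds (x : OnePoint ℝ))
        (𝓝 (h x)) := by
      have := hre.sub him
      rw [sub_zero] at this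
      exact (hc.tendsto x).comp this
    have hα : Tendsto (fun z : UpperHalfPlane => mean h z.re (z.re + z.im))
        (boundaryNhds (x : OnePoint ℝ)) (𝓝 (h x)) :=
      tendsto_of_tendsto_of_tendsto_of_le_of_le hx hp
        (fun z => (lt_mean hc hm (by have := z.im_pos; linarith)).le)
        (fun z => (mean_lt hc hm (by have := z.im_pos; linarith)).le)
    have hβ : Tendsto (fun z : UpperHalfPlane => mean h (z.re - z.im) z.re)
        (boundaryNhds (x : OnePoint ℝ)) (𝓝 (h x)) :=
      tendsto_of_tendsto_of_tendsto_of_le_of_le hn hx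
        (fun z => (lt_mean hc hm (by have := z.im_pos; linarith)).le)
        (fun z => (mean_lt hc hm (by have := z.im_pos; linarith)).le)
    rw [tendsto_boundaryNhds_coe_iff]
    have k1 : Tendsto (fun z : UpperHalfPlane => (planeMap h z).re)
        (boundaryNhds (x : OnePoint ℝ)) (𝓝 (h x)) := by
      have := (hα.add hβ).div_const 2
      rwa [add_self_div_two] at this
    have k2 : Tendsto (fun z : UpperHalfPlane => (planeMap h z).im)
        (boundaryNhds (x : OnePoint ℝ)) (𝓝 0) := by
      have := (hα.sub hβ).div_const 2
      rwa [sub_self, zero_div] at this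
    have k3 := ((Complex.continuous_ofReal.tendsto _).comp k1).add
      (((Complex.continuous_ofReal.tendsto _).comp k2).mul_const Complex.I)
    simp only [Complex.ofReal_zero, zero_mul, add_zero] at k3
    refine k3.congr fun z => ?_
    exact Complex.re_add_im _

end Bounds

end BeurlingAhlfors

/-- A continuous open self-map of `ℍ²` that extends continuously to the boundary is surjective. -/
theorem ExtendsContinuouslyBy.surjective {f : UpperHalfPlane → UpperHalfPlane}
    {b : BoundaryH2 → BoundaryH2} (hf : ExtendsContinuouslyBy f b) (hc : Continuous f)
    (ho : IsOpenMap f) : Function.Surjective f := by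
  rw [← Set.range_eq_univ]
  refine IsClopen.eq_univ ⟨isClosed_of_closure_subset fun w hw => ?_, ho.isOpen_range⟩
    (range_nonempty f)
  have hne : (comap f (𝓝 w)).NeBot := by
    rw [mem_closure_iff_nhdsWithin_neBot] at hw
    rw [comap_neBot_iff]
    intro t ht
    obtain ⟨y, ⟨z, rfl⟩, hy⟩ := (mem_closure_iff_nhds.1 (mem_closure_iff_nhdsWithin_neBot.2 hw) t ht
      ).imp fun y hy => (⟨hy.2, hy.1⟩ : y ∈ range f ∧ y ∈ t)
    exact ⟨z, hy⟩
  set u := Ultrafilter.of (comap f (𝓝 w)) with hu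
  have hfu : Tendsto f u (𝓝 w) := tendsto_comap.mono_left (Ultrafilter.of_le _)
  -- If the preimages leave all balls, the boundary extension makes their images do so too, against
  -- convergence to `w`. Otherwise they accumulate at a preimage of `w`.
  by_cases hd : Tendsto (fun z : UpperHalfPlane => dist z I) u atTop
  · obtain ⟨ξ, hξ⟩ := exists_tendsto_boundaryNhds (p := id) u hd
    have h1 := tendsto_dist_atTop_of_boundaryNhds ((hf.tendsto ξ).comp hξ)
    have h2 : Tendsto (fun z => dist (f z) I) u (𝓝 (dist w I)) := hfu.dist tendsto_const_nhds
    exact (not_tendsto_nhds_of_tendsto_atTop h1 _ h2).elim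
  · rw [tendsto_atTop] at hd
    push Not at hd
    obtain ⟨R, hR⟩ := hd
    have hball : Metric.closedBall I R ∈ (u : Filter UpperHalfPlane) := by
      filter_upwards [hR] with z hz
      exact hz.le
    obtain ⟨z, -, hz⟩ := (isCompact_closedBall I R).ultrafilter_le_nhds u
      (le_principal_iff.2 hball)
    exact ⟨z, tendsto_nhds_unique ((hc.tendsto z).mono_left hz) hfu⟩

/-- A homeomorphism that is bilipschitz at small scales around each point, with constants of
bounded ratio, is quasiconformal. -/
theorem isQuasiconformal_of_local_bounds {X : Type*} [MetricSpace X] {H : ℝ} {f : X ≃ₜ X}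
    (hf : ∀ x, ∃ ρ > 0, ∃ a b : ℝ, 0 < a ∧ a ≤ b ∧ b ≤ H * a ∧ ∀ w, dist x w < ρ →
      a * dist x w ≤ dist (f x) (f w) ∧ dist (f x) (f w) ≤ b * dist x w) :
    IsQuasiconformal H f := by
  intro x H' hH'
  obtain ⟨ρ, hρ, a, b, ha, hab, hbH, hloc⟩ := hf x
  -- The dilatation involves all `z` with `r ≤ dist x z`, including distant ones. Continuity of the
  -- inverse keeps their images at distance at least `c`, which exceeds `b * r` for small `r`.
  obtain ⟨c, hc, hcρ⟩ := Metric.continuousAt_iff.1 (f.symm.continuous.continuousAt (x := f x)) ρ hρ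
  have hb : 0 < b := ha.trans_le hab
  have hH1 : 1 ≤ H := by
    by_contra hcon
    push Not at hcon
    nlinarith
  filter_upwards [Ioo_mem_nhdsGT (show (0 : ℝ) < min ρ (c / b) from lt_min hρ (div_pos hc hb))]
    with r hr y z hy hz
  have hrρ : r < ρ := hr.2.trans_le (min_le_left _ _)
  have hrc : b * r < c := by
    have := hr.2.trans_le (min_le_right ρ (c / b))
    rwa [lt_div_iff₀ hb, mul_comm] at this
  have h1 := (hloc y (hy.trans_lt hrρ)).2
  have h2 : dist (f x) (f y) ≤ b * r := h1.trans (by gcongr)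
  have h0 : 0 ≤ dist (f x) (f z) := dist_nonneg
  have h3 : b * r ≤ H * dist (f x) (f z) := by
    rcases lt_or_ge (dist x z) ρ with hzρ | hzρ
    · have h4 := (hloc z hzρ).1
      have h5 : a * r ≤ a * dist x z := by gcongr
      have hr0 := hr.1.le
      calc b * r ≤ H * a * r := by gcongr
        _ = H * (a * r) := by ring
        _ ≤ H * dist (f x) (f z) := by gcongr; linarith
    · have h4 : c ≤ dist (f x) (f z) := by
        by_contra hcon
        push Not at hcon
        have h5 := hcρ (x := f z) (by rwa [dist_comm])
        rw [f.symm_apply_apply, f.symm_apply_apply, dist_comm] at h5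
        linarith
      nlinarith
  refine h2.trans (h3.trans ?_)
  gcongr

namespace UpperHalfPlane

theorem dist_coe_le_two_mul {w z : UpperHalfPlane} (h : dist w z ≤ 1 / 2) :
    dist (w : ℂ) z ≤ 2 * z.im * dist w z := by
  have h0 : 0 ≤ dist w z := dist_nonneg
  have h1 := dist_coe_le w z
  have h2 := Real.abs_exp_sub_one_le (x := dist w z) (by rw [abs_of_nonneg h0]; linarith)
  rw [abs_of_nonneg h0] at h2
  have h3 := (le_abs_self _).trans h2
  have := mul_le_mul_of_nonneg_left h3 z.im_pos.le
  linarith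

theorem half_mul_dist_le {w z : UpperHalfPlane} (h : dist w z ≤ 1 / 2) :
    z.im * dist w z / 2 ≤ dist (w : ℂ) z := by
  have h0 : 0 ≤ dist w z := dist_nonneg
  have h1 := le_dist_coe w z
  have h2 := Real.abs_exp_sub_one_sub_id_le (x := -dist w z)
    (by rw [abs_neg, abs_of_nonneg h0]; linarith)
  have h3 := (le_abs_self _).trans h2
  have h4 : dist w z / 2 ≤ 1 - Real.exp (-dist w z) := by nlinarith
  have := mul_le_mul_of_nonneg_left h4 z.im_pos.le
  linarith

/-- A homeomorphism of `ℍ²` whose differentials have bounded distortion is quasiconformal. -/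
theorem isQuasiconformal_of_hasFDerivAt {H : ℝ} {f : UpperHalfPlane ≃ₜ UpperHalfPlane} {F : ℂ → ℂ}
    (hF : ∀ z : UpperHalfPlane, (f z : ℂ) = F z)
    (hd : ∀ z : UpperHalfPlane, ∃ (A : ℂ →L[ℝ] ℂ) (m N : ℝ), HasFDerivAt F A z ∧ 0 < m ∧ m ≤ N ∧
      N ≤ H * m ∧ ∀ v, m * ‖v‖ ≤ ‖A v‖ ∧ ‖A v‖ ≤ N * ‖v‖) :
    IsQuasiconformal (64 * H) f := by
  refine isQuasiconformal_of_local_bounds fun z => ?_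
  obtain ⟨A, m, N, hA, hm, hmN, hNH, hv⟩ := hd z
  have hN : 0 < N := hm.trans_le hmN
  have e1 : ∀ᶠ w : UpperHalfPlane in 𝓝 z,
      ‖F w - F z - A ((w : ℂ) - z)‖ ≤ m / 2 * ‖(w : ℂ) - z‖ :=
    isOpenEmbedding_coe.continuous.continuousAt.eventually
      (hA.isLittleO.def (by positivity : 0 < m / 2))
  have e2 : ∀ᶠ w : UpperHalfPlane in 𝓝 z, dist (f w) (f z) < 1 / 2 :=
    f.continuous.continuousAt.eventually (Metric.ball_mem_nhds _ (by norm_num))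
  have e3 : ∀ᶠ w : UpperHalfPlane in 𝓝 z, dist w z < 1 / 2 :=
    Metric.ball_mem_nhds _ (by norm_num)
  obtain ⟨ρ, hρ, hball⟩ := Metric.eventually_nhds_iff.1 (e1.and (e2.and e3))
  set y := z.im with hy
  set Y := (f z).im with hY
  have hy0 : 0 < y := z.im_pos
  have hY0 : 0 < Y := (f z).im_pos
  -- Each `8` is three factors `2`: the error of the linear approximation, and the comparison of
  -- hyperbolic with Euclidean distance at `z` and at `f z`.
  refine ⟨ρ, hρ, m * y / (8 * Y), 8 * N * y / Y, by positivity, ?_, ?_, fun w hw => ?_⟩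
  · rw [div_le_div_iff₀ (by positivity) hY0]
    have h1 : m * (y * Y) ≤ N * (y * Y) := by gcongr
    have h2 : 0 < N * (y * Y) := by positivity
    linarith
  · calc 8 * N * y / Y ≤ 8 * (H * m) * y / Y := by gcongr
      _ = 64 * H * (m * y / (8 * Y)) := by field_simp; ring
  · obtain ⟨k1, k2, k3⟩ := hball (by rwa [dist_comm] : dist w z < ρ)
    have g1 := half_mul_dist_le k3.le
    have g2 := dist_coe_le_two_mul k3.le
    have g3 := half_mul_dist_le k2.le
    have g4 := dist_coe_le_two_mul k2.le
    rw [dist_comm z w, dist_comm (f z) (f w)]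
    rw [Complex.dist_eq] at g1 g2 g3 g4
    rw [hF, hF] at g3 g4
    obtain ⟨v1, v2⟩ := hv ((w : ℂ) - z)
    have t1 := norm_sub_norm_le (A ((w : ℂ) - z)) (-(F w - F z - A ((w : ℂ) - z)))
    have t2 := norm_add_le (A ((w : ℂ) - z)) (F w - F z - A ((w : ℂ) - z))
    rw [norm_neg, sub_neg_eq_add, add_sub_cancel] at t1
    rw [add_sub_cancel] at t2
    have n0 : 0 ≤ ‖(w : ℂ) - z‖ := norm_nonneg _
    have u1 : m / 2 * ‖(w : ℂ) - z‖ ≤ ‖F w - F z‖ := by linarith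
    have u2 : ‖F w - F z‖ ≤ 2 * N * ‖(w : ℂ) - z‖ := by nlinarith
    constructor
    · rw [div_mul_eq_mul_div, div_le_iff₀ (by positivity)]
      have : m / 2 * (y * dist w z / 2) ≤ m / 2 * ‖(w : ℂ) - z‖ := by gcongr
      linarith
    · rw [div_mul_eq_mul_div, le_div_iff₀ hY0]
      have : 2 * N * ‖(w : ℂ) - z‖ ≤ 2 * N * (2 * y * dist w z) := by gcongr
      linarith

end UpperHalfPlane

/-- The Beurling–Ahlfors theorem: quasisymmetric homeomorphisms of the line extend to
quasiconformal homeomorphisms of `ℍ²`. -/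
theorem IsLineQuasisymmetric.exists_isQuasiconformal {M : ℝ} {h : ℝ → ℝ}
    (hh : IsLineQuasisymmetric M h) :
    ∃ f : UpperHalfPlane ≃ₜ UpperHalfPlane, IsQuasiconformal (64 * (16 * (1 + M) ^ 2)) f ∧
      ExtendsContinuouslyBy f (OnePoint.map h) := by
  have hext := BeurlingAhlfors.extendsContinuouslyBy_extension hh
  have hcont := BeurlingAhlfors.continuous_extension hh.continuous hh.strictMono
  have hopen := BeurlingAhlfors.isOpenMap_extension hh
  set f := (Equiv.ofBijective (BeurlingAhlfors.extension hh.continuous hh.strictMono)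
    ⟨BeurlingAhlfors.extension_injective _ _,
      hext.surjective hcont hopen⟩).toHomeomorphOfContinuousOpen hcont hopen with hf
  have hM := hh.nonneg
  refine ⟨f, isQuasiconformal_of_hasFDerivAt (F := BeurlingAhlfors.planeMap h) (fun z => rfl)
    fun z => ?_, hext⟩
  set s := (h ((z : ℂ).re + (z : ℂ).im) - h ((z : ℂ).re - (z : ℂ).im)) / (z : ℂ).im with hs
  have hz : 0 < (z : ℂ).im := z.im_pos
  have hs0 : 0 < s := div_pos (sub_pos.2 (hh.strictMono (by linarith))) hz
  refine ⟨BeurlingAhlfors.planeDeriv h z, s / (4 * (1 + M) ^ 2), 4 * s,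
    (BeurlingAhlfors.hasStrictFDerivAt_planeMap hh.continuous hz.ne').hasFDerivAt,
    by positivity, ?_, ?_, fun v => ⟨?_, BeurlingAhlfors.norm_planeDeriv_le hh hz v⟩⟩
  · rw [div_le_iff₀ (by positivity)]
    nlinarith [mul_nonneg hs0.le hM, mul_nonneg hs0.le (sq_nonneg M)]
  · field_simp
    norm_num
  · rw [div_mul_eq_mul_div, div_le_iff₀ (by positivity), mul_comm ‖_‖]
    exact BeurlingAhlfors.le_norm_planeDeriv hh hz v

/-! ### Quasisymmetry of the boundary values -/

namespace UpperHalfPlane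

/-- Since `‖a - conj b‖` is `2 * cosh (dist a b / 2)` times the roots of the heights, the factors
that degenerate at the boundary cancel, and the inequality survives the passage to real `p` and
`p'`. -/
theorem exp_neg_mul_norm_le {q p p' : UpperHalfPlane} {D : ℝ} (h : gromovProd q p p' ≤ D) :
    Real.exp (-D) * (‖(p : ℂ) - starRingEnd ℂ q‖ * ‖(p' : ℂ) - starRingEnd ℂ q‖) ≤
      4 * q.im * ‖(p : ℂ) - starRingEnd ℂ p'‖ := by
  have key : ∀ a b : UpperHalfPlane, ‖(a : ℂ) - starRingEnd ℂ b‖ =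
      Real.cosh (dist a b / 2) * (2 * (√a.im * √b.im)) := fun a b => by
    have h1 : 0 < √a.im := Real.sqrt_pos.2 a.im_pos
    have h2 : 0 < √b.im := Real.sqrt_pos.2 b.im_pos
    rw [cosh_half_dist, Real.sqrt_mul a.im_pos.le, Complex.dist_eq]
    field_simp
  have h1 : Real.exp (-D) ≤ Real.exp (-gromovProd q p p') := Real.exp_le_exp.2 (by linarith)
  have h2 := exp_neg_gromovProd q p p'
  have h3 := exp_div_two_le_cosh (dist p p' / 2)
  have h4 := cosh_le_exp (x := dist p q / 2) (by positivity)
  have h5 := cosh_le_exp (x := dist p' q / 2) (by positivity)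
  have h6 : Real.exp (-D) * (Real.cosh (dist p q / 2) * Real.cosh (dist p' q / 2)) ≤
      2 * Real.cosh (dist p p' / 2) := by
    calc _ ≤ Real.exp (-gromovProd q p p') *
          (Real.exp (dist p q / 2) * Real.exp (dist p' q / 2)) := by
          have := Real.cosh_pos (dist p' q / 2)
          gcongr
      _ ≤ _ := by linarith
  have hq : √q.im * √q.im = q.im := Real.mul_self_sqrt q.im_pos.le
  rw [key, key, key]
  have h7 : 0 ≤ 4 * q.im * (√p.im * √p'.im) := by
    have := q.im_pos
    positivity
  have h8 := mul_le_mul_of_nonneg_right h6 h7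
  linear_combination h8 + 4 * Real.exp (-D) * Real.cosh (dist p q / 2) *
    Real.cosh (dist p' q / 2) * √p.im * √p'.im * hq

section Limits

variable {α : Type*} {l : Filter α} [l.NeBot] {p p' : α → UpperHalfPlane} {q : UpperHalfPlane}
  {D ξ ξ' : ℝ}

theorem exp_neg_mul_norm_le_of_tendsto (hp : Tendsto p l (boundaryNhds (ξ : OnePoint ℝ)))
    (hp' : Tendsto p' l (boundaryNhds (ξ' : OnePoint ℝ)))
    (h : ∀ᶠ a in l, gromovProd q (p a) (p' a) ≤ D) :
    Real.exp (-D) * (‖(ξ : ℂ) - starRingEnd ℂ q‖ * ‖(ξ' : ℂ) - starRingEnd ℂ q‖) ≤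
      4 * q.im * |ξ - ξ'| := by
  rw [tendsto_boundaryNhds_coe_iff] at hp hp'
  have h1 : Tendsto (fun a => starRingEnd ℂ (p' a : ℂ)) l (𝓝 (ξ' : ℂ)) := by
    have := (Complex.continuous_conj.tendsto _).comp hp'
    rwa [Complex.conj_ofReal] at this
  have h2 := ((hp.sub h1).norm).const_mul (4 * q.im)
  rw [← Complex.ofReal_sub, Complex.norm_real, Real.norm_eq_abs] at h2
  exact le_of_tendsto_of_tendsto
    ((((hp.sub_const (starRingEnd ℂ q)).norm).mul
      ((hp'.sub_const (starRingEnd ℂ q)).norm)).const_mul (Real.exp (-D))) h2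
    (h.mono fun a ha => exp_neg_mul_norm_le ha)

theorem exp_neg_mul_norm_le_of_tendsto_infty
    (hp : Tendsto p l (boundaryNhds (ξ : OnePoint ℝ)))
    (hp' : Tendsto p' l (boundaryNhds OnePoint.infty))
    (h : ∀ᶠ a in l, gromovProd q (p a) (p' a) ≤ D) :
    Real.exp (-D) * ‖(ξ : ℂ) - starRingEnd ℂ q‖ ≤ 4 * q.im := by
  rw [tendsto_boundaryNhds_coe_iff] at hp
  rw [tendsto_boundaryNhds_infty_iff] at hp'
  have h1 : Tendsto (fun a => ‖(p' a : ℂ) - starRingEnd ℂ q‖) l atTop :=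
    tendsto_atTop_mono (fun a => by
      have := norm_sub_norm_le (p' a : ℂ) (starRingEnd ℂ q)
      linarith) (tendsto_atTop_add_const_right _ (-‖starRingEnd ℂ (q : ℂ)‖) hp')
  have h2 : Tendsto (fun a => 4 * q.im * (‖(p a : ℂ) - q‖ / ‖(p' a : ℂ) - starRingEnd ℂ q‖ + 1)) l
      (𝓝 (4 * q.im * (0 + 1))) :=
    (((hp.sub_const (q : ℂ)).norm.div_atTop h1).add_const 1).const_mul _
  rw [zero_add, mul_one] at h2
  refine le_of_tendsto_of_tendsto
    (((hp.sub_const (starRingEnd ℂ q)).norm).const_mul (Real.exp (-D))) h2 ?_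
  filter_upwards [h, h1.eventually_gt_atTop 0] with a ha ha'
  have h3 := exp_neg_mul_norm_le ha
  have h4 : ‖(p a : ℂ) - starRingEnd ℂ (p' a)‖ ≤
      ‖(p a : ℂ) - q‖ + ‖(p' a : ℂ) - starRingEnd ℂ q‖ := by
    have h5 : ‖(p' a : ℂ) - starRingEnd ℂ q‖ = ‖(q : ℂ) - starRingEnd ℂ (p' a)‖ := by
      rw [← Complex.norm_conj, map_sub, Complex.conj_conj, norm_sub_rev]
    rw [h5]
    exact norm_sub_le_norm_sub_add_norm_sub _ _ _
  have hq := q.im_pos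
  rw [div_add_one ha'.ne', mul_div_assoc', le_div_iff₀ ha']
  nlinarith [mul_le_mul_of_nonneg_left h4 (by positivity : 0 ≤ 4 * q.im)]

end Limits

theorem im_le_norm_sub_conj (ξ : ℝ) (q : UpperHalfPlane) :
    q.im ≤ ‖(ξ : ℂ) - starRingEnd ℂ q‖ := by
  have := Complex.abs_im_le_norm ((ξ : ℂ) - starRingEnd ℂ q)
  simp at this
  exact (le_abs_self _).trans this

/-- A map of `ℍ²` that distorts small Gromov products boundedly is quasisymmetric on the
boundary line. -/
theorem isLineQuasisymmetric_of_gromovProd {G : UpperHalfPlane → UpperHalfPlane} {D : ℝ}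
    (hG : ∀ m a b, gromovProd m a b ≤ 1 → gromovProd (G m) (G a) (G b) ≤ D) {k : ℝ → ℝ}
    (hk : ExtendsContinuouslyBy G (OnePoint.map k)) (hm : StrictMono k)
    (hs : Function.Surjective k) : IsLineQuasisymmetric (32 * (Real.exp D * Real.exp D)) k := by
  -- `Y` is the height of the image `q` of the point over `x` at height `t`. As a coarse centre of
  -- `k x`, `k y` and infinity, `q` has height comparable to `|k x - k y|`. It does not depend on
  -- `y`, so it compares the two sides of `x`; the constant is `32 = 4 * 8`.
  have key : ∀ x t, 0 < t → ∃ Y, ∀ y, |x - y| = t → Y ≤ 4 * Real.exp D * |k x - k y| ∧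
      |k x - k y| ≤ 8 * Real.exp D * Y := by
    intro x t ht
    set u := Real.log t
    have hu : Real.exp u = t := Real.exp_log ht
    have hu' : Tendsto (fun n : ℝ => u - n) atTop atBot :=
      tendsto_atBot_add_const_left _ u tendsto_neg_atTop_atBot
    set q := G (vert x u)
    refine ⟨q.im, fun y hxy => ?_⟩
    rw [← hu] at hxy
    have hx : Tendsto (fun n : ℝ => G (vert x (u - n))) atTop (boundaryNhds (k x : OnePoint ℝ)) :=
      (hk.tendsto x).comp ((tendsto_vert_atBot x).comp hu')
    have hy : Tendsto (fun n : ℝ => G (vert y (u - n))) atTop (boundaryNhds (k y : OnePoint ℝ)) :=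
      (hk.tendsto y).comp ((tendsto_vert_atBot y).comp hu')
    have hz : Tendsto (fun n : ℝ => G (vert x (u + n))) atTop (boundaryNhds OnePoint.infty) :=
      (hk.tendsto OnePoint.infty).comp
        ((tendsto_vert_atTop x).comp (tendsto_atTop_add_const_left _ u tendsto_id))
    have h1 := exp_neg_mul_norm_le_of_tendsto (q := q) (D := D) hx hy (by
      filter_upwards [eventually_ge_atTop 0] with n hn
      exact hG _ _ _ (gromovProd_vert_down_down hn hxy))
    have h2 := exp_neg_mul_norm_le_of_tendsto_infty (q := q) (D := D) hx hz (by
      filter_upwards [eventually_ge_atTop 0] with n hn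
      rw [gromovProd_comm]
      exact hG _ _ _ (gromovProd_vert_up_down hn (by simp [Real.exp_nonneg])))
    have h3 := exp_neg_mul_norm_le_of_tendsto_infty (q := q) (D := D) hy hz (by
      filter_upwards [eventually_ge_atTop 0] with n hn
      rw [gromovProd_comm]
      exact hG _ _ _ (gromovProd_vert_up_down hn (by rw [abs_sub_comm]; exact hxy.le)))
    have h4 := im_le_norm_sub_conj (k x) q
    have h5 := im_le_norm_sub_conj (k y) q
    have hq := q.im_pos
    have hD := Real.exp_pos D
    rw [Real.exp_neg, inv_mul_le_iff₀ hD] at h1 h2 h3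
    refine ⟨?_, ?_⟩
    · have h6 := mul_le_mul h4 h5 hq.le (norm_nonneg _)
      have h7 := h6.trans h1
      rw [show Real.exp D * (4 * q.im * |k x - k y|) =
        q.im * (4 * Real.exp D * |k x - k y|) by ring] at h7
      exact le_of_mul_le_mul_left h7 hq
    · have h6 : |k x - k y| ≤ ‖(k x : ℂ) - starRingEnd ℂ q‖ + ‖(k y : ℂ) - starRingEnd ℂ q‖ := by
        rw [← Real.norm_eq_abs, ← Complex.norm_real, Complex.ofReal_sub,
          norm_sub_rev (k y : ℂ)]
        exact norm_sub_le_norm_sub_add_norm_sub _ _ _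
      linarith
  have hD := Real.exp_pos D
  have ratio : ∀ x t, 0 < t → ∀ y z, |x - y| = t → |x - z| = t →
      |k x - k y| ≤ 32 * (Real.exp D * Real.exp D) * |k x - k z| := by
    intro x t ht y z hy hz
    obtain ⟨Y, hY⟩ := key x t ht
    have h1 := mul_le_mul_of_nonneg_left (hY z hz).1 (by positivity : 0 ≤ 8 * Real.exp D)
    linarith [(hY y hy).2]
  refine ⟨by positivity, hm.monotone.continuous_of_surjective hs, hm, hs, fun x t ht => ?_,
    fun x t ht => ?_⟩
  all_goals
    have h1 : k (x - t) < k x := hm (by linarith)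
    have h2 : k x < k (x + t) := hm (by linarith)
  · have h3 := ratio x t ht (x + t) (x - t) (by simp [abs_of_pos ht]) (by simp [abs_of_pos ht])
    rwa [abs_sub_comm, abs_of_pos (sub_pos.2 h2), abs_of_pos (sub_pos.2 h1)] at h3
  · have h3 := ratio x t ht (x - t) (x + t) (by simp [abs_of_pos ht]) (by simp [abs_of_pos ht])
    rwa [abs_of_pos (sub_pos.2 h1), abs_sub_comm, abs_of_pos (sub_pos.2 h2)] at h3

/-! ### Normalisation by isometries -/

/-- The reflection of `ℍ²` in the imaginary axis. -/
noncomputable def reflection : UpperHalfPlane ≃ᵢ UpperHalfPlane :=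
  IsometryEquiv.mk' (fun z => ⟨-starRingEnd ℂ z, by simpa using z.im_pos⟩)
    (fun z => ⟨-starRingEnd ℂ z, by simpa using z.im_pos⟩)
    (fun z => UpperHalfPlane.ext (by simp))
    (Isometry.of_dist_eq fun z w => by
      have h1 : dist (-starRingEnd ℂ (z : ℂ)) (-starRingEnd ℂ w) = dist (z : ℂ) w := by
        rw [dist_neg_neg, Complex.dist_conj_conj]
      have h2 : ∀ (a : UpperHalfPlane) h,
          (⟨-starRingEnd ℂ (a : ℂ), h⟩ : UpperHalfPlane).im = a.im :=
        fun a h => (neg_neg _)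
      rw [dist_eq, dist_eq, h2, h2, ← h1])

theorem reflection_vert (x t : ℝ) : reflection (vert x t) = vert (-x) t := by
  apply UpperHalfPlane.ext
  apply Complex.ext <;> simp [reflection, IsometryEquiv.mk', vert]

/-- The matrix of an isometry that sends the boundary point `x` to infinity. -/
def inversionMatrix (x : ℝ) : Matrix.SpecialLinearGroup (Fin 2) ℝ :=
  ⟨!![0, -1; 1, -x], by simp [Matrix.det_fin_two]⟩

/-- The isometry `z ↦ -1 / (z - x)`. -/
noncomputable def inversion (x : ℝ) : UpperHalfPlane ≃ᵢ UpperHalfPlane :=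
  IsometryEquiv.constSMul (inversionMatrix x)

theorem inversion_vert (x t : ℝ) : inversion x (vert x t) = vert 0 (-t) := by
  apply UpperHalfPlane.ext
  have h1 : (vert x t : ℂ) = x + Real.exp t * Complex.I := by
    apply Complex.ext <;> simp [vert, -Complex.ofReal_exp]
  have h2 : (vert 0 (-t) : ℂ) = Real.exp (-t) * Complex.I := by
    apply Complex.ext <;> simp [vert, -Complex.ofReal_exp]
  have h3 : (Real.exp t : ℂ) ≠ 0 := by exact_mod_cast (Real.exp_pos t).ne'
  rw [inversion, IsometryEquiv.constSMul_apply, coe_specialLinearGroup_apply, h1, h2, Real.exp_neg]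
  simp [inversionMatrix, -Complex.ofReal_exp]
  field_simp
  simp

end UpperHalfPlane

open UpperHalfPlane

theorem isMorseMap_of_isometry {f : UpperHalfPlane → UpperHalfPlane} (hf : Isometry f) :
    IsMorseMap 1 0 id f where
  pos := one_pos
  upper a b := by simp [hf.dist_eq]
  lower a b := by simp [hf.dist_eq]
  morse C m a b h := by simpa [gromovProd, hf.dist_eq] using h

theorem exists_isometry_map_eq_infty (ξ : BoundaryH2) :
    ∃ (A : UpperHalfPlane ≃ᵢ UpperHalfPlane) (c : BoundaryH2 → BoundaryH2),
      ExtendsContinuouslyBy A c ∧ c ξ = OnePoint.infty := by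
  induction ξ using OnePoint.rec with
  | infty => exact ⟨IsometryEquiv.refl _, id, ExtendsContinuouslyBy.id, rfl⟩
  | coe x =>
    obtain ⟨c, hc⟩ := (isMorseMap_of_isometry (inversion x).isometry).exists_extendsContinuouslyBy
    refine ⟨inversion x, c, hc, ?_⟩
    have h1 : Tendsto (fun t => inversion x (vert x t)) atBot (boundaryNhds (c x)) :=
      (hc.tendsto x).comp (tendsto_vert_atBot x)
    simp only [inversion_vert] at h1
    exact eq_of_tendsto_boundaryNhds h1 ((tendsto_vert_atTop 0).comp tendsto_neg_atBot_atTop)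

theorem extendsContinuouslyBy_reflection :
    ExtendsContinuouslyBy reflection (OnePoint.map fun x => -x) := by
  obtain ⟨c, hc⟩ := (isMorseMap_of_isometry reflection.isometry).exists_extendsContinuouslyBy
  convert hc
  funext ξ
  induction ξ using OnePoint.rec with
  | infty =>
    have h1 : Tendsto (fun t => reflection (vert 0 t)) atTop (boundaryNhds (c OnePoint.infty)) :=
      (hc.tendsto _).comp (tendsto_vert_atTop 0)
    simp only [reflection_vert] at h1
    exact eq_of_tendsto_boundaryNhds (tendsto_vert_atTop _) h1
  | coe x =>
    have h1 : Tendsto (fun t => reflection (vert x t)) atBot (boundaryNhds (c x)) :=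
      (hc.tendsto _).comp (tendsto_vert_atBot x)
    simp only [reflection_vert] at h1
    exact eq_of_tendsto_boundaryNhds (tendsto_vert_atBot _) h1

/-- A homeomorphism of the circle that fixes infinity is given by a homeomorphism of the line. -/
theorem OnePoint.exists_eq_map {g : BoundaryH2 → BoundaryH2} (hc : Continuous g)
    (hb : Function.Bijective g) (hg : g OnePoint.infty = OnePoint.infty) :
    ∃ k : ℝ → ℝ, g = OnePoint.map k ∧ Continuous k ∧ Function.Bijective k := by
  have h1 : ∀ x : ℝ, ∃ y : ℝ, (y : OnePoint ℝ) = g x := fun x =>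
    OnePoint.ne_infty_iff_exists.1 fun h => OnePoint.coe_ne_infty x (hb.1 (h.trans hg.symm))
  choose k hk using h1
  refine ⟨k, funext fun ξ => ?_, ?_, fun x y hxy => ?_, fun y => ?_⟩
  · induction ξ using OnePoint.rec with
    | infty => exact hg
    | coe x => exact (hk x).symm
  · rw [OnePoint.isOpenEmbedding_coe.isEmbedding.continuous_iff]
    exact (hc.comp OnePoint.continuous_coe).congr fun x => (hk x).symm
  · exact OnePoint.coe_injective (hb.1 ((hk x).symm.trans ((congrArg _ hxy).trans (hk y))))
  · obtain ⟨ξ, hξ⟩ := hb.2 (y : OnePoint ℝ)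
    obtain ⟨x, rfl⟩ : ∃ x : ℝ, (x : OnePoint ℝ) = ξ := OnePoint.ne_infty_iff_exists.1 fun h => by
      rw [h, hg] at hξ
      exact OnePoint.coe_ne_infty y hξ.symm
    exact ⟨x, OnePoint.coe_injective ((hk x).trans hξ)⟩

/-- Every homeomorphism of the circle becomes an increasing homeomorphism of the line after
composition with an isometry of `ℍ²`. -/
theorem exists_isometry_comp_eq_map (g : BoundaryH2 ≃ₜ BoundaryH2) :
    ∃ (A : UpperHalfPlane ≃ᵢ UpperHalfPlane) (c : BoundaryH2 → BoundaryH2) (k : ℝ → ℝ),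
      ExtendsContinuouslyBy A c ∧ c ∘ g = OnePoint.map k ∧ StrictMono k ∧
        Function.Surjective k := by
  obtain ⟨A, c, hA, hc⟩ := exists_isometry_map_eq_infty (g OnePoint.infty)
  obtain ⟨c', hA'⟩ := (isMorseMap_of_isometry A.symm.isometry).exists_extendsContinuouslyBy
  have e1 : c ∘ c' = id := (hA.comp hA').unique (by
    rw [A.self_comp_symm]; exact ExtendsContinuouslyBy.id)
  have e2 : c' ∘ c = id := (hA'.comp hA).unique (by
    rw [A.symm_comp_self]; exact ExtendsContinuouslyBy.id)
  have hcb : Function.Bijective c :=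
    Function.bijective_iff_has_inverse.2 ⟨c', congrFun e2, congrFun e1⟩
  obtain ⟨k, hk, hkc, hkb⟩ := OnePoint.exists_eq_map (hA.continuous.comp g.continuous)
    (hcb.comp g.bijective) hc
  -- An orientation-reversing map becomes increasing after composition with the reflection.
  rcases hkc.strictMono_of_inj hkb.1 with hm | hm
  · exact ⟨A, c, k, hA, hk, hm, hkb.2⟩
  · refine ⟨A.trans reflection, _, fun x => -k x, extendsContinuouslyBy_reflection.comp hA, ?_,
      fun x y hxy => neg_lt_neg (hm hxy), neg_surjective.comp hkb.2⟩
    rw [Function.comp_assoc, hk]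
    funext ξ
    induction ξ using OnePoint.rec with
    | infty => rfl
    | coe x => rfl

theorem IsQuasiconformal.trans_isometry {X : Type*} [MetricSpace X] {H : ℝ} {f : X ≃ₜ X}
    (hf : IsQuasiconformal H f) (A : X ≃ᵢ X) : IsQuasiconformal H (f.trans A.toHomeomorph) := by
  intro x H' hH'
  filter_upwards [hf x H' hH'] with r hr y z hy hz
  have := hr y z hy hz
  simpa [A.dist_eq] using this

/-- The boundary values of a Morse map are quasisymmetric, with a constant that depends only on
the constants of the map. -/
theorem IsMorseMap.isQuasisymmetric {L K : ℝ} {M : ℝ → ℝ} {f : UpperHalfPlane → UpperHalfPlane}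
    (hf : IsMorseMap L K M f) {g : BoundaryH2 ≃ₜ BoundaryH2} (hg : ExtendsContinuouslyBy f g) :
    IsQuasisymmetric (64 * (16 * (1 + 32 * (Real.exp (M 1) * Real.exp (M 1))) ^ 2)) g := by
  obtain ⟨A, c, k, hA, hk, hm, hs⟩ := exists_isometry_comp_eq_map g
  have h1 : IsLineQuasisymmetric _ k := isLineQuasisymmetric_of_gromovProd (G := A ∘ f) (D := M 1)
    (fun m a b h => by simpa [gromovProd, A.dist_eq] using hf.morse 1 m a b h)
    (hk ▸ hA.comp hg) hm hs
  obtain ⟨E, hE, hEk⟩ := h1.exists_isQuasiconformal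
  refine ⟨E.trans A.symm.toHomeomorph, hE.trans_isometry A.symm, ?_⟩
  obtain ⟨c', hA'⟩ := (isMorseMap_of_isometry A.symm.isometry).exists_extendsContinuouslyBy
  have e2 : c' ∘ c = id := (hA'.comp hA).unique (by
    rw [A.symm_comp_self]; exact ExtendsContinuouslyBy.id)
  have h2 := hA'.comp hEk
  rw [← hk, ← Function.comp_assoc, e2, Function.id_comp] at h2
  exact h2

/-! ### The boundary action of a group quasi-isometric to `ℍ² × ℝ` -/

theorem wordDist_mul_left {Γ : Type*} [Group Γ] (S : Set Γ) (u g h : Γ) :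
    wordDist S (u * g) (u * h) = wordDist S g h := by
  simp only [wordDist, mul_assoc, mul_right_inj]

namespace AreQuasiInverse

variable {Γ X : Type*} [Group Γ] [PseudoMetricSpace X] {S : Set Γ} {lam eps del kap : ℝ}
  {ψ : Γ → X} {ω : X → Γ}

theorem dist_quasiAction_one_le (h : AreQuasiInverse (wordDist S) dist lam eps del kap ψ ω)
    (x : X) : dist x (quasiAction ψ ω 1 x) ≤ kap := by
  simpa [quasiAction] using h.right_inv x

theorem dist_quasiAction_mul_le (h : AreQuasiInverse (wordDist S) dist lam eps del kap ψ ω)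
    (u v : Γ) (x : X) :
    dist (quasiAction ψ ω (u * v) x) (quasiAction ψ ω u (quasiAction ψ ω v x)) ≤
      lam * kap + eps := by
  have h1 := h.quasiIsometry.upper (u * (v * ω x)) (u * ω (ψ (v * ω x)))
  rw [wordDist_mul_left] at h1
  have h2 := mul_le_mul_of_nonneg_left (h.left_inv (v * ω x)) h.quasiIsometry.lam_pos.le
  rw [quasiAction, mul_assoc]
  exact h1.trans (by linarith)

theorem dist_quasiAction_le (h : AreQuasiInverse (wordDist S) dist lam eps del kap ψ ω)
    (u : Γ) (x y : X) : dist (quasiAction ψ ω u x) (quasiAction ψ ω u y) ≤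
      lam ^ 2 * dist x y + (lam * eps + eps) := by
  have h1 := h.quasiIsometry.upper (u * ω x) (u * ω y)
  rw [wordDist_mul_left] at h1
  have h2 := mul_le_mul_of_nonneg_left (h.quasiIsometry_inv.upper x y) h.quasiIsometry.lam_pos.le
  exact h1.trans (by linarith)

theorem areCoarseInverse_quasiAction
    (h : AreQuasiInverse (wordDist S) dist lam eps del kap ψ ω) (u : Γ) :
    AreCoarseInverse (max 1 (lam ^ 2)) (|lam * eps + eps| + |lam * kap + eps + kap|)
      (quasiAction ψ ω u) (quasiAction ψ ω u⁻¹) := by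
  have hlip : ∀ u x y, dist (quasiAction ψ ω u x) (quasiAction ψ ω u y) ≤
      max 1 (lam ^ 2) * dist x y + (|lam * eps + eps| + |lam * kap + eps + kap|) := by
    intro u x y
    have h1 := h.dist_quasiAction_le u x y
    have h2 := mul_le_mul_of_nonneg_right (le_max_right 1 (lam ^ 2)) (dist_nonneg (x := x) (y := y))
    have h3 := le_abs_self (lam * eps + eps)
    have h4 := abs_nonneg (lam * kap + eps + kap)
    linarith
  have hinv : ∀ u v, u * v = 1 → ∀ x, dist (quasiAction ψ ω u (quasiAction ψ ω v x)) x ≤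
      |lam * eps + eps| + |lam * kap + eps + kap| := by
    intro u v huv x
    have h1 := h.dist_quasiAction_mul_le u v x
    have h2 := h.dist_quasiAction_one_le x
    rw [huv] at h1
    have h3 := dist_triangle_left (quasiAction ψ ω u (quasiAction ψ ω v x)) x (quasiAction ψ ω 1 x)
    rw [dist_comm x] at h2
    have h4 := le_abs_self (lam * kap + eps + kap)
    have h5 := abs_nonneg (lam * eps + eps)
    linarith
  exact ⟨le_max_left _ _, by positivity, hlip u, hlip u⁻¹, hinv _ _ (mul_inv_cancel u),
    hinv _ _ (inv_mul_cancel u)⟩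

end AreQuasiInverse

theorem dist_horizontalPart_le {C : ℝ} {φ : H2R → H2R} (hφ : ∀ x, dist x (φ x) ≤ C)
    (z : UpperHalfPlane) : dist z (horizontalPart φ z) ≤ C :=
  (H2R.dist_fst_le (H2R.mk z 0) (φ (H2R.mk z 0))).trans (hφ _)

/-- Composing horizontal parts resets the height to `0` in between; the bound on fibres makes this
harmless. -/
theorem dist_horizontalPart_comp_le {K C : ℝ} {φ : H2R → H2R}
    (hφ : ∀ z s t, dist (H2R.slice φ s z) (H2R.slice φ t z) ≤ C) {θ χ : H2R → H2R}
    (hχ : ∀ x, dist (χ x) (φ (θ x)) ≤ K) (z : UpperHalfPlane) :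
    dist (horizontalPart φ (horizontalPart θ z)) (horizontalPart χ z) ≤ C + K := by
  have h1 := hφ (θ (H2R.mk z 0)).fst 0 (θ (H2R.mk z 0)).snd
  have h2 := (H2R.dist_fst_le _ _).trans (hχ (H2R.mk z 0))
  rw [dist_comm] at h2
  exact (dist_triangle _ _ _).trans (add_le_add h1 h2)

theorem corollary3p7 {Γ : Type*} [Group Γ] (S : Set Γ) (hS_fin : S.Finite)
    (hS_inv : ∀ a ∈ S, a⁻¹ ∈ S) (hS_gen : Subgroup.closure S = ⊤)
    (lam eps del kap : ℝ) (ψ : Γ → H2R) (ω : H2R → Γ)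
    (hψω : AreQuasiInverse (wordDist S) dist lam eps del kap ψ ω) :
    ∃ (F : Subgroup (BoundaryH2 ≃ₜ BoundaryH2)) (Ξ : Γ →* F),
      (∀ (u : Γ) (b : BoundaryH2 → BoundaryH2),
        HasBoundaryValues (horizontalPart (quasiAction ψ ω u)) b ↔
          b = ((Ξ u : BoundaryH2 ≃ₜ BoundaryH2) : BoundaryH2 → BoundaryH2)) ∧
      (∀ g : BoundaryH2 ≃ₜ BoundaryH2,
        g ∈ F ↔ ∃ u : Γ, HasBoundaryValues (horizontalPart (quasiAction ψ ω u)) g) ∧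
      Function.Surjective Ξ ∧
      IsUniformlyQuasisymmetric F := by
  obtain ⟨L, K, M, hM⟩ := exists_isMorseMap_slice (max 1 (lam ^ 2))
    (|lam * eps + eps| + |lam * kap + eps + kap|)
  obtain ⟨C, -, hC⟩ := exists_fibre_bound (max 1 (lam ^ 2))
    (|lam * eps + eps| + |lam * kap + eps + kap|)
  have hf : ∀ u, IsMorseMap L K M (horizontalPart (quasiAction ψ ω u)) := fun u =>
    hM _ _ (hψω.areCoarseInverse_quasiAction u) 0
  choose b hb using fun u => (hf u).exists_extendsContinuouslyBy
  have hone : b 1 = id :=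
    (hb 1).unique (ExtendsContinuouslyBy.id.of_dist_le
      (dist_horizontalPart_le hψω.dist_quasiAction_one_le))
  have hmul : ∀ u v, b (u * v) = b u ∘ b v := fun u v =>
    (hb (u * v)).unique (((hb u).comp (hb v)).of_dist_le
      (dist_horizontalPart_comp_le
        (hC _ _ (hψω.areCoarseInverse_quasiAction u)) (hψω.dist_quasiAction_mul_le u v)))
  have hinv : ∀ u v, u * v = 1 → ∀ x, b u (b v x) = x := fun u v huv x => by
    rw [← Function.comp_apply (f := b u), ← hmul, huv, hone, id]
  let Θ : Γ →* (BoundaryH2 ≃ₜ BoundaryH2) :=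
    { toFun := fun u =>
        { toFun := b u
          invFun := b u⁻¹
          left_inv := hinv _ _ (inv_mul_cancel u)
          right_inv := hinv _ _ (mul_inv_cancel u)
          continuous_toFun := (hb u).continuous
          continuous_invFun := (hb u⁻¹).continuous }
      map_one' := Homeomorph.ext fun x => congrFun hone x
      map_mul' := fun u v => Homeomorph.ext fun x => congrFun (hmul u v) x }
  -- Existence and uniqueness of the boundary values in one equality of predicates, so that `F` can
  -- be taken as the range of `Θ`.
  have hΘ : ∀ u, HasBoundaryValues (horizontalPart (quasiAction ψ ω u)) = (· = ⇑(Θ u)) :=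
    fun u => funext fun c => propext ((hf u).hasBoundaryValues_iff (hb u))
  refine ⟨Θ.range, Θ.rangeRestrict, fun u c => by rw [hΘ]; rfl, fun g => ?_,
    Θ.rangeRestrict_surjective,
    64 * (16 * (1 + 32 * (Real.exp (M 1) * Real.exp (M 1))) ^ 2), ?_⟩
  · simp only [hΘ, MonoidHom.mem_range]
    exact exists_congr fun u => ⟨fun h => by rw [h], fun h => (Homeomorph.ext (congrFun h)).symm⟩
  · rintro _ ⟨u, rfl⟩
    exact (hf u).isQuasisymmetric (hb u)
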